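/- For $a,b,w\in\mathbb{C}$ with $b\notin\{0,-1,-2,\dots\}$ let ${}_1F_1(a;b;w)=\sum_{n=0}^{\infty}\frac{(a)_n}{(b)_n}\frac{w^n}{n!}$, where $(a)_n=a(a+1)\cdots(a+n-1)$, and let $\eta(s)=\pi^{-s/2}\,\Gamma(s/2)\,\zeta(s)$, where $\zeta$ is the Riemann zeta function. Let $\{c_j\}_{j\ge 1}$ be a sequence of nonzero real numbers with $\sum_{j=1}^{\infty}|c_j|<\infty$, and let $\{\lambda_j\}_{j\ge 1}$ be a bounded sequence of distinct real numbers that attains its bounds, i.e. both $\sup_j\lambda_j$ and $\inf_j\lambda_j$ are values of the sequence. Let $\mathfrak{D}$ be the set of all $z\in\mathbb{C}$ such that $$|\mathrm{Re}(z)-\mathrm{Im}(z)|<\sqrt{\tfrac{\pi}{2}}-\sqrt{\tfrac{2}{\pi}}\,\mathrm{Re}(z)\,\mathrm{Im}(z).$$ Then for every $z\in\mathfrak{D}$ the series $$F_z(s)=\sum_{j=1}^{\infty}c_j\,\eta(s+i\lambda_j)\left\{{}_1F_1\!\left(\frac{1-(s+i\lambda_j)}{2};\frac12;\frac{z^2}{4}\right)+{}_1F_1\!\left(\frac{1-(\bar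 s-i\lambda_j)}{2};\frac12;\frac{\bar z^2}{4}\right)\right\}$$ converges absolutely at every point $s$ of the critical line $\mathrm{Re}(s)=\frac12$, and the function $F_z$ has infinitely many zeros on this line. -/

import Mathlib

/-- The completed zeta function `η(s) = π^(-s/2) Γ(s/2) ζ(s)`. -/
noncomputable def shiftEta (s : ℂ) : ℂ :=
  (Real.pi : ℂ) ^ (-s / 2) * Complex.Gamma (s / 2) * riemannZeta s

/-- The confluent hypergeometric function `₁F₁(a; b; w) = ∑ₙ (a)ₙ wⁿ / ((b)ₙ n!)`, where `(a)ₙ` is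
the rising factorial `a (a + 1) ⋯ (a + n - 1)`. -/
noncomputable def confluentHyp (a b w : ℂ) : ℂ :=
  ∑' n : ℕ, (ascPochhammer ℂ n).eval a * w ^ n / ((ascPochhammer ℂ n).eval b * (n.factorial : ℂ))

/-- The region `|Re z - Im z| < √(π/2) - √(2/π) Re z Im z` of the complex plane. -/
def regionD : Set ℂ :=
  {z | |z.re - z.im| < Real.sqrt (Real.pi / 2) - Real.sqrt (2 / Real.pi) * z.re * z.im}

/-- The `j`-th term of the series defining `F_z(s)`. -/
noncomputable def shiftTerm (c lam : ℕ → ℝ) (z s : ℂ) (j : ℕ) : ℂ :=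
  (c j : ℂ) * shiftEta (s + Complex.I * (lam j : ℂ)) *
    (confluentHyp ((1 - (s + Complex.I * (lam j : ℂ))) / 2) (1 / 2) (z ^ 2 / 4) +
      confluentHyp ((1 - ((starRingEnd ℂ) s - Complex.I * (lam j : ℂ))) / 2) (1 / 2)
        ((starRingEnd ℂ) z ^ 2 / 4))

/-- The function `F_z(s)`, the sum of the series with the above terms. -/
noncomputable def shiftF (c lam : ℕ → ℝ) (z s : ℂ) : ℂ :=
  ∑' j : ℕ, shiftTerm c lam z s j

open Complex Filter Topology MeasureTheory Set
open scoped Real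

/-! On the critical line the two hypergeometric factors are complex conjugates and `shiftEta` is
real, so each term of `F_z(1/2 + it)` is `c j * g (t + lam j)` with one real function `g`. Taking
Mellin transforms of the cosine theta series in the variable `x = exp y` shows that `g` is the
Fourier transform of the kernel `h = shiftKernel z`, holomorphic and exponentially decaying in `|Im
y| < π/4` (`lineTransform_thetaKernel`, `shiftTerm_critical`). This gives absolute convergence.

For the zeros, suppose `f(t) = ∑ c j * g (t + lam j)` is nonnegative for large `t`. Fourier
inversion gives `∫ f(t) exp(-ity) dt = 2π E(y) h(y)`, where `E(y) = ∑ c j * exp (i lam j y)`. For `y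
= x + iθ` the weight has modulus `exp (θt)`, so eventual nonnegativity forces `|E h|(x + iθ) ≤ |E
h|(iθ) + C`, uniformly in `x` and `0 ≤ θ < π/4` (`StripDecay.norm_expSum_mul_le`). The function `E`
is almost periodic and not identically zero on the line `Im y = π/4`, so along suitable `ω → ∞` it
is asymptotically bounded away from zero there and no smaller than at `iπ/4`. Hence `h` may not grow
faster near `ω + iπ/4` than near `iπ/4`.

This is what fails. Write `z exp(iπ/4) = 2√π (X + iY)` with `Y > 0` and put `θ = π/4 - ε`. On the
imaginary axis Poisson summation at the cusp `-1` gives `h = O((2 sin ε)^(-1/2) exp(π(Y² cot ε / 2 +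
XY)))` times a sum of Gaussians at half-integers that tends to 0, unless `X` is a half-integer, when
its limiting bound is 1. At real part `log (Y / (2 sin ε))` a single term of each theta series
dominates, with the same exponential, the larger prefactor `√(Y / (2 sin ε))`, and a factor `|1 +
phase|`. Comparison yields `√Y κ ≤ u + v` (`shiftKernel_growth_le`), where `κ` bounds `|1 + phase|`
below and `u`, `v` are the limits for `-X` and `X`. This is absurd if `κ > 0` and `u = v = 0`, or if
`κ = 2`, `u = v = 1` and `Y > 1`.

Conjugating `z` interchanges `X` and `Y` and reverses `t`, and `z ↦ -z` changes both signs;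
membership in `regionD` gives `4Y² < (1 - 2|X|)²`, which puts `z` or its conjugate in one of these
cases. The remaining points are `z = 0`, treated by a polynomial version of the comparison, and
exceptional points where `h`, hence `F_z`, vanishes identically. Otherwise `f`, and `-f` by the same
argument, is negative at arbitrarily large arguments, and the intermediate value theorem gives
infinitely many zeros. Reversing `t` turns the minimum of the frequencies into a maximum, which is
why both bounds must be attained. -/

/-! ### The cosine theta series: inversion and decay -/

/-- The theta series `∑ₙ exp (-π n² x²) cos (√π n q x)` over the integers. -/
noncomputable def cosTheta (q x : ℂ) : ℂ :=
  jacobiTheta₂ (q * x / (2 * (√π : ℝ))) (I * x ^ 2)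

lemma ofReal_sqrt_pi_sq : ((√π : ℝ) : ℂ) ^ 2 = π := by
  rw [← ofReal_pow, Real.sq_sqrt Real.pi_pos.le]

lemma ofReal_sqrt_pi_ne_zero : ((√π : ℝ) : ℂ) ≠ 0 := by
  exact_mod_cast (Real.sqrt_pos.2 Real.pi_pos).ne'

lemma I_mul_sq_im (x : ℂ) : (I * x ^ 2).im = (x ^ 2).re := by simp

lemma cosTheta_neg (q x : ℂ) : cosTheta (-q) x = cosTheta q x := by
  rw [cosTheta, neg_mul, neg_div, jacobiTheta₂_neg_left, cosTheta]

lemma cosTheta_conj (q x : ℂ) :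
    (starRingEnd ℂ) (cosTheta q x) = cosTheta ((starRingEnd ℂ) q) ((starRingEnd ℂ) x) := by
  rw [cosTheta, jacobiTheta₂_conj, cosTheta]
  congr 1
  · simp [map_ofNat]
  · simp

/-- Jacobi's functional equation. The principal square root of `x⁻¹ ^ 2` is `x⁻¹` because `Re x >
0`, and inversion turns the parameter `q` into `I * q`. -/
lemma cosTheta_inv (q : ℂ) {x : ℂ} (hx : 0 < x.re) :
    cosTheta q x⁻¹ = x * exp (-q ^ 2 / 4) * cosTheta (I * q) x := by
  have hx0 : x ≠ 0 := by rintro rfl; simp at hx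
  have hs := ofReal_sqrt_pi_ne_zero
  have hp := ofReal_sqrt_pi_sq
  rw [cosTheta, jacobiTheta₂_functional_equation]
  have h1 : (-I * (I * x⁻¹ ^ 2)) = (x⁻¹) ^ 2 := by
    rw [← mul_assoc]; simp
  have h2 : ((x⁻¹) ^ 2) ^ (1 / 2 : ℂ) = x⁻¹ := by
    have : (1 / 2 : ℂ) = ((2 : ℕ) : ℂ)⁻¹ := by norm_num
    rw [this]
    have h3 : 0 < (x⁻¹).re := by
      rw [inv_re]; exact div_pos hx (normSq_pos.2 hx0)
    apply pow_cpow_nat_inv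
    · norm_num
    · have := (abs_arg_lt_pi_div_two_iff.2 (Or.inl h3))
      rw [abs_lt] at this
      simp; linarith [this.1]
    · have := (abs_arg_lt_pi_div_two_iff.2 (Or.inl h3))
      rw [abs_lt] at this
      simp; linarith [this.2]
  rw [h1, h2, one_div, inv_inv]
  have h4 : -π * I * (q * x⁻¹ / (2 * (√π : ℝ))) ^ 2 / (I * x⁻¹ ^ 2) = -q ^ 2 / 4 := by
    rw [div_pow, mul_pow, mul_pow, hp]
    have : (π : ℂ) ≠ 0 := by exact_mod_cast Real.pi_ne_zero
    field_simp
    norm_num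
  have h5 : q * x⁻¹ / (2 * (√π : ℝ)) / (I * x⁻¹ ^ 2) = -((I * q) * x / (2 * (√π : ℝ))) := by
    field_simp
    rw [I_sq]; ring
  have h6 : -1 / (I * x⁻¹ ^ 2) = I * x ^ 2 := by
    field_simp
    rw [I_sq]
  rw [h4, h5, h6, jacobiTheta₂_neg_left]
  rfl

lemma differentiableAt_cosTheta (q : ℂ) {x : ℂ} (hx : 0 < (x ^ 2).re) :
    DifferentiableAt ℂ (cosTheta q) x := by
  have h := hasFDerivAt_jacobiTheta₂ (q * x / (2 * (√π : ℝ))) (τ := I * x ^ 2)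
    (by rwa [I_mul_sq_im])
  have h2 : DifferentiableAt ℂ (fun x : ℂ => ((q * x / (2 * (√π : ℝ)), I * x ^ 2) : ℂ × ℂ)) x := by
    fun_prop
  exact DifferentiableAt.comp x (f := fun x : ℂ => ((q * x / (2 * (√π : ℝ)), I * x ^ 2) : ℂ × ℂ))
    (g := fun p : ℂ × ℂ => jacobiTheta₂ p.1 p.2) h.differentiableAt h2

lemma hasSum_cosTheta_sub_one (q : ℂ) {x : ℂ} (hx : 0 < (x ^ 2).re) :
    HasSum (fun n : ℕ => 2 * exp (-π * (n + 1) ^ 2 * x ^ 2) * cos ((√π : ℝ) * (n + 1) * x * q))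
      (cosTheta q x - 1) := by
  have h := (hasSum_jacobiTheta₂_term (q * x / (2 * (√π : ℝ))) (τ := I * x ^ 2)
    (by rwa [I_mul_sq_im])).nat_add_neg
  rw [← hasSum_nat_add_iff' 1] at h
  have hv : jacobiTheta₂ (q * x / (2 * (√π : ℝ))) (I * x ^ 2)
      + jacobiTheta₂_term 0 (q * x / (2 * (√π : ℝ))) (I * x ^ 2)
      - ∑ i ∈ Finset.range 1, (jacobiTheta₂_term (i : ℤ) (q * x / (2 * (√π : ℝ))) (I * x ^ 2)
        + jacobiTheta₂_term (-(i : ℤ)) (q * x / (2 * (√π : ℝ))) (I * x ^ 2))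
      = cosTheta q x - 1 := by
    simp [jacobiTheta₂_term, cosTheta]
  rw [hv] at h
  refine h.congr_fun fun n => ?_
  simp only [jacobiTheta₂_term, Complex.cos]
  have e1 : 2 * ↑π * I * ((n + 1 : ℕ) : ℤ) * (q * x / (2 * ((√π : ℝ) : ℂ)))
      + ↑π * I * (((n + 1 : ℕ) : ℤ) : ℂ) ^ 2 * (I * x ^ 2)
      = (-π * (n + 1) ^ 2 * x ^ 2) + ((√π : ℝ) * (n + 1) * x * q) * I := by
    have hs := ofReal_sqrt_pi_ne_zero
    rw [← ofReal_sqrt_pi_sq]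
    push_cast
    field_simp
    linear_combination (x ^ 2 * ((√π : ℝ) : ℂ)) * (n + 1 : ℂ) * I_sq
  have e2 : 2 * ↑π * I * ((-((n + 1 : ℕ) : ℤ) : ℤ) : ℂ) * (q * x / (2 * ((√π : ℝ) : ℂ)))
      + ↑π * I * ((-((n + 1 : ℕ) : ℤ) : ℤ) : ℂ) ^ 2 * (I * x ^ 2)
      = (-π * (n + 1) ^ 2 * x ^ 2) + -((√π : ℝ) * (n + 1) * x * q) * I := by
    have hs := ofReal_sqrt_pi_ne_zero
    rw [← ofReal_sqrt_pi_sq]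
    push_cast
    field_simp
    linear_combination (x ^ 2 * ((√π : ℝ) : ℂ)) * (n + 1 : ℂ) * I_sq
  rw [e1, e2, Complex.exp_add, Complex.exp_add]
  ring

lemma norm_cos_le (w : ℂ) : ‖cos w‖ ≤ Real.exp |w.im| := by
  rw [Complex.cos, norm_div]
  have h1 : ‖exp (w * I)‖ ≤ Real.exp |w.im| := by
    rw [norm_exp]; apply Real.exp_le_exp.2; simp; exact neg_le_abs _
  have h2 : ‖exp (-w * I)‖ ≤ Real.exp |w.im| := by
    rw [norm_exp]; apply Real.exp_le_exp.2; simp; exact le_abs_self _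
  have := norm_add_le (exp (w * I)) (exp (-w * I))
  simp only [norm_ofNat]
  linarith

/-- In a closed sector where `Re x²` is comparable to `‖x‖²`, the Gaussian factors beat the
exponential growth of the cosines, uniformly in `x`. -/
lemma norm_cosTheta_sub_one_le (q : ℂ) {a : ℝ} (ha : 0 < a) :
    ∃ C : ℝ, 0 < C ∧ ∀ x : ℂ, 1 ≤ ‖x‖ → a * ‖x‖ ^ 2 ≤ (x ^ 2).re →
      ‖cosTheta q x - 1‖ ≤ C * Real.exp (-a * ‖x‖ ^ 2) := by
  set b := √π * ‖q‖ with hb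
  have hb0 : 0 ≤ b := by positivity
  have hS : Summable fun n : ℕ => 2 * (Real.exp (b ^ 2 / a) * Real.exp (-a * (n + 1))) := by
    refine (Summable.mul_left _ ?_).mul_left _
    have := (Real.summable_exp_nat_mul_of_ge (c := -a) (by linarith) (f := fun n => n + 1)
      (fun i => by simp))
    simpa using this
  refine ⟨∑' n : ℕ, 2 * (Real.exp (b ^ 2 / a) * Real.exp (-a * (n + 1))),
    hS.tsum_pos (fun n => by positivity) 0 (by positivity), fun x hx hxa => ?_⟩
  have hre : 0 < (x ^ 2).re := lt_of_lt_of_le (by positivity) hxa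
  rw [← (hasSum_cosTheta_sub_one q hre).tsum_eq, ← tsum_mul_right]
  refine tsum_of_norm_bounded (hS.mul_right _).hasSum fun n => ?_
  rw [norm_mul, norm_mul, norm_exp, norm_ofNat]
  suffices key : Real.exp (-π * (n + 1) ^ 2 * x ^ 2 : ℂ).re * ‖cos ((√π : ℝ) * (n + 1) * x * q)‖ ≤
      Real.exp (b ^ 2 / a) * Real.exp (-a * (n + 1)) * Real.exp (-a * ‖x‖ ^ 2) by linarith
  have h1 : (-π * (n + 1) ^ 2 * x ^ 2 : ℂ).re = -π * (n + 1) ^ 2 * (x ^ 2).re := by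
    rw [show (-π * (n + 1) ^ 2 * x ^ 2 : ℂ) = ((-π * (n + 1) ^ 2 : ℝ) : ℂ) * x ^ 2 by push_cast; ring,
      re_ofReal_mul]
  have h2 : |((√π : ℝ) * (n + 1) * x * q : ℂ).im| ≤ b * ((n + 1) * ‖x‖) := by
    refine (abs_im_le_norm _).trans (le_of_eq ?_)
    have : ‖(n + 1 : ℂ)‖ = n + 1 := by exact_mod_cast norm_natCast (n + 1)
    rw [norm_mul, norm_mul, norm_mul, this, norm_real, Real.norm_of_nonneg (Real.sqrt_nonneg π), hb]
    ring
  rw [h1]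
  refine (mul_le_mul_of_nonneg_left ((norm_cos_le _).trans (Real.exp_le_exp.2 h2))
    (Real.exp_pos _).le).trans ?_
  rw [← Real.exp_add, ← Real.exp_add, ← Real.exp_add]
  apply Real.exp_le_exp.2
  set m : ℝ := (n + 1) * ‖x‖ with hm
  -- Since `π > 3` the Gaussian exponent supplies `3 a m²`: one share absorbs the cosine up to the
  -- constant `b² / a`, one gives geometric decay in `n`, one gives the decay in `‖x‖`.
  have k1 : b * m ≤ b ^ 2 / a + a * m ^ 2 := by
    have : b ^ 2 / a + a * m ^ 2 - b * m = ((b - a * m / 2) ^ 2 + 3 / 4 * (a * m) ^ 2) / a := by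
      field_simp; ring
    have : 0 ≤ b ^ 2 / a + a * m ^ 2 - b * m := by rw [this]; positivity
    linarith
  have hn : (1 : ℝ) ≤ n + 1 := by simp
  have k2 : 3 * (a * m ^ 2) ≤ π * (n + 1) ^ 2 * (x ^ 2).re := by
    have : a * m ^ 2 ≤ (n + 1) ^ 2 * (x ^ 2).re := by
      rw [hm, mul_pow]; nlinarith [sq_nonneg (n + 1 : ℝ)]
    nlinarith [Real.pi_gt_three, mul_nonneg (sq_nonneg (n + 1 : ℝ)) hre.le]
  have k3 : a * (n + 1) ≤ a * m ^ 2 := by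
    rw [hm, mul_pow]
    apply mul_le_mul_of_nonneg_left _ ha.le
    nlinarith [one_le_pow₀ (n := 2) hx, sq_nonneg ((n : ℝ) + 1)]
  have k4 : a * ‖x‖ ^ 2 ≤ a * m ^ 2 := by
    rw [hm, mul_pow]
    apply mul_le_mul_of_nonneg_left _ ha.le
    nlinarith [one_le_pow₀ (n := 2) hn, sq_nonneg ‖x‖]
  nlinarith

/-! ### The theta kernel in the strip `|Im y| < π/4` -/

/-- The theta series in the exponential variable, with its polar parts removed. -/
noncomputable def thetaKernel (q y : ℂ) : ℂ :=
  exp (y / 2) * (cosTheta q (exp y) - 1) - exp (-q ^ 2 / 4) * exp (-y / 2)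

/-- Inversion interchanges the two subtracted polar parts, so the functional equation becomes an
exact reflection. It transports decay to the left half of the strip and yields the conjugation
formula for the transform. -/
lemma thetaKernel_neg (q : ℂ) {y : ℂ} (hy : |y.im| < π / 2) :
    thetaKernel q (-y) = exp (-q ^ 2 / 4) * thetaKernel (I * q) y := by
  have hre : 0 < (exp y).re := by
    rw [exp_re]
    exact mul_pos (Real.exp_pos _) (Real.cos_pos_of_mem_Ioo ⟨by linarith [(abs_lt.1 hy).1],
      by linarith [(abs_lt.1 hy).2]⟩)
  have e1 : exp (-y / 2) * exp y = exp (y / 2) := by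
    rw [← exp_add]; congr 1; ring
  have e2 : exp (-q ^ 2 / 4) * exp (-(I * q) ^ 2 / 4) = 1 := by
    rw [← exp_add, mul_pow, I_sq, exp_eq_one_iff]
    exact ⟨0, by push_cast; ring⟩
  have e3 : exp (-(-y) / 2) = exp (y / 2) := by rw [neg_neg]
  rw [thetaKernel, thetaKernel, exp_neg, cosTheta_inv q hre, e3]
  linear_combination (exp (-q ^ 2 / 4) * cosTheta (I * q) (exp y)) * e1 + exp (-y / 2) * e2

lemma thetaKernel_neg_left (q y : ℂ) : thetaKernel (-q) y = thetaKernel q y := by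
  rw [thetaKernel, thetaKernel, cosTheta_neg, neg_sq]

lemma thetaKernel_conj (q y : ℂ) :
    (starRingEnd ℂ) (thetaKernel q y) =
      thetaKernel ((starRingEnd ℂ) q) ((starRingEnd ℂ) y) := by
  simp only [thetaKernel, map_sub, map_mul, map_one, ← exp_conj, cosTheta_conj, map_div₀, map_neg,
    map_pow, map_ofNat]

lemma exp_sq_re (y : ℂ) : (exp y ^ 2).re = ‖exp y‖ ^ 2 * Real.cos (2 * y.im) := by
  rw [← exp_nat_mul, exp_re, norm_exp, ← Real.exp_nat_mul]
  simp

lemma exp_sq_re_pos {y : ℂ} (hy : |y.im| < π / 4) : 0 < (exp y ^ 2).re := by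
  rw [exp_sq_re]
  refine mul_pos (pow_pos (norm_pos_iff.2 (exp_ne_zero y)) 2) (Real.cos_pos_of_mem_Ioo ⟨?_, ?_⟩)
  · linarith [(abs_lt.1 hy).1]
  · linarith [(abs_lt.1 hy).2]

lemma differentiableAt_thetaKernel (q : ℂ) {y : ℂ} (hy : |y.im| < π / 4) :
    DifferentiableAt ℂ (thetaKernel q) y := by
  have h1 : DifferentiableAt ℂ (fun y => cosTheta q (exp y)) y :=
    DifferentiableAt.comp y (differentiableAt_cosTheta q (exp_sq_re_pos hy)) differentiableAt_exp
  unfold thetaKernel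
  fun_prop

/-- Holomorphy in the strip `|Im y| < π / 4` with exponential decay on closed substrips. -/
structure StripDecay (h : ℂ → ℂ) : Prop where
  differentiableAt : ∀ y : ℂ, |y.im| < π / 4 → DifferentiableAt ℂ h y
  bound : ∀ θ : ℝ, θ < π / 4 → ∃ C : ℝ, 0 ≤ C ∧
    ∀ y : ℂ, |y.im| ≤ θ → ‖h y‖ ≤ C * Real.exp (-|y.re| / 2)

lemma StripDecay.add {h k : ℂ → ℂ} (hh : StripDecay h) (hk : StripDecay k) :
    StripDecay (fun y => h y + k y) where
  differentiableAt y hy := (hh.differentiableAt y hy).add (hk.differentiableAt y hy)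
  bound θ hθ := by
    obtain ⟨C, hC, h1⟩ := hh.bound θ hθ
    obtain ⟨D, hD, h2⟩ := hk.bound θ hθ
    refine ⟨C + D, by positivity, fun y hy => ?_⟩
    rw [add_mul]
    exact norm_add_le_of_le (h1 y hy) (h2 y hy)

lemma StripDecay.const_mul {h : ℂ → ℂ} (hh : StripDecay h) (a : ℂ) :
    StripDecay (fun y => a * h y) where
  differentiableAt y hy := (hh.differentiableAt y hy).const_mul a
  bound θ hθ := by
    obtain ⟨C, hC, h1⟩ := hh.bound θ hθ
    refine ⟨‖a‖ * C, by positivity, fun y hy => ?_⟩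
    rw [norm_mul, mul_assoc]
    exact mul_le_mul_of_nonneg_left (h1 y hy) (norm_nonneg _)

lemma norm_thetaKernel_le_of_re_nonneg (q : ℂ) {θ : ℝ} (hθ : θ < π / 4) :
    ∃ C : ℝ, 0 ≤ C ∧ ∀ y : ℂ, 0 ≤ y.re → |y.im| ≤ θ →
      ‖thetaKernel q y‖ ≤ C * Real.exp (-y.re / 2) := by
  rcases lt_or_ge θ 0 with h0 | h0
  · exact ⟨0, le_rfl, fun y _ hy => absurd hy (by linarith [abs_nonneg y.im])⟩
  set a := Real.cos (2 * θ) with ha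
  have ha0 : 0 < a := Real.cos_pos_of_mem_Ioo ⟨by linarith [Real.pi_pos], by linarith⟩
  obtain ⟨C, hC, hb⟩ := norm_cosTheta_sub_one_le q ha0
  refine ⟨C / a + ‖exp (-q ^ 2 / 4)‖, by positivity, fun y hy hi => ?_⟩
  have hx : 1 ≤ ‖exp y‖ := by rw [norm_exp]; exact Real.one_le_exp hy
  have hx2 : a * ‖exp y‖ ^ 2 ≤ (exp y ^ 2).re := by
    rw [exp_sq_re, mul_comm, ha]
    refine mul_le_mul_of_nonneg_left ?_ (by positivity)
    rw [← Real.cos_abs (2 * y.im), abs_mul, abs_two]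
    apply Real.cos_le_cos_of_nonneg_of_le_pi (by positivity) (by linarith [Real.pi_pos]) (by linarith)
  have h1 := hb _ hx hx2
  have h2 : ‖exp (y / 2)‖ = Real.exp (y.re / 2) := by rw [norm_exp]; simp
  have h3 : ‖exp (-y / 2)‖ = Real.exp (-y.re / 2) := by rw [norm_exp]; simp
  have h4 : Real.exp (-a * ‖exp y‖ ^ 2) ≤ Real.exp (-y.re) / a := by
    rw [norm_exp, le_div_iff₀ ha0]
    have k1 : a * Real.exp y.re ≤ Real.exp (a * Real.exp y.re) := by
      linarith [Real.add_one_le_exp (a * Real.exp y.re)]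
    have k2 : Real.exp (-a * Real.exp y.re ^ 2) ≤ Real.exp (-(a * Real.exp y.re)) := by
      apply Real.exp_le_exp.2
      have := Real.one_le_exp hy
      nlinarith [mul_nonneg ha0.le (Real.exp_pos y.re).le]
    calc Real.exp (-a * Real.exp y.re ^ 2) * a ≤ Real.exp (-(a * Real.exp y.re)) * a := by gcongr
      _ = Real.exp (-(a * Real.exp y.re)) * (a * Real.exp y.re) * Real.exp (-y.re) := by
        rw [Real.exp_neg y.re]; field_simp
      _ ≤ Real.exp (-(a * Real.exp y.re)) * Real.exp (a * Real.exp y.re) * Real.exp (-y.re) := by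
        gcongr
      _ = Real.exp (-y.re) := by rw [← Real.exp_add]; simp
  rw [thetaKernel]
  refine (norm_sub_le _ _).trans ?_
  rw [norm_mul, norm_mul, h2, h3, add_mul]
  refine add_le_add_left ?_ _
  calc Real.exp (y.re / 2) * ‖cosTheta q (exp y) - 1‖
      ≤ Real.exp (y.re / 2) * (C * (Real.exp (-y.re) / a)) := by
        gcongr; exact h1.trans (by gcongr)
    _ = C / a * (Real.exp (y.re / 2) * Real.exp (-y.re)) := by ring
    _ = C / a * Real.exp (-y.re / 2) := by rw [← Real.exp_add]; ring_nf

lemma stripDecay_thetaKernel (q : ℂ) : StripDecay (thetaKernel q) where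
  differentiableAt y hy := differentiableAt_thetaKernel q hy
  bound θ hθ := by
    obtain ⟨C, hC, h1⟩ := norm_thetaKernel_le_of_re_nonneg q hθ
    obtain ⟨D, hD, h2⟩ := norm_thetaKernel_le_of_re_nonneg (I * q) hθ
    refine ⟨max C (‖exp (-q ^ 2 / 4)‖ * D), le_max_of_le_left hC, fun y hy => ?_⟩
    rcases le_total 0 y.re with h | h
    · rw [abs_of_nonneg h]
      exact (h1 y h hy).trans (by gcongr; exact le_max_left _ _)
    · rw [abs_of_nonpos h]
      have hy' : |(-y).im| < π / 2 := by
        rw [neg_im, abs_neg]; linarith [Real.pi_pos]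
      have := thetaKernel_neg q hy'
      rw [neg_neg] at this
      rw [this, norm_mul]
      have h3 := h2 (-y) (by simpa using h) (by simpa using hy)
      rw [neg_re] at h3
      calc ‖exp (-q ^ 2 / 4)‖ * ‖thetaKernel (I * q) (-y)‖
          ≤ ‖exp (-q ^ 2 / 4)‖ * (D * Real.exp (- -y.re / 2)) := by gcongr
        _ = (‖exp (-q ^ 2 / 4)‖ * D) * Real.exp (- -y.re / 2) := by ring
        _ ≤ _ := by gcongr; exact le_max_right _ _

/-! ### Contour shifts and Fourier inversion in the strip -/

lemma integrable_exp_neg_mul_abs {a : ℝ} (ha : 0 < a) :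
    Integrable fun x : ℝ => Real.exp (-a * |x|) := by
  rw [← integrableOn_univ, ← Iic_union_Ioi (a := (0 : ℝ))]
  refine IntegrableOn.union ?_ ?_
  · refine (integrableOn_exp_mul_Iic ha 0).congr_fun (fun x hx => ?_) measurableSet_Iic
    simp only [abs_of_nonpos (show x ≤ 0 from hx)]
    ring_nf
  · refine (integrableOn_exp_mul_Ioi (neg_lt_zero.2 ha) 0).congr_fun (fun x hx => ?_)
      measurableSet_Ioi
    simp only [abs_of_pos (show 0 < x from hx)]

namespace StripDecay

variable {h : ℂ → ℂ}

lemma mul_exp (hh : StripDecay h) (u : ℝ) : StripDecay (fun y => h y * exp (I * u * y)) where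
  differentiableAt y hy := (hh.differentiableAt y hy).mul (by fun_prop)
  bound θ hθ := by
    obtain ⟨C, hC, h1⟩ := hh.bound θ hθ
    refine ⟨C * Real.exp (|u| * θ), by positivity, fun y hy => ?_⟩
    rw [norm_mul, norm_exp, mul_right_comm C]
    refine mul_le_mul (h1 y hy) (Real.exp_le_exp.2 ?_) (Real.exp_pos _).le (by positivity)
    have : (I * u * y).re = -(u * y.im) := by simp [mul_re]
    rw [this]
    refine (neg_le_abs _).trans ?_
    rw [abs_mul]
    gcongr

lemma continuous_line (hh : StripDecay h) {θ : ℝ} (hθ : |θ| < π / 4) :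
    Continuous fun x : ℝ => h (x + θ * I) := by
  refine continuous_iff_continuousAt.2 fun x => ?_
  have h1 : ContinuousAt h (x + θ * I) := (hh.differentiableAt _ (by simpa using hθ)).continuousAt
  exact ContinuousAt.comp (f := fun x : ℝ => (x + θ * I : ℂ)) h1 (by fun_prop)

lemma integrable_line (hh : StripDecay h) {θ : ℝ} (hθ : |θ| < π / 4) :
    Integrable fun x : ℝ => h (x + θ * I) := by
  obtain ⟨C, hC, h1⟩ := hh.bound _ hθ
  refine ((integrable_exp_neg_mul_abs (a := 1 / 2) (by norm_num)).const_mul C).mono'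
    (hh.continuous_line hθ).aestronglyMeasurable (Eventually.of_forall fun x => ?_)
  refine (h1 _ (by simp)).trans (le_of_eq ?_)
  simp
  ring_nf
  simp

lemma integral_line_eq (hh : StripDecay h) {θ : ℝ} (hθ : |θ| < π / 4) :
    ∫ x : ℝ, h (x + θ * I) = ∫ x : ℝ, h x := by
  obtain ⟨C, hC, hb⟩ := hh.bound _ hθ
  have h0 : |(0 : ℝ)| < π / 4 := by simpa using Real.pi_pos
  have hi0 : Integrable fun x : ℝ => h x := by simpa using hh.integrable_line h0
  have t1 := intervalIntegral_tendsto_integral (hh.integrable_line hθ) tendsto_neg_atTop_atBot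
    (tendsto_id (α := ℝ))
  have t0 := intervalIntegral_tendsto_integral hi0 tendsto_neg_atTop_atBot (tendsto_id (α := ℝ))
  have hrect : ∀ T : ℝ, (∫ x : ℝ in (-T)..T, h x) - (∫ x : ℝ in (-T)..T, h (x + θ * I)) =
      I • (∫ y : ℝ in (0 : ℝ)..θ, h ((-T : ℝ) + y * I)) -
        I • (∫ y : ℝ in (0 : ℝ)..θ, h (T + y * I)) := by
    intro T
    have := integral_boundary_rect_eq_zero_of_differentiableOn h (-T : ℝ) (T + θ * I) (by
      intro y hy
      refine (hh.differentiableAt y ?_).differentiableWithinAt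
      have := hy.2
      simp only [ofReal_im, add_im, mul_im, ofReal_re, I_im, mul_one, I_re, mul_zero, add_zero,
        zero_add, mem_preimage] at this
      have h3 : |y.im - 0| ≤ |θ - 0| := abs_sub_left_of_mem_uIcc this
      rw [sub_zero, sub_zero] at h3
      exact h3.trans_lt hθ)
    simp only [ofReal_re, ofReal_im, add_re, mul_re, I_re, I_im, mul_zero, mul_one, sub_zero,
      add_zero, add_im, mul_im, zero_add, ofReal_zero, zero_mul] at this
    linear_combination this
  have hvert : ∀ T : ℝ, ‖∫ y : ℝ in (0 : ℝ)..θ, h (T + y * I)‖ ≤ C * Real.exp (-|T| / 2) * |θ| := by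
    intro T
    have := intervalIntegral.norm_integral_le_of_norm_le_const (a := 0) (b := θ)
      (f := fun y : ℝ => h (T + y * I)) (C := C * Real.exp (-|T| / 2)) (fun y hy => by
        have h2 := hb (T + y * I) (by
          have h3 : |y - 0| ≤ |θ - 0| := abs_sub_left_of_mem_uIcc (uIoc_subset_uIcc hy)
          simpa using h3)
        simpa using h2)
    simpa using this
  have hzero : Tendsto (fun T : ℝ => C * Real.exp (-|T| / 2) * |θ|) atTop (𝓝 0) := by
    have : Tendsto (fun T : ℝ => -|T| / 2) atTop atBot :=
      (tendsto_neg_atTop_atBot.comp tendsto_abs_atTop_atTop).atBot_div_const (by norm_num)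
    simpa using ((Real.tendsto_exp_atBot.comp this).const_mul C).mul_const |θ|
  have v1 : Tendsto (fun T : ℝ => ∫ y : ℝ in (0 : ℝ)..θ, h (T + y * I)) atTop (𝓝 0) :=
    squeeze_zero_norm hvert hzero
  have v2 : Tendsto (fun T : ℝ => ∫ y : ℝ in (0 : ℝ)..θ, h ((-T : ℝ) + y * I)) atTop (𝓝 0) :=
    squeeze_zero_norm (fun T => by simpa using hvert (-T)) hzero
  have hd := (t0.sub t1).congr hrect
  have hd2 := (v2.const_smul I).sub (v1.const_smul I)
  have := tendsto_nhds_unique hd hd2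
  rw [smul_zero, sub_zero, sub_eq_zero] at this
  exact this.symm

end StripDecay

/-- The Fourier transform `u ↦ ∫ h(y) exp (i u y) dy` along the real line. -/
noncomputable def lineTransform (h : ℂ → ℂ) (u : ℝ) : ℂ := ∫ x : ℝ, h x * exp (I * u * x)

namespace StripDecay

variable {h : ℂ → ℂ}

lemma lineTransform_eq (hh : StripDecay h) {θ : ℝ} (hθ : |θ| < π / 4) (u : ℝ) :
    lineTransform h u = ∫ x : ℝ, h (x + θ * I) * exp (I * u * (x + θ * I)) :=
  ((hh.mul_exp u).integral_line_eq hθ).symm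

lemma norm_lineTransform_le (hh : StripDecay h) {θ : ℝ} (hθ : |θ| < π / 4) :
    ∃ C : ℝ, 0 ≤ C ∧ ∀ u : ℝ, ‖lineTransform h u‖ ≤ C * Real.exp (-(θ * u)) := by
  refine ⟨∫ x : ℝ, ‖h (x + θ * I)‖, integral_nonneg fun _ => norm_nonneg _, fun u => ?_⟩
  rw [hh.lineTransform_eq hθ, ← integral_mul_const]
  refine (norm_integral_le_integral_norm _).trans (le_of_eq (integral_congr_ae
    (Eventually.of_forall fun x => ?_)))
  simp only [norm_mul, norm_exp]
  congr 2
  simp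
  ring

lemma continuous_lineTransform (hh : StripDecay h) : Continuous (lineTransform h) := by
  have h0 : |(0 : ℝ)| < π / 4 := by simpa using Real.pi_pos
  have hi0 : Integrable fun x : ℝ => h x := by simpa using hh.integrable_line h0
  have hc0 : Continuous fun x : ℝ => h x := by simpa using hh.continuous_line h0
  refine continuous_of_dominated (bound := fun x => ‖h x‖) (fun u => ?_)
    (fun u => Eventually.of_forall fun x => ?_) hi0.norm (Eventually.of_forall fun x => ?_)
  · exact (hc0.mul (by fun_prop)).aestronglyMeasurable
  · rw [norm_mul, norm_exp]
    simp
  · fun_prop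

lemma norm_lineTransform_mul_exp_le (hh : StripDecay h) {θ : ℝ} (hθ : |θ| < π / 4) :
    ∃ C a : ℝ, 0 ≤ C ∧ 0 < a ∧
      ∀ u : ℝ, ‖lineTransform h u‖ * Real.exp (θ * u) ≤ C * Real.exp (-a * |u|) := by
  -- A height strictly between `|θ|` and `π/4`: shifting the contour to `η` for `u ≥ 0` and to `-η`
  -- for `u ≤ 0` leaves decay at rate `η - |θ|` after the weight `exp (θ u)`.
  set η := (|θ| + π / 4) / 2 with hη
  have h1 : |η| < π / 4 := by rw [abs_of_nonneg (by positivity)]; linarith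
  obtain ⟨C, hC, hb⟩ := hh.norm_lineTransform_le h1
  obtain ⟨D, hD, hb'⟩ := hh.norm_lineTransform_le (θ := -η) (by rwa [abs_neg])
  refine ⟨max C D, η - |θ|, le_max_of_le_left hC, by rw [hη]; linarith, fun u => ?_⟩
  rcases le_total 0 u with hu | hu
  · calc _ ≤ C * Real.exp (-(η * u)) * Real.exp (θ * u) := by gcongr; exact hb u
      _ = C * Real.exp (-(η * u) + θ * u) := by rw [Real.exp_add, mul_assoc]
      _ ≤ _ := by
        rw [abs_of_nonneg hu]
        gcongr
        · exact le_max_left _ _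
        · nlinarith [le_abs_self θ]
  · calc _ ≤ D * Real.exp (-(-η * u)) * Real.exp (θ * u) := by gcongr; exact hb' u
      _ = D * Real.exp (-(-η * u) + θ * u) := by rw [Real.exp_add, mul_assoc]
      _ ≤ _ := by
        rw [abs_of_nonpos hu]
        gcongr
        · exact le_max_right _ _
        · nlinarith [neg_le_abs θ]

lemma integrable_lineTransform_mul_exp (hh : StripDecay h) {y : ℂ} (hy : |y.im| < π / 4) :
    Integrable fun u : ℝ => lineTransform h u * exp (-(I * u * y)) := by
  obtain ⟨C, a, hC, ha, hb⟩ := hh.norm_lineTransform_mul_exp_le hy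
  refine ((integrable_exp_neg_mul_abs ha).const_mul C).mono'
    (hh.continuous_lineTransform.mul (by fun_prop)).aestronglyMeasurable
    (Eventually.of_forall fun u => ?_)
  rw [norm_mul, norm_exp]
  refine le_trans (le_of_eq ?_) (hb u)
  congr 2
  simp
  ring

lemma integral_lineTransform_mul_exp (hh : StripDecay h) {y : ℂ} (hy : |y.im| < π / 4) :
    ∫ u : ℝ, lineTransform h u * exp (-(I * u * y)) = 2 * π * h y := by
  -- The inversion is done along the horizontal line through `y`: the contour shift identifies the
  -- transform of `F` with that of `h` up to the factor `exp (y.im * u)`, where `u = -2 * π * w`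
  -- reconciles the normalisations.
  set F : ℝ → ℂ := fun x => h (x + y.im * I) with hF
  have hFT : FourierTransform.fourier F =
      fun w : ℝ => lineTransform h (-2 * π * w) * exp ((y.im : ℂ) * (-2 * π * w : ℝ)) := by
    ext w
    rw [Real.fourier_real_eq_integral_exp_smul, hh.lineTransform_eq hy, ← integral_mul_const]
    congr 1
    ext x
    rw [smul_eq_mul, mul_comm, mul_assoc (h _), ← Complex.exp_add]
    congr 2
    push_cast
    linear_combination (2 * π * w * y.im : ℂ) * I_sq
  set G : ℝ → ℂ := fun u => lineTransform h u * exp (-(I * u * y)) with hG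
  have hGi : Integrable G := hh.integrable_lineTransform_mul_exp hy
  have hFi : Integrable (FourierTransform.fourier F) := by
    have h1 : Integrable fun u : ℝ => lineTransform h u * exp ((y.im : ℂ) * u) := by
      have := hh.integrable_lineTransform_mul_exp (y := y.im * I) (by simpa using hy)
      refine this.congr (Eventually.of_forall fun u => ?_)
      simp only
      congr 2
      linear_combination (-(u * y.im : ℂ)) * I_sq
    rw [hFT]
    exact h1.comp_mul_left' (R := -2 * π) (by simp [Real.pi_ne_zero])
  have hinv := (hh.continuous_line hy).fourierInv_fourier_eq (hh.integrable_line hy) hFi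
  have h2 := congrFun hinv y.re
  rw [Real.fourierInv_eq', hFT, re_add_im] at h2
  rw [← h2]
  have h3 := Measure.integral_comp_mul_left G (-2 * π)
  have h4 : |(-2 * π : ℝ)⁻¹| = (2 * π)⁻¹ := by
    rw [abs_inv, abs_mul, abs_neg, abs_two, abs_of_pos Real.pi_pos]
  rw [h4] at h3
  have h5 : (∫ w : ℝ, exp (((2 * π * inner ℝ w y.re : ℝ) : ℂ) * I) •
      (lineTransform h (-2 * π * w) * exp ((y.im : ℂ) * (-2 * π * w : ℝ)))) =
      ∫ w : ℝ, G (-2 * π * w) := by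
    congr 1
    ext w
    rw [hG, smul_eq_mul, mul_left_comm, ← Complex.exp_add]
    congr 2
    have e : (inner ℝ w y.re : ℝ) = w * y.re := by simp [mul_comm]
    have hy' : y = y.re + y.im * I := (re_add_im y).symm
    rw [e]
    conv_rhs => rw [hy']
    push_cast
    linear_combination (-(2 * π * w * y.im : ℂ)) * I_sq
  rw [h5, h3, real_smul]
  have : (π : ℂ) ≠ 0 := by exact_mod_cast Real.pi_ne_zero
  push_cast
  field_simp

end StripDecay

/-! ### Mellin transform of the Gaussian cosine -/

/-- The function `exp (-r²) cos (q r)`. -/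
noncomputable def gaussCos (q : ℂ) (r : ℝ) : ℂ := exp (-(r : ℂ) ^ 2) * cos (q * r)

lemma continuous_gaussCos (q : ℂ) : Continuous (gaussCos q) := by
  unfold gaussCos; fun_prop

lemma norm_gaussCos_le (q : ℂ) : ∃ C : ℝ, ∀ r : ℝ, 0 ≤ r → ‖gaussCos q r‖ ≤ C * Real.exp (-1 * r) := by
  refine ⟨Real.exp ((‖q‖ + 1) ^ 2), fun r hr => ?_⟩
  rw [gaussCos, norm_mul, norm_exp]
  have h1 : ‖cos (q * r)‖ ≤ Real.exp (‖q‖ * r) := by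
    refine (norm_cos_le _).trans (Real.exp_le_exp.2 ((abs_im_le_norm _).trans ?_))
    rw [norm_mul, norm_real, Real.norm_of_nonneg hr]
  have h2 : (-(r : ℂ) ^ 2).re = -r ^ 2 := by norm_cast
  rw [h2]
  calc _ ≤ Real.exp (-r ^ 2) * Real.exp (‖q‖ * r) := by gcongr
    _ ≤ _ := by
      rw [← Real.exp_add, ← Real.exp_add]
      apply Real.exp_le_exp.2
      nlinarith [sq_nonneg (r - (‖q‖ + 1)), sq_nonneg (‖q‖ + 1), mul_nonneg hr (norm_nonneg q), sq_nonneg r]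

lemma gaussCos_isBigO_atTop (q : ℂ) : gaussCos q =O[atTop] fun t => Real.exp (-1 * t) := by
  obtain ⟨C, hC⟩ := norm_gaussCos_le q
  refine Asymptotics.IsBigO.of_bound C ?_
  filter_upwards [eventually_ge_atTop 0] with r hr
  rw [Real.norm_of_nonneg (Real.exp_pos _).le]
  exact hC r hr

lemma gaussCos_isBigO_zero (q : ℂ) : gaussCos q =O[𝓝[>] 0] fun t : ℝ => t ^ (-(0 : ℝ)) := by
  simp only [neg_zero, Real.rpow_zero]
  exact (((continuous_gaussCos q).tendsto 0).mono_left nhdsWithin_le_nhds).isBigO_one ℝ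

lemma mellinConvergent_gaussCos (q : ℂ) {s : ℂ} (hs : 0 < s.re) :
    MellinConvergent (gaussCos q) s :=
  mellinConvergent_of_isBigO_rpow_exp one_pos
    ((continuous_gaussCos q).locallyIntegrable.locallyIntegrableOn _) (gaussCos_isBigO_atTop q)
    (gaussCos_isBigO_zero q) hs

lemma differentiableAt_mellin_gaussCos (q : ℂ) {s : ℂ} (hs : 0 < s.re) :
    DifferentiableAt ℂ (mellin (gaussCos q)) s :=
  mellin_differentiableAt_of_isBigO_rpow_exp one_pos
    ((continuous_gaussCos q).locallyIntegrable.locallyIntegrableOn _) (gaussCos_isBigO_atTop q)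
    (gaussCos_isBigO_zero q) hs

lemma integral_cpow_mul_exp_neg_sq {s : ℂ} (hs : 0 < s.re) :
    ∫ r : ℝ in Ioi 0, (r : ℂ) ^ (s - 1) * exp (-(r : ℂ) ^ 2) = Gamma (s / 2) / 2 := by
  have h := mellin_comp_rpow (fun t : ℝ => (Real.exp (-t) : ℂ)) s 2
  have h2 : mellin (fun t : ℝ => (Real.exp (-t) : ℂ)) (s / (2 : ℝ)) = Gamma (s / 2) := by
    rw [← GammaIntegral_eq_mellin, Gamma_eq_integral]
    · simp
    · simpa using hs
  rw [h2] at h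
  have h3 : mellin (fun t : ℝ => ((Real.exp (-t ^ (2 : ℝ)) : ℝ) : ℂ)) s =
      ∫ r : ℝ in Ioi 0, (r : ℂ) ^ (s - 1) * exp (-(r : ℂ) ^ 2) := by
    unfold mellin
    congr 1
    ext r
    simp
  rw [← h3, h]
  rw [abs_two, real_smul]
  push_cast
  ring

lemma ascPochhammer_eval_mul_Gamma {a : ℂ} (ha : 0 < a.re) (n : ℕ) :
    (ascPochhammer ℂ n).eval a * Gamma a = Gamma (a + n) := by
  induction n with
  | zero => simp
  | succ n ih =>
    have h0 : a + n ≠ 0 := by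
      intro h
      have := congrArg re h
      simp at this
      have : (0 : ℝ) ≤ n := n.cast_nonneg
      linarith
    rw [ascPochhammer_succ_right, Polynomial.eval_mul, mul_right_comm, ih]
    push_cast
    rw [← add_assoc, Gamma_add_one _ h0]
    simp [mul_comm]

lemma factorial_two_mul_eq_ascPochhammer (n : ℕ) :
    ((2 * n).factorial : ℂ) = 4 ^ n * (ascPochhammer ℂ n).eval (1 / 2) * n.factorial := by
  induction n with
  | zero => simp
  | succ n ih =>
    rw [ascPochhammer_succ_right, Polynomial.eval_mul, show 2 * (n + 1) = 2 * n + 1 + 1 by ring,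
      Nat.factorial_succ, Nat.factorial_succ, Nat.factorial_succ]
    push_cast
    rw [ih]
    simp
    ring

/-- The cosine is expanded and integrated term by term against Gamma integrals; `(2n)! = 4^n (1/2)_n
n!` turns the result into the hypergeometric series. The dominating series is the cosh series,
itself a Gaussian cosine with parameter `I * ‖q‖`. -/
lemma mellin_gaussCos (q : ℂ) {s : ℂ} (hs : 0 < s.re) :
    mellin (gaussCos q) s = Gamma (s / 2) / 2 * confluentHyp (s / 2) (1 / 2) (-q ^ 2 / 4) := by
  have hI : ∀ r : ℝ, gaussCos (I * ‖q‖) r = ((Real.exp (-r ^ 2) * Real.cosh (‖q‖ * r) : ℝ) : ℂ) := by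
    intro r
    rw [gaussCos, mul_assoc, mul_comm I, Complex.cos_mul_I]
    push_cast
    rfl
  have hcosh : ∀ r : ℝ, HasSum (fun n : ℕ => r ^ (s.re - 1) * (Real.exp (-r ^ 2) *
      ((‖q‖ * r) ^ (2 * n) / (2 * n).factorial)))
      (r ^ (s.re - 1) * (Real.exp (-r ^ 2) * Real.cosh (‖q‖ * r))) :=
    fun r => ((Real.hasSum_cosh (‖q‖ * r)).mul_left _).mul_left _
  have key := hasSum_integral_of_dominated_convergence (μ := volume.restrict (Ioi (0 : ℝ)))
    (F := fun (n : ℕ) (r : ℝ) => (r : ℂ) ^ (s - 1) * (exp (-(r : ℂ) ^ 2) *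
      ((-1) ^ n * (q * r) ^ (2 * n) / (2 * n).factorial)))
    (f := fun r : ℝ => (r : ℂ) ^ (s - 1) • gaussCos q r)
    (fun (n : ℕ) (r : ℝ) => r ^ (s.re - 1) * (Real.exp (-r ^ 2) *
      ((‖q‖ * r) ^ (2 * n) / (2 * n).factorial)))
    (fun n => by
      refine ContinuousOn.aestronglyMeasurable ?_ measurableSet_Ioi
      refine ContinuousOn.mul ?_ (by fun_prop)
      intro r hr
      exact (continuousAt_ofReal_cpow_const r (s - 1) (Or.inr (ne_of_gt hr))).continuousWithinAt)
    (fun n => by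
      filter_upwards [ae_restrict_mem measurableSet_Ioi] with r hr
      have hr' : (0 : ℝ) < r := hr
      rw [norm_mul, norm_cpow_eq_rpow_re_of_pos hr', norm_mul, norm_div, norm_mul, norm_pow, norm_pow,
        norm_neg, norm_one, one_pow, one_mul, norm_mul, norm_natCast, norm_exp, norm_real,
        Real.norm_of_nonneg hr'.le]
      apply le_of_eq
      congr 3
      norm_cast)
    (Eventually.of_forall fun r => (hcosh r).summable)
    (by
      have h1 : IntegrableOn (fun r : ℝ => (r : ℂ) ^ ((s.re : ℂ) - 1) • gaussCos (I * ‖q‖) r) (Ioi 0) :=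
        mellinConvergent_gaussCos (I * ‖q‖) (s := s.re) (by simpa using hs)
      refine h1.norm.congr ?_
      filter_upwards [ae_restrict_mem measurableSet_Ioi] with r hr
      have hr' : (0 : ℝ) < r := hr
      rw [(hcosh r).tsum_eq, hI, norm_smul, norm_cpow_eq_rpow_re_of_pos hr', norm_real,
        Real.norm_of_nonneg (by have := Real.cosh_pos (‖q‖ * r); positivity)]
      simp)
    (Eventually.of_forall fun r => by
      rw [smul_eq_mul, gaussCos]
      exact ((Complex.hasSum_cos (q * r)).mul_left _).mul_left _)
  have hterm : ∀ n : ℕ, ∫ r : ℝ in Ioi 0, (r : ℂ) ^ (s - 1) * (exp (-(r : ℂ) ^ 2) *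
      ((-1) ^ n * (q * r) ^ (2 * n) / (2 * n).factorial)) =
      Gamma (s / 2) / 2 * ((ascPochhammer ℂ n).eval (s / 2) * (-q ^ 2 / 4) ^ n /
        ((ascPochhammer ℂ n).eval (1 / 2) * n.factorial)) := by
    intro n
    have h1 : ∀ r ∈ Ioi (0 : ℝ), (r : ℂ) ^ (s - 1) * (exp (-(r : ℂ) ^ 2) *
        ((-1) ^ n * (q * r) ^ (2 * n) / (2 * n).factorial)) =
        ((-1) ^ n * q ^ (2 * n) / (2 * n).factorial) *
          ((r : ℂ) ^ (s + 2 * n - 1) * exp (-(r : ℂ) ^ 2)) := by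
      intro r hr
      have hr' : (r : ℂ) ≠ 0 := by exact_mod_cast (ne_of_gt hr)
      have : (r : ℂ) ^ (s + 2 * n - 1) = (r : ℂ) ^ (s - 1) * (r : ℂ) ^ (2 * n) := by
        rw [show s + 2 * n - 1 = (s - 1) + ((2 * n : ℕ) : ℂ) by push_cast; ring, cpow_add _ _ hr',
          cpow_natCast]
      rw [this, mul_pow]
      ring
    rw [setIntegral_congr_fun measurableSet_Ioi h1, integral_const_mul,
      integral_cpow_mul_exp_neg_sq (by simp; positivity),
      show (s + 2 * n) / 2 = s / 2 + n by ring,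
      ← ascPochhammer_eval_mul_Gamma (by simpa using hs), factorial_two_mul_eq_ascPochhammer]
    have e : (-q ^ 2 / 4) ^ n = (-1) ^ n * q ^ (2 * n) / 4 ^ n := by
      rw [pow_mul, ← mul_pow, ← div_pow]; ring
    rw [e]
    have h4 : (4 : ℂ) ^ n ≠ 0 := pow_ne_zero _ (by norm_num)
    field_simp
  simp_rw [hterm] at key
  rw [mellin, ← key.tsum_eq, tsum_mul_left]
  rfl

/-! ### Mellin transform of the theta series, continued to the critical strip -/

lemma cosTheta_term_eq_gaussCos (q : ℂ) (n : ℕ) (x : ℝ) :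
    exp (-π * (n + 1) ^ 2 * (x : ℂ) ^ 2) * cos ((√π : ℝ) * (n + 1) * x * q) =
      gaussCos q (√π * (n + 1) * x) := by
  rw [gaussCos]
  push_cast
  congr 2
  · rw [mul_pow, mul_pow, ofReal_sqrt_pi_sq]; ring
  · ring

lemma ofReal_sq_re_pos {x : ℝ} (hx : 0 < x) : 0 < ((x : ℂ) ^ 2).re := by
  norm_cast
  positivity

lemma continuousAt_cosTheta_ofReal (q : ℂ) {x : ℝ} (hx : 0 < x) :
    ContinuousAt (fun x : ℝ => cosTheta q x) x :=
  ContinuousAt.comp (f := fun x : ℝ => (x : ℂ))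
    (differentiableAt_cosTheta q (ofReal_sq_re_pos hx)).continuousAt (by fun_prop)

lemma locallyIntegrableOn_cosTheta (q : ℂ) :
    LocallyIntegrableOn (fun x : ℝ => cosTheta q x) (Ioi 0) :=
  ContinuousOn.locallyIntegrableOn
    (fun _ hx => (continuousAt_cosTheta_ofReal q hx).continuousWithinAt) measurableSet_Ioi

lemma cosTheta_sub_one_isBigO (q : ℂ) (r : ℝ) :
    (fun x : ℝ => cosTheta q x - 1) =O[atTop] fun x : ℝ => x ^ r := by
  obtain ⟨C, hC, hb⟩ := norm_cosTheta_sub_one_le q one_pos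
  refine Asymptotics.IsBigO.trans (g := fun x : ℝ => Real.exp (-1 * x)) ?_
    (isLittleO_exp_neg_mul_rpow_atTop one_pos r).isBigO
  refine Asymptotics.IsBigO.of_bound C ?_
  filter_upwards [eventually_ge_atTop 1] with x hx
  have hn : ‖(x : ℂ)‖ = x := by rw [norm_real, Real.norm_of_nonneg (by linarith)]
  have hre : ((x : ℂ) ^ 2).re = x ^ 2 := by norm_cast
  refine (hb x (by rwa [hn]) (by rw [hn, hre]; simp)).trans ?_
  rw [hn, Real.norm_of_nonneg (Real.exp_pos _).le]
  refine mul_le_mul_of_nonneg_left (Real.exp_le_exp.2 ?_) hC.le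
  nlinarith

/-- The functional-equation pair of the theta series `cosTheta q`. -/
noncomputable def cosThetaPair (q : ℂ) : WeakFEPair ℂ where
  f x := cosTheta q x
  g x := cosTheta (I * q) x
  k := 1
  ε := exp (-q ^ 2 / 4)
  f₀ := 1
  g₀ := 1
  hf_int := locallyIntegrableOn_cosTheta q
  hg_int := locallyIntegrableOn_cosTheta (I * q)
  hk := one_pos
  hε := exp_ne_zero _
  h_feq x hx := by
    have := cosTheta_inv q (x := x) (by simpa using hx)
    simp only [one_div, ofReal_inv, this, Real.rpow_one, smul_eq_mul]
    ring
  hf_top r := cosTheta_sub_one_isBigO q r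
  hg_top r := cosTheta_sub_one_isBigO (I * q) r

lemma mellin_cosTheta_sub_one (q : ℂ) {s : ℂ} (hs : 1 < s.re) :
    mellin (fun x : ℝ => cosTheta q x - 1) s =
      2 * (π : ℂ) ^ (-s / 2) * riemannZeta s * mellin (gaussCos q) s := by
  have hs0 : 0 < s.re := by linarith
  have ha : ∀ n : ℕ, 0 < √π * ((n : ℝ) + 1) := fun n => by
    have := Real.sqrt_pos.2 Real.pi_pos
    positivity
  have hmel : ∀ n : ℕ, mellin (fun x : ℝ => gaussCos q (√π * (n + 1) * x)) s =
      (π : ℂ) ^ (-s / 2) * (1 / ((n : ℂ) + 1) ^ s) * mellin (gaussCos q) s := by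
    intro n
    rw [mellin_comp_mul_left _ _ (ha n), smul_eq_mul]
    congr 1
    rw [ofReal_mul, mul_cpow_ofReal_nonneg (Real.sqrt_nonneg _) (by positivity), one_div, ← cpow_neg]
    congr 1
    · rw [Real.sqrt_eq_rpow, ← cpow_mul_ofReal_nonneg Real.pi_pos.le]
      congr 1
      push_cast
      ring
    · push_cast; rfl
  have hint : ∀ n : ℕ, IntegrableOn
      (fun r : ℝ => (r : ℂ) ^ (s - 1) • (2 * gaussCos q (√π * (n + 1) * r))) (Ioi 0) := by
    intro n
    have h1 : MellinConvergent (fun r : ℝ => gaussCos q (√π * (n + 1) * r)) s :=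
      (MellinConvergent.comp_mul_left (ha n)).2 (mellinConvergent_gaussCos q hs0)
    refine (h1.const_mul 2).congr (Eventually.of_forall fun r => ?_)
    simp only [smul_eq_mul]
    ring
  set J := ∫ r : ℝ in Ioi 0, ‖(r : ℂ) ^ (s - 1) * gaussCos q r‖ with hJ
  have hnorm : ∀ n : ℕ, ∫ r : ℝ in Ioi 0, ‖(r : ℂ) ^ (s - 1) • (2 * gaussCos q (√π * (n + 1) * r))‖ =
      2 * (√π * (n + 1)) ^ (-s.re) * J := by
    intro n
    have h1 := integral_comp_mul_left_Ioi (fun r : ℝ => ‖(r : ℂ) ^ (s - 1) * gaussCos q r‖) 0 (ha n)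
    rw [mul_zero, ← hJ, smul_eq_mul] at h1
    have h2 : ∀ r ∈ Ioi (0 : ℝ), ‖(r : ℂ) ^ (s - 1) • (2 * gaussCos q (√π * (n + 1) * r))‖ =
        2 * (√π * (n + 1)) ^ (-s.re + 1) *
          ‖((√π * (n + 1) * r : ℝ) : ℂ) ^ (s - 1) * gaussCos q (√π * (n + 1) * r)‖ := by
      intro r hr
      have hr' : (0 : ℝ) < r := hr
      rw [norm_smul, norm_mul, norm_mul, norm_cpow_eq_rpow_re_of_pos hr',
        norm_cpow_eq_rpow_re_of_pos (mul_pos (ha n) hr'), Real.mul_rpow (ha n).le hr'.le,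
        show -s.re + 1 = -(s - 1).re by simp; ring, Real.rpow_neg (ha n).le]
      have := Real.rpow_pos_of_pos (ha n) (s - 1).re
      simp only [norm_ofNat]
      field_simp
    rw [setIntegral_congr_fun measurableSet_Ioi h2, integral_const_mul, h1,
      Real.rpow_add (ha n), Real.rpow_one]
    have := (ha n).ne'
    field_simp
  have hsum : Summable fun n : ℕ => 2 * (√π * ((n : ℝ) + 1)) ^ (-s.re) * J := by
    refine Summable.mul_right _ (Summable.mul_left _ ?_)
    have h1 : Summable fun n : ℕ => ((n : ℝ) + 1) ^ (-s.re) := by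
      have := (summable_nat_add_iff 1).2 (Real.summable_nat_rpow.2 (show -s.re < -1 by linarith))
      simpa using this
    refine (h1.mul_left (√π ^ (-s.re))).congr fun n => ?_
    rw [Real.mul_rpow (Real.sqrt_nonneg _) (by positivity)]
  have key := hasSum_integral_of_summable_integral_norm hint (by simpa only [hnorm] using hsum)
  have hlhs : mellin (fun x : ℝ => cosTheta q x - 1) s = ∫ r : ℝ in Ioi 0,
      ∑' n : ℕ, (r : ℂ) ^ (s - 1) • (2 * gaussCos q (√π * (n + 1) * r)) := by
    refine setIntegral_congr_fun measurableSet_Ioi fun r hr => ?_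
    have h1 := (hasSum_cosTheta_sub_one q (ofReal_sq_re_pos hr)).mul_left ((r : ℂ) ^ (s - 1))
    simp only [smul_eq_mul]
    rw [← h1.tsum_eq]
    refine tsum_congr fun n => ?_
    rw [mul_assoc 2, cosTheta_term_eq_gaussCos]
  rw [hlhs, ← key.tsum_eq]
  have hterm : ∀ n : ℕ, ∫ r : ℝ in Ioi 0,
      (r : ℂ) ^ (s - 1) • (2 * gaussCos q (√π * (n + 1) * r)) =
      (2 * (π : ℂ) ^ (-s / 2) * mellin (gaussCos q) s) * (1 / ((n : ℂ) + 1) ^ s) := by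
    intro n
    have h1 := hmel n
    rw [mellin] at h1
    rw [show (2 * (π : ℂ) ^ (-s / 2) * mellin (gaussCos q) s) * (1 / ((n : ℂ) + 1) ^ s) =
      2 * ((π : ℂ) ^ (-s / 2) * (1 / ((n : ℂ) + 1) ^ s) * mellin (gaussCos q) s) by ring, ← h1,
      ← integral_const_mul]
    congr 1
    ext r
    simp only [smul_eq_mul]
    ring
  rw [tsum_congr hterm, tsum_mul_left, ← zeta_eq_tsum_one_div_nat_add_one_cpow hs]
  ring

lemma cosThetaPair_Λ_of_one_lt (q : ℂ) {s : ℂ} (hs : 1 < s.re) :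
    (cosThetaPair q).Λ s = 2 * (π : ℂ) ^ (-s / 2) * riemannZeta s * mellin (gaussCos q) s := by
  rw [← mellin_cosTheta_sub_one q hs]
  exact ((cosThetaPair q).hasMellin (by simpa [cosThetaPair] using hs)).2.symm

/-- Both sides agree for `Re s > 1`, where the Mellin integral may be taken termwise. Multiplication
by `s - 1` removes the pole at 1, and the identity theorem on the right half-plane does the rest. -/
lemma cosThetaPair_Λ (q : ℂ) {s : ℂ} (hs : 0 < s.re) (hs1 : s ≠ 1) :
    (cosThetaPair q).Λ s = shiftEta s * confluentHyp (s / 2) (1 / 2) (-q ^ 2 / 4) := by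
  set A : ℂ → ℂ := fun s => (s - 1) * (cosThetaPair q).Λ₀ s - (s - 1) / s + exp (-q ^ 2 / 4) with hA
  set B : ℂ → ℂ := fun s => 2 * ((s - 1) * completedRiemannZeta₀ s - (s - 1) / s + 1) *
    (Gamma (s / 2))⁻¹ * mellin (gaussCos q) s with hB
  have hne : ∀ t : ℂ, 0 < t.re → t ≠ 0 := by rintro t ht rfl; simp at ht
  have hAL : ∀ t : ℂ, t ≠ 1 → A t = (t - 1) * (cosThetaPair q).Λ t := by
    intro t h1
    have h1' : t - 1 ≠ 0 := sub_ne_zero.2 h1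
    have h1'' : 1 - t ≠ 0 := sub_ne_zero.2 h1.symm
    rw [hA, WeakFEPair.Λ]
    simp only [cosThetaPair, ofReal_one, smul_eq_mul, mul_one]
    field_simp
    ring
  have hBL : ∀ t : ℂ, 0 < t.re → t ≠ 1 → B t = (t - 1) *
      (2 * (π : ℂ) ^ (-t / 2) * riemannZeta t * mellin (gaussCos q) t) := by
    intro t h0 h1
    have h1' : t - 1 ≠ 0 := sub_ne_zero.2 h1
    have h1'' : 1 - t ≠ 0 := sub_ne_zero.2 h1.symm
    have hG : Gamma (t / 2) ≠ 0 := Gamma_ne_zero_of_re_pos (by simpa using h0)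
    have hpi : (π : ℂ) ^ (-t / 2) ≠ 0 := by
      rw [Ne, cpow_eq_zero_iff]
      simp [Real.pi_ne_zero]
    rw [hB, riemannZeta_def_of_ne_zero (hne t h0), completedRiemannZeta_eq, Gammaℝ_def]
    have := hne t h0
    field_simp
    ring
  have hU : IsOpen {t : ℂ | 0 < t.re} := isOpen_lt continuous_const continuous_re
  have hconv : IsPreconnected {t : ℂ | 0 < t.re} := (convex_halfSpace_re_gt 0).isPreconnected
  have hAd : AnalyticOnNhd ℂ A {t : ℂ | 0 < t.re} := by
    refine DifferentiableOn.analyticOnNhd (fun t ht => ?_) hU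
    have h1 := (cosThetaPair q).differentiable_Λ₀ t
    have h2 := hne t ht
    refine DifferentiableAt.differentiableWithinAt ?_
    fun_prop (disch := assumption)
  have hBd : AnalyticOnNhd ℂ B {t : ℂ | 0 < t.re} := by
    refine DifferentiableOn.analyticOnNhd (fun t ht => ?_) hU
    have h1 := differentiable_completedZeta₀ t
    have h2 := hne t ht
    have h3 := differentiableAt_mellin_gaussCos q ht
    have h4 : DifferentiableAt ℂ (fun s : ℂ => (Gamma (s / 2))⁻¹) t :=
      DifferentiableAt.comp t (f := fun s : ℂ => s / 2) (differentiable_one_div_Gamma (t / 2))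
        (by fun_prop)
    refine DifferentiableAt.differentiableWithinAt ?_
    fun_prop (disch := assumption)
  have hev : A =ᶠ[𝓝 2] B := by
    filter_upwards [(isOpen_lt continuous_const continuous_re).mem_nhds
      (show (1 : ℝ) < (2 : ℂ).re by norm_num)] with t ht
    have ht' : 1 < t.re := ht
    have h1 : t ≠ 1 := by rintro rfl; simp at ht'
    rw [hAL t h1, hBL t (by linarith) h1, cosThetaPair_Λ_of_one_lt q ht']
  have hAB := hAd.eqOn_of_preconnected_of_eventuallyEq hBd hconv
    (show (2 : ℂ) ∈ {t : ℂ | 0 < t.re} by simp) hev hs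
  rw [hAL s hs1, hBL s hs hs1] at hAB
  rw [mul_left_cancel₀ (sub_ne_zero.2 hs1) hAB, mellin_gaussCos q hs, shiftEta]
  ring

/-- `f_modif` subtracts only 1 beyond `x = 1` and only the polar term before it. Subtracting the
complementary pieces adds `-1/s` and `-c/(1-s)`, exactly the difference between `Λ` and `Λ₀`; both
pieces converge only for `0 < Re s < 1`. -/
lemma mellin_cosTheta_sub_polar (q : ℂ) {s : ℂ} (hs : 0 < s.re) (hs1 : s.re < 1) :
    mellin (fun x : ℝ => cosTheta q x - 1 - exp (-q ^ 2 / 4) * (x : ℂ)⁻¹) s =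
      (cosThetaPair q).Λ s := by
  set c := exp (-q ^ 2 / 4) with hc
  have h1 : HasMellin (cosThetaPair q).f_modif s ((cosThetaPair q).Λ₀ s) :=
    ⟨((cosThetaPair q).isStrongFEPair_toStrongFEPair.hasMellin s).1, rfl⟩
  have h2 : HasMellin (indicator (Ioc 0 1) (fun _ : ℝ => (1 : ℂ))) s (1 / s) := hasMellin_one_Ioc hs
  have hre : (s - 2).re < -1 := by simp; linarith
  have heq : ∀ x ∈ Ioi (1 : ℝ), (x : ℂ) ^ (s - 2) * c = (x : ℂ) ^ (s - 1) • (c * (x : ℂ)⁻¹) := by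
    intro x hx
    have hx0 : (x : ℂ) ≠ 0 := by exact_mod_cast (show x ≠ 0 by linarith [show (1 : ℝ) < x from hx])
    rw [show s - 2 = s - 1 - 1 by ring, cpow_sub _ _ hx0, cpow_one, smul_eq_mul]
    ring
  have hpt : ∀ x : ℝ, (x : ℂ) ^ (s - 1) • (indicator (Ioi 1) (fun x : ℝ => c * (x : ℂ)⁻¹) x) =
      indicator (Ioi 1) (fun x : ℝ => (x : ℂ) ^ (s - 1) • (c * (x : ℂ)⁻¹)) x := fun x => by
    by_cases hx : x ∈ Ioi (1 : ℝ) <;> simp [hx]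
  have h3 : HasMellin (indicator (Ioi 1) (fun x : ℝ => c * (x : ℂ)⁻¹)) s (c / (1 - s)) := by
    have hsub : Ioi (0 : ℝ) ∩ Ioi 1 = Ioi 1 := by
      rw [inter_eq_right]; exact Ioi_subset_Ioi zero_le_one
    constructor
    · rw [MellinConvergent]
      simp_rw [hpt]
      rw [integrableOn_indicator_iff measurableSet_Ioi, inter_comm, hsub]
      exact IntegrableOn.congr_fun ((integrableOn_Ioi_cpow_of_lt hre one_pos).mul_const c) heq
        measurableSet_Ioi
    · rw [mellin]
      simp_rw [hpt]
      rw [setIntegral_indicator measurableSet_Ioi, hsub,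
        ← setIntegral_congr_fun measurableSet_Ioi heq, integral_mul_const,
        integral_Ioi_cpow_of_lt hre one_pos]
      have e1 : s - 1 ≠ 0 := by
        intro h; have := congrArg re h; simp at this; linarith
      have e2 : 1 - s ≠ 0 := by rw [← neg_sub]; exact neg_ne_zero.2 e1
      rw [show s - 2 + 1 = s - 1 by ring, ofReal_one, one_cpow]
      field_simp
      ring
  have h4 := (hasMellin_sub (hasMellin_sub h1.1 h2.1).1 h3.1).2
  rw [(hasMellin_sub h1.1 h2.1).2, h1.2, h2.2, h3.2] at h4
  have h5 : (cosThetaPair q).Λ s = (cosThetaPair q).Λ₀ s - 1 / s - c / (1 - s) := by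
    rw [WeakFEPair.Λ]
    simp [cosThetaPair, hc]
  rw [h5, ← h4, mellin, mellin]
  refine integral_congr_ae ((ae_restrict_iff' measurableSet_Ioi).mpr ?_)
  filter_upwards [compl_mem_ae_iff.mpr (Subsingleton.measure_zero (s := {(1 : ℝ)}) (by simp) volume)]
    with x hx hx0
  have hx1 : x ≠ 1 := hx
  have hx0' : (0 : ℝ) < x := hx0
  congr 1
  rcases lt_or_gt_of_ne hx1 with h | h
  · simp [WeakFEPair.f_modif, cosThetaPair, h, h.le, hx0', h.not_gt, Real.rpow_neg_one, hc]
    ring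
  · simp [WeakFEPair.f_modif, cosThetaPair, h, h.not_ge, h.not_gt]

/-- The Fourier transform of the theta kernel on the real line. -/
theorem lineTransform_thetaKernel (q : ℂ) (u : ℝ) :
    lineTransform (thetaKernel q) u = shiftEta (1 / 2 + I * u) *
      confluentHyp ((1 / 2 + I * u) / 2) (1 / 2) (-q ^ 2 / 4) := by
  set s : ℂ := 1 / 2 + I * u with hs
  have hre : s.re = 1 / 2 := by simp [hs]
  have him : s.im = u := by simp [hs]
  rw [← cosThetaPair_Λ q (by rw [hre]; norm_num) (by
    intro h; rw [h] at hre; norm_num at hre),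
    ← mellin_cosTheta_sub_polar q (by rw [hre]; norm_num) (by rw [hre]; norm_num), mellin_eq_fourier,
    Real.fourier_real_eq_integral_exp_smul, lineTransform, ← integral_neg_eq_self]
  congr 1
  ext x
  rw [hre, him, real_smul, smul_eq_mul, thetaKernel]
  push_cast
  have h2 : exp (-2 * π * (x : ℂ) * (u / (2 * π)) * I) = exp (I * u * -x) := by
    have : (π : ℂ) ≠ 0 := by exact_mod_cast Real.pi_ne_zero
    congr 1
    field_simp
  have h3 : exp (-(1 / 2) * (x : ℂ)) = exp (-x / 2) := by congr 1; ring
  have h4 : exp (-(x : ℂ) / 2) * (exp (-(x : ℂ)))⁻¹ = exp (- -x / 2) := by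
    rw [← exp_neg, ← exp_add]; congr 1; ring
  rw [h2, h3]
  linear_combination (exp (-q ^ 2 / 4) * exp (I * u * -x)) * h4

/-! ### The terms of the series as a real Fourier transform -/

/-- The kernel whose Fourier transform gives the terms of `shiftF`. -/
noncomputable def shiftKernel (z y : ℂ) : ℂ :=
  thetaKernel (I * (starRingEnd ℂ) z) y + exp (z ^ 2 / 4) * thetaKernel z y

lemma stripDecay_shiftKernel (z : ℂ) : StripDecay (shiftKernel z) :=
  (stripDecay_thetaKernel _).add ((stripDecay_thetaKernel z).const_mul _)

lemma StripDecay.integrable_mul_exp {h : ℂ → ℂ} (hh : StripDecay h) (u : ℝ) :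
    Integrable fun x : ℝ => h x * exp (I * u * x) := by
  have h0 : |(0 : ℝ)| < π / 4 := by simpa using Real.pi_pos
  simpa using (hh.mul_exp u).integrable_line h0

/-- Conjugation reverses the sign of `u`; the substitution `x ↦ -x` and the reflection formula of
the kernel restore it. -/
lemma conj_lineTransform_thetaKernel (q : ℂ) (u : ℝ) :
    (starRingEnd ℂ) (lineTransform (thetaKernel q) u) =
      exp (-((starRingEnd ℂ) q) ^ 2 / 4) *
        lineTransform (thetaKernel (I * (starRingEnd ℂ) q)) u := by
  rw [lineTransform, ← integral_conj, lineTransform, ← integral_const_mul, ← integral_neg_eq_self]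
  congr 1
  ext x
  rw [map_mul, thetaKernel_conj, ← exp_conj, conj_ofReal, ← mul_assoc, ofReal_neg,
    thetaKernel_neg _ (by simpa using Real.pi_pos)]
  congr 2
  simp

/-- The weight `exp (z ^ 2 / 4)` in `shiftKernel` is exactly the one that makes its second summand
transform to the conjugate of the first, whence reality. -/
lemma lineTransform_shiftKernel (z : ℂ) (u : ℝ) :
    lineTransform (shiftKernel z) u = lineTransform (thetaKernel (I * (starRingEnd ℂ) z)) u +
      (starRingEnd ℂ) (lineTransform (thetaKernel (I * (starRingEnd ℂ) z)) u) := by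
  rw [conj_lineTransform_thetaKernel]
  have e1 : I * (starRingEnd ℂ) (I * (starRingEnd ℂ) z) = z := by
    simp [← mul_assoc]
  have e2 : -((starRingEnd ℂ) (I * (starRingEnd ℂ) z)) ^ 2 / 4 = z ^ 2 / 4 := by
    simp [mul_pow]
  rw [e1, e2]
  simp only [lineTransform, shiftKernel]
  rw [← integral_const_mul, ← integral_add ((stripDecay_thetaKernel _).integrable_mul_exp u)
    (((stripDecay_thetaKernel z).integrable_mul_exp u).const_mul _)]
  congr 1
  ext x
  ring

lemma lineTransform_shiftKernel_im (z : ℂ) (u : ℝ) : (lineTransform (shiftKernel z) u).im = 0 := by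
  rw [lineTransform_shiftKernel]
  simp

lemma confluentHyp_zero (a b : ℂ) : confluentHyp a b 0 = 1 := by
  rw [confluentHyp, tsum_eq_single 0]
  · simp
  · intro n hn
    simp [hn]

lemma ascPochhammer_eval_conj (n : ℕ) (a : ℂ) :
    (starRingEnd ℂ) ((ascPochhammer ℂ n).eval a) =
      (ascPochhammer ℂ n).eval ((starRingEnd ℂ) a) := by
  induction n with
  | zero => simp
  | succ n ih => simp [ascPochhammer_succ_right, ih]

lemma confluentHyp_conj (a b w : ℂ) :
    (starRingEnd ℂ) (confluentHyp a b w) =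
      confluentHyp ((starRingEnd ℂ) a) ((starRingEnd ℂ) b) ((starRingEnd ℂ) w) := by
  rw [confluentHyp, conj_tsum, confluentHyp]
  simp only [map_div₀, map_mul, map_pow, ascPochhammer_eval_conj, map_natCast]

/-- At `q = 0` the hypergeometric factor is 1 and the conjugation formula reads as reality of
`shiftEta`. -/
lemma shiftEta_conj_critical (u : ℝ) :
    (starRingEnd ℂ) (shiftEta (1 / 2 + I * u)) = shiftEta (1 / 2 + I * u) := by
  have h := lineTransform_thetaKernel 0 u
  have h2 := conj_lineTransform_thetaKernel 0 u
  simp only [ne_eq, OfNat.ofNat_ne_zero, not_false_eq_true, zero_pow, neg_zero, zero_div, map_zero,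
    exp_zero, mul_zero, one_mul, confluentHyp_zero, mul_one] at h h2
  rw [← h, h2]

/-- On `Re s = 1/2` one has `1 - w = conj w` for `w = s + iλ`, so the two hypergeometric values are
conjugate and `shiftEta w` factors out as a real number. -/
lemma shiftTerm_critical (c lam : ℕ → ℝ) (z : ℂ) (t : ℝ) (j : ℕ) :
    shiftTerm c lam z (1 / 2 + I * t) j = c j * lineTransform (shiftKernel z) (t + lam j) := by
  have e1 : (1 / 2 + I * t : ℂ) + I * lam j = 1 / 2 + I * ((t + lam j : ℝ) : ℂ) := by
    push_cast; ring
  have e2 : (1 - (1 / 2 + I * ((t + lam j : ℝ) : ℂ))) / 2 =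
      (starRingEnd ℂ) ((1 / 2 + I * ((t + lam j : ℝ) : ℂ)) / 2) := by
    simp only [map_div₀, map_add, map_mul, map_one, map_ofNat, conj_I, conj_ofReal]
    ring
  have e3 : (1 - ((starRingEnd ℂ) (1 / 2 + I * t) - I * lam j)) / 2 =
      (1 / 2 + I * ((t + lam j : ℝ) : ℂ)) / 2 := by
    simp only [map_div₀, map_add, map_mul, map_one, map_ofNat, conj_I, conj_ofReal]
    push_cast
    ring
  have e4 : -(I * (starRingEnd ℂ) z) ^ 2 / 4 = ((starRingEnd ℂ) z) ^ 2 / 4 := by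
    simp [mul_pow]
  have e5 : z ^ 2 / 4 = (starRingEnd ℂ) (((starRingEnd ℂ) z) ^ 2 / 4) := by
    simp [map_ofNat]
  have e6 : (1 / 2 : ℂ) = (starRingEnd ℂ) (1 / 2) := by simp [map_ofNat]
  rw [shiftTerm, lineTransform_shiftKernel, lineTransform_thetaKernel, map_mul,
    shiftEta_conj_critical, confluentHyp_conj, e1, e2, e3, e4, ← e5, ← e6]
  ring

/-! ### Superpositions of translates and the one-sided sign condition -/

/-- The superposition `∑ⱼ cⱼ g(t + λⱼ)` of translates of the Fourier transform of `h`. -/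
noncomputable def shiftSum (c lam : ℕ → ℝ) (h : ℂ → ℂ) (t : ℝ) : ℂ :=
  ∑' j : ℕ, (c j : ℂ) * lineTransform h (t + lam j)

/-- The exponential sum `∑ⱼ cⱼ exp (i λⱼ y)`. -/
noncomputable def expSum (c lam : ℕ → ℝ) (y : ℂ) : ℂ :=
  ∑' j : ℕ, (c j : ℂ) * exp (I * lam j * y)

section shiftSum

variable {c lam : ℕ → ℝ} {h : ℂ → ℂ} {B : ℝ}

lemma norm_exp_I_mul_le (hB : ∀ j, |lam j| ≤ B) (y : ℂ) (j : ℕ) :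
    ‖exp (I * lam j * y)‖ ≤ Real.exp (B * |y.im|) := by
  rw [norm_exp]
  apply Real.exp_le_exp.2
  have : (I * lam j * y).re = -(lam j * y.im) := by simp [mul_re]
  rw [this]
  refine (neg_le_abs _).trans ?_
  rw [abs_mul]
  gcongr
  exact hB j

lemma StripDecay.norm_lineTransform_bounded (hh : StripDecay h) :
    ∃ C : ℝ, 0 ≤ C ∧ ∀ u : ℝ, ‖lineTransform h u‖ ≤ C := by
  obtain ⟨C, hC, hb⟩ := hh.norm_lineTransform_le (θ := 0) (by simpa using Real.pi_pos)
  exact ⟨C, hC, fun u => by simpa using hb u⟩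

lemma StripDecay.summable_shift (hh : StripDecay h) (hsum : Summable fun j => |c j|) (t : ℝ) :
    Summable fun j => (c j : ℂ) * lineTransform h (t + lam j) := by
  obtain ⟨C, hC, hb⟩ := hh.norm_lineTransform_bounded
  refine Summable.of_norm_bounded (hsum.mul_right C) fun j => ?_
  rw [norm_mul, norm_real, Real.norm_eq_abs]
  gcongr
  exact hb _

lemma StripDecay.continuous_shiftSum (hh : StripDecay h) (hsum : Summable fun j => |c j|) :
    Continuous (shiftSum c lam h) := by
  obtain ⟨C, hC, hb⟩ := hh.norm_lineTransform_bounded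
  refine continuous_tsum (u := fun j => |c j| * C) (fun j => ?_) (hsum.mul_right C) fun j t => ?_
  · exact continuous_const.mul (hh.continuous_lineTransform.comp (by fun_prop))
  · rw [norm_mul, norm_real, Real.norm_eq_abs]
    gcongr
    exact hb _

/-- Translating by a frequency of size at most `B` costs only the constant factor `exp ((a + |θ|) *
B)`, so the decay of a single transform passes to the sum. -/
lemma StripDecay.norm_shiftSum_mul_exp_le (hh : StripDecay h) (hsum : Summable fun j => |c j|)
    (hB : ∀ j, |lam j| ≤ B) {θ : ℝ} (hθ : |θ| < π / 4) :
    ∃ C a : ℝ, 0 ≤ C ∧ 0 < a ∧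
      ∀ t : ℝ, ‖shiftSum c lam h t‖ * Real.exp (θ * t) ≤ C * Real.exp (-a * |t|) := by
  obtain ⟨C, a, hC, ha, hb⟩ := hh.norm_lineTransform_mul_exp_le hθ
  set D := C * Real.exp ((a + |θ|) * B) with hD
  refine ⟨∑' j, |c j| * D, a, tsum_nonneg fun j => by positivity, ha, fun t => ?_⟩
  have hle : ∀ j, ‖(c j : ℂ) * lineTransform h (t + lam j)‖ ≤
      |c j| * (D * Real.exp (-a * |t|) * Real.exp (-(θ * t))) := by
    intro j
    rw [norm_mul, norm_real, Real.norm_eq_abs]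
    gcongr
    have h1 := hb (t + lam j)
    rw [← le_div_iff₀ (Real.exp_pos _)] at h1
    refine h1.trans ?_
    have e1 : D * Real.exp (-a * |t|) * Real.exp (-(θ * t)) =
        C * Real.exp ((a + |θ|) * B + -a * |t| + -(θ * t)) := by
      simp only [hD, Real.exp_add]
      ring
    rw [div_eq_mul_inv, ← Real.exp_neg, e1, mul_assoc, ← Real.exp_add]
    refine mul_le_mul_of_nonneg_left (Real.exp_le_exp.2 ?_) hC
    have h2 : |t| ≤ |t + lam j| + |lam j| := by
      have := abs_sub (t + lam j) (lam j)
      simpa using this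
    have h3 : -(θ * lam j) ≤ |θ| * |lam j| := by rw [← abs_mul]; exact neg_le_abs _
    have h4 := hB j
    nlinarith [abs_nonneg θ]
  have hs := hsum.mul_right (D * Real.exp (-a * |t|) * Real.exp (-(θ * t)))
  have h1 := tsum_of_norm_bounded hs.hasSum hle
  rw [tsum_mul_right] at h1
  calc ‖shiftSum c lam h t‖ * Real.exp (θ * t)
      ≤ ((∑' j, |c j|) * (D * Real.exp (-a * |t|) * Real.exp (-(θ * t)))) * Real.exp (θ * t) := by
        gcongr; exact h1
    _ = (∑' j, |c j|) * D * Real.exp (-a * |t|) * (Real.exp (-(θ * t)) * Real.exp (θ * t)) := by ring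
    _ = _ := by rw [← Real.exp_add, tsum_mul_right]; simp

lemma norm_exp_neg_I_mul (t : ℝ) (y : ℂ) : ‖exp (-(I * t * y))‖ = Real.exp (y.im * t) := by
  rw [norm_exp]
  congr 1
  simp
  ring

lemma StripDecay.integrable_shiftSum_mul_exp (hh : StripDecay h) (hsum : Summable fun j => |c j|)
    (hB : ∀ j, |lam j| ≤ B) {y : ℂ} (hy : |y.im| < π / 4) :
    Integrable fun t : ℝ => shiftSum c lam h t * exp (-(I * t * y)) := by
  obtain ⟨C, a, hC, ha, hb⟩ := hh.norm_shiftSum_mul_exp_le hsum hB hy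
  refine ((integrable_exp_neg_mul_abs ha).const_mul C).mono'
    ((hh.continuous_shiftSum hsum).mul (by fun_prop)).aestronglyMeasurable
    (Eventually.of_forall fun t => ?_)
  rw [norm_mul, norm_exp_neg_I_mul]
  exact hb t

/-- A translation by `lam j` on the transform side is multiplication by `exp (I * lam j * y)` on the
kernel side; the sum of these multipliers is `expSum`. -/
lemma StripDecay.integral_shiftSum_mul_exp (hh : StripDecay h) (hsum : Summable fun j => |c j|)
    (hB : ∀ j, |lam j| ≤ B) {y : ℂ} (hy : |y.im| < π / 4) :
    ∫ t : ℝ, shiftSum c lam h t * exp (-(I * t * y)) = 2 * π * (expSum c lam y * h y) := by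
  set G : ℝ → ℂ := fun u => lineTransform h u * exp (-(I * u * y)) with hG
  have hGi : Integrable G := hh.integrable_lineTransform_mul_exp hy
  have hF : ∀ (j : ℕ) (t : ℝ), (c j : ℂ) * lineTransform h (t + lam j) * exp (-(I * t * y)) =
      (c j * exp (I * lam j * y)) * G (t + lam j) := by
    intro j t
    rw [hG]
    have : exp (-(I * t * y)) = exp (I * lam j * y) * exp (-(I * (t + lam j : ℝ) * y)) := by
      rw [← Complex.exp_add]
      congr 1
      push_cast
      ring
    rw [this]
    ring
  have key := hasSum_integral_of_summable_integral_norm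
    (F := fun (j : ℕ) (t : ℝ) => (c j : ℂ) * lineTransform h (t + lam j) * exp (-(I * t * y)))
    (fun j => by
      simp only [hF]
      exact (hGi.comp_add_right (lam j)).const_mul _)
    (by
      simp only [hF, norm_mul, integral_const_mul]
      have : ∀ j, ∫ t : ℝ, ‖G (t + lam j)‖ = ∫ t : ℝ, ‖G t‖ := fun j =>
        integral_add_right_eq_self (fun t => ‖G t‖) (lam j)
      simp only [this]
      refine Summable.mul_right _ ?_
      refine Summable.of_nonneg_of_le (fun j => by positivity) (fun j => ?_)
        (hsum.mul_right (Real.exp (B * |y.im|)))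
      rw [norm_real, Real.norm_eq_abs]
      gcongr
      exact norm_exp_I_mul_le hB y j)
  have h1 : ∀ t : ℝ, ∑' j : ℕ, (c j : ℂ) * lineTransform h (t + lam j) * exp (-(I * t * y)) =
      shiftSum c lam h t * exp (-(I * t * y)) := fun t => tsum_mul_right
  simp only [h1] at key
  rw [← key.tsum_eq]
  simp only [hF, integral_const_mul]
  have : ∀ j, ∫ t : ℝ, G (t + lam j) = 2 * π * h y := fun j => by
    rw [integral_add_right_eq_self G (lam j)]
    exact hh.integral_lineTransform_mul_exp hy
  simp only [this]
  rw [tsum_mul_right, expSum]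
  ring

/-- If a superposition of translates is eventually nonnegative, then its Fourier-Laplace transform
is dominated on each horizontal line by its value on the imaginary axis. -/
theorem StripDecay.norm_expSum_mul_le (hh : StripDecay h) (hsum : Summable fun j => |c j|)
    (hB : ∀ j, |lam j| ≤ B) (him : ∀ t, (shiftSum c lam h t).im = 0) {T : ℝ}
    (hT : ∀ t, T ≤ t → 0 ≤ (shiftSum c lam h t).re) :
    ∃ C : ℝ, ∀ θ : ℝ, 0 ≤ θ → θ < π / 4 → ∀ x : ℝ,
      ‖expSum c lam (x + θ * I)‖ * ‖h (x + θ * I)‖ ≤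
        ‖expSum c lam (θ * I)‖ * ‖h (θ * I)‖ + C := by
  set f := shiftSum c lam h with hf
  set E := Real.exp (π / 4 * |T|) with hE
  have hfi : Integrable f := by
    have := hh.integrable_shiftSum_mul_exp hsum hB (y := 0) (by simpa using Real.pi_pos)
    simpa using this
  refine ⟨(2 * E * ∫ t, ‖f t‖) / (2 * π), fun θ h0 hθ x => ?_⟩
  have hpi := Real.pi_pos
  have hy1 : |((x : ℂ) + θ * I).im| < π / 4 := by simpa [abs_of_nonneg h0] using hθ
  have hy2 : |((θ : ℂ) * I).im| < π / 4 := by simpa [abs_of_nonneg h0] using hθ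
  have i1 := hh.integral_shiftSum_mul_exp hsum hB hy1
  have i2 := hh.integral_shiftSum_mul_exp hsum hB hy2
  have I2 := hh.integrable_shiftSum_mul_exp hsum hB hy2
  -- For `t ≥ T` the modulus on the left equals the real integrand on the imaginary axis. For `t <
  -- T` the weight is at most `E`, for every admissible `θ`, and `2 * E * ‖f t‖` pays for a possible
  -- wrong sign.
  have hpt : ∀ t : ℝ, ‖f t * exp (-(I * t * (x + θ * I)))‖ ≤
      (f t * exp (-(I * t * (θ * I)))).re + 2 * E * ‖f t‖ := by
    intro t
    have e1 : exp (-(I * t * (θ * I))) = ((Real.exp (θ * t) : ℝ) : ℂ) := by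
      rw [ofReal_exp]
      congr 1
      push_cast
      linear_combination (-(t * θ : ℂ)) * I_sq
    have hn : ‖f t‖ = |(f t).re| := by
      conv_lhs => rw [← re_add_im (f t), him t]
      simp
    rw [norm_mul, norm_exp_neg_I_mul, e1, re_mul_ofReal, hn]
    simp only [add_im, ofReal_im, mul_im, ofReal_re, I_im, mul_one, I_re, mul_zero, add_zero, zero_add]
    rcases le_or_gt T t with ht | ht
    · rw [abs_of_nonneg (hT t ht)]
      have := hT t ht
      have : 0 ≤ 2 * E * (f t).re := by positivity
      linarith
    · have hexp : Real.exp (θ * t) ≤ E := by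
        apply Real.exp_le_exp.2
        have : t ≤ |T| := ht.le.trans (le_abs_self T)
        nlinarith [abs_nonneg T]
      have h1 : -(|(f t).re| * Real.exp (θ * t)) ≤ (f t).re * Real.exp (θ * t) := by
        rw [← neg_mul]
        gcongr
        exact neg_abs_le _
      have h2 : |(f t).re| * Real.exp (θ * t) ≤ |(f t).re| * E := by gcongr
      linarith
  have hint : ‖∫ t : ℝ, f t * exp (-(I * t * (x + θ * I)))‖ ≤
      ‖∫ t : ℝ, f t * exp (-(I * t * (θ * I)))‖ + 2 * E * ∫ t, ‖f t‖ := by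
    refine (norm_integral_le_integral_norm _).trans ?_
    have h1 : ∫ t : ℝ, (f t * exp (-(I * t * (θ * I)))).re ≤
        ‖∫ t : ℝ, f t * exp (-(I * t * (θ * I)))‖ := by
      have : ∫ t : ℝ, (f t * exp (-(I * t * (θ * I)))).re =
          (∫ t : ℝ, f t * exp (-(I * t * (θ * I)))).re := integral_re (𝕜 := ℂ) I2
      rw [this]
      exact re_le_norm _
    refine le_trans ?_ (add_le_add_left h1 _)
    rw [← integral_const_mul, ← integral_add]
    · exact integral_mono (hh.integrable_shiftSum_mul_exp hsum hB hy1).norm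
        (I2.re.add (hfi.norm.const_mul _)) hpt
    · exact I2.re
    · exact hfi.norm.const_mul _
  rw [i1, i2] at hint
  simp only [norm_mul, norm_ofNat, norm_real, Real.norm_of_nonneg hpi.le] at hint
  rw [← sub_le_iff_le_add', le_div_iff₀ (by positivity)]
  linarith

end shiftSum

/-! ### Almost periodicity and non-vanishing of the exponential sum -/

section expSum

variable {c lam : ℕ → ℝ} {B : ℝ}

lemma summable_expSum (hsum : Summable fun j => |c j|) (hB : ∀ j, |lam j| ≤ B) (y : ℂ) :
    Summable fun j => (c j : ℂ) * exp (I * lam j * y) := by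
  refine Summable.of_norm_bounded (hsum.mul_right (Real.exp (B * |y.im|))) fun j => ?_
  rw [norm_mul, norm_real, Real.norm_eq_abs]
  gcongr
  exact norm_exp_I_mul_le hB y j

/-- Exponential sums with bounded frequencies are almost periodic along horizontal lines. -/
lemma exists_expSum_add_close (hsum : Summable fun j => |c j|) (hB : ∀ j, |lam j| ≤ B) (y : ℂ)
    (W : ℝ) {η : ℝ} (hη : 0 < η) :
    ∃ ω : ℝ, W ≤ ω ∧ ‖expSum c lam (ω + y) - expSum c lam y‖ < η := by
  set d : ℕ → ℝ := fun j => |c j| * Real.exp (B * |y.im|) with hd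
  have hds : Summable d := hsum.mul_right _
  have hd0 : ∀ j, 0 ≤ d j := fun j => by positivity
  set Φ : (ℕ → Circle) × (ℕ → Circle) → ℝ :=
    fun p => ∑' j, d j * ‖((p.1 j : Circle) : ℂ) - (p.2 j : Circle)‖ with hΦ
  have hbd : ∀ (j : ℕ) (p : (ℕ → Circle) × (ℕ → Circle)),
      ‖d j * ‖((p.1 j : Circle) : ℂ) - (p.2 j : Circle)‖‖ ≤ d j * 2 := by
    intro j p
    rw [Real.norm_of_nonneg (mul_nonneg (hd0 j) (norm_nonneg _))]
    refine mul_le_mul_of_nonneg_left ?_ (hd0 j)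
    refine (norm_sub_le _ _).trans ?_
    rw [Circle.norm_coe, Circle.norm_coe]
    norm_num
  have hΦc : Continuous Φ :=
    continuous_tsum (fun j => by fun_prop) (hds.mul_right 2) hbd
  set u : ℕ → (ℕ → Circle) := fun k j => Circle.exp (lam j * k) with hu
  -- The phases `exp (i lam j k)`, for integer times `k`, have a cluster point in the compact
  -- product of circles. Two visits close to it, far apart in time, differ by an almost period.
  obtain ⟨x, hx⟩ := exists_clusterPt_of_compactSpace (map u atTop)
  have hΦx : Φ (x, x) < η := by simp [hΦ, hη]
  have hmem : {p | Φ p < η} ∈ 𝓝 (x, x) := (isOpen_lt hΦc continuous_const).mem_nhds hΦx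
  rw [nhds_prod_eq] at hmem
  obtain ⟨U, hU, V, hV, hUV⟩ := mem_prod_iff.1 hmem
  have hfreq : ∃ᶠ k in atTop, u k ∈ U ∩ V :=
    MapClusterPt.frequently hx (inter_mem hU hV)
  obtain ⟨k1, hk1⟩ := hfreq.exists
  obtain ⟨k2, hk2, hk2'⟩ := (frequently_atTop.1 hfreq) (k1 + ⌈W⌉₊)
  refine ⟨(k2 : ℝ) - k1, ?_, ?_⟩
  · have h1 : ((k1 + ⌈W⌉₊ : ℕ) : ℝ) ≤ k2 := by exact_mod_cast hk2
    push_cast at h1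
    linarith [Nat.le_ceil W]
  · have h1 : Φ (u k2, u k1) < η := hUV ⟨hk2'.1, hk1.2⟩
    refine lt_of_le_of_lt ?_ h1
    rw [expSum, expSum, ← (summable_expSum hsum hB _).tsum_sub (summable_expSum hsum hB _)]
    refine tsum_of_norm_bounded (Summable.hasSum ?_) fun j => ?_
    · exact Summable.of_norm_bounded (hds.mul_right 2) fun j => hbd j (u k2, u k1)
    · have e1 : (c j : ℂ) * exp (I * lam j * (((k2 : ℝ) - (k1 : ℝ) : ℝ) + y)) -
          c j * exp (I * lam j * y) = c j * exp (I * lam j * y) *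
          (((u k2 j : Circle) : ℂ) - (u k1 j : Circle)) * exp (-((lam j * k1 : ℝ) : ℂ) * I) := by
        simp only [hu, Circle.coe_exp]
        have e2 : exp (I * lam j * (((k2 : ℝ) - (k1 : ℝ) : ℝ) + y)) = exp (I * lam j * y) *
            exp (((lam j * k2 : ℝ) : ℂ) * I) * exp (-((lam j * k1 : ℝ) : ℂ) * I) := by
          rw [← Complex.exp_add, ← Complex.exp_add]
          congr 1
          push_cast
          ring
        have e3 : exp (((lam j * k1 : ℝ) : ℂ) * I) * exp (-((lam j * k1 : ℝ) : ℂ) * I) = 1 := by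
          rw [← Complex.exp_add]
          simp
        rw [e2]
        linear_combination ((c j : ℂ) * exp (I * lam j * y)) * e3
      have e4 : ‖exp (-((lam j * k1 : ℝ) : ℂ) * I)‖ = 1 := by
        rw [← ofReal_neg]; exact norm_exp_ofReal_mul_I _
      rw [e1, norm_mul, norm_mul, norm_mul, e4, mul_one, norm_real, Real.norm_eq_abs]
      refine mul_le_mul_of_nonneg_right ?_ (norm_nonneg _)
      exact mul_le_mul_of_nonneg_left (norm_exp_I_mul_le hB y j) (abs_nonneg _)

lemma norm_expSum_add_sub_le (hsum : Summable fun j => |c j|) (hB : ∀ j, |lam j| ≤ B) {y δ : ℂ}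
    (hy : |y.im| ≤ 1) (hδ : B * ‖δ‖ ≤ 1) :
    ‖expSum c lam (y + δ) - expSum c lam y‖ ≤ (∑' j, |c j|) * (Real.exp B * (2 * (B * ‖δ‖))) := by
  have hB0 : 0 ≤ B := (abs_nonneg _).trans (hB 0)
  rw [expSum, expSum, ← (summable_expSum hsum hB _).tsum_sub (summable_expSum hsum hB _),
    ← tsum_mul_right]
  refine tsum_of_norm_bounded (hsum.mul_right _).hasSum fun j => ?_
  have e1 : (c j : ℂ) * exp (I * lam j * (y + δ)) - c j * exp (I * lam j * y) =
      c j * (exp (I * lam j * y) * (exp (I * lam j * δ) - 1)) := by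
    rw [mul_add, Complex.exp_add]
    ring
  have e2 : ‖I * lam j * δ‖ ≤ B * ‖δ‖ := by
    rw [norm_mul, norm_mul, norm_I, one_mul, norm_real, Real.norm_eq_abs]
    gcongr
    exact hB j
  rw [e1, norm_mul, norm_mul, norm_real, Real.norm_eq_abs]
  gcongr
  · refine (norm_exp_I_mul_le hB y j).trans (Real.exp_le_exp.2 ?_)
    nlinarith
  · exact (norm_exp_sub_one_le (e2.trans hδ)).trans (by linarith)

lemma tendsto_expSum_add (hsum : Summable fun j => |c j|) (hB : ∀ j, |lam j| ≤ B) {y δ : ℕ → ℂ}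
    (hy : ∀ n, |(y n).im| ≤ 1) (hδ : Tendsto δ atTop (𝓝 0)) {p : ℂ}
    (hp : Tendsto (fun n => expSum c lam (y n)) atTop (𝓝 p)) :
    Tendsto (fun n => expSum c lam (y n + δ n)) atTop (𝓝 p) := by
  have h1 : Tendsto (fun n => B * ‖δ n‖) atTop (𝓝 0) := by
    simpa using hδ.norm.const_mul B
  have h2 : Tendsto (fun n => expSum c lam (y n + δ n) - expSum c lam (y n)) atTop (𝓝 0) := by
    refine squeeze_zero_norm' ?_ (a := fun n => (∑' j, |c j|) * (Real.exp B * (2 * (B * ‖δ n‖))))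
      (by simpa using ((h1.const_mul 2).const_mul (Real.exp B)).const_mul (∑' j, |c j|))
    filter_upwards [h1.eventually_le_const one_pos] with n hn
    exact norm_expSum_add_sub_le hsum hB (hy n) hn
  simpa using h2.add hp

lemma exists_tendsto_expSum (hsum : Summable fun j => |c j|) (hB : ∀ j, |lam j| ≤ B) (y : ℂ) :
    ∃ ω : ℕ → ℝ, Tendsto ω atTop atTop ∧
      Tendsto (fun n => expSum c lam (ω n + y)) atTop (𝓝 (expSum c lam y)) := by
  choose ω h1 h2 using fun n : ℕ =>
    exists_expSum_add_close hsum hB y n (η := 1 / ((n : ℝ) + 1)) (by positivity)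
  refine ⟨ω, tendsto_atTop_mono h1 tendsto_natCast_atTop_atTop, ?_⟩
  rw [tendsto_iff_norm_sub_tendsto_zero]
  exact squeeze_zero (fun _ => norm_nonneg _) (fun n => (h2 n).le)
    tendsto_one_div_add_atTop_nhds_zero_nat

lemma differentiable_expSum (hsum : Summable fun j => |c j|) (hB : ∀ j, |lam j| ≤ B) :
    Differentiable ℂ (expSum c lam) := by
  have hB0 : 0 ≤ B := (abs_nonneg _).trans (hB 0)
  intro y
  have hU : IsOpen {w : ℂ | |w.im| < |y.im| + 1} :=
    isOpen_lt (continuous_abs.comp continuous_im) continuous_const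
  refine (differentiableOn_tsum_of_summable_norm (u := fun j => |c j| * Real.exp (B * (|y.im| + 1)))
    (hsum.mul_right _) (fun j => by fun_prop) hU fun j w hw => ?_).differentiableAt
    (hU.mem_nhds (by simp))
  rw [norm_mul, norm_real, Real.norm_eq_abs]
  gcongr
  refine (norm_exp_I_mul_le hB w j).trans (Real.exp_le_exp.2 ?_)
  exact mul_le_mul_of_nonneg_left (le_of_lt hw) hB0

/-- Vanishing on one horizontal line would mean vanishing everywhere; but at `-iσ` the sum divided
by `exp (lam M * σ)` tends to `c M` as `σ → ∞`, since the largest frequency is attained exactly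
once. -/
lemma exists_expSum_ne_zero (hsum : Summable fun j => |c j|) (hB : ∀ j, |lam j| ≤ B)
    (hinj : Function.Injective lam) {M : ℕ} (hM : ∀ j, lam j ≤ lam M) (hc : c M ≠ 0) (θ : ℝ) :
    ∃ ω : ℝ, expSum c lam (ω + θ * I) ≠ 0 := by
  by_contra! hzero
  have han : AnalyticOnNhd ℂ (expSum c lam) univ :=
    (differentiable_expSum hsum hB).differentiableOn.analyticOnNhd isOpen_univ
  have hfreq : ∃ᶠ w in 𝓝[≠] ((θ : ℂ) * I), expSum c lam w = 0 := by
    have ht : Tendsto (fun n : ℕ => (((1 / ((n : ℝ) + 1) : ℝ) : ℂ) + θ * I)) atTop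
        (𝓝[≠] ((θ : ℂ) * I)) := by
      rw [tendsto_nhdsWithin_iff]
      constructor
      · have h1 := (continuous_ofReal.tendsto 0).comp tendsto_one_div_add_atTop_nhds_zero_nat
        simpa using h1.add_const ((θ : ℂ) * I)
      · refine Eventually.of_forall fun n => ?_
        have : ((1 / ((n : ℝ) + 1) : ℝ) : ℂ) ≠ 0 := by
          rw [Ne, ofReal_eq_zero]
          positivity
        simpa using this
    exact ht.frequently (Eventually.of_forall fun n => hzero _).frequently
  have hall : ∀ w, expSum c lam w = 0 := fun w =>
    han.eqOn_zero_of_preconnected_of_frequently_eq_zero isPreconnected_univ (mem_univ _) hfreq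
      (mem_univ w)
  have ht : Tendsto (fun σ : ℝ => ∑' j, c j * Real.exp ((lam j - lam M) * σ)) atTop
      (𝓝 (∑' j, if j = M then c M else 0)) := by
    refine tendsto_tsum_of_dominated_convergence hsum (fun j => ?_) ?_
    · by_cases hj : j = M
      · simp [hj]
      · have hlt : lam j - lam M < 0 := sub_neg.2 (lt_of_le_of_ne (hM j) (hinj.ne hj))
        have h1 : Tendsto (fun σ : ℝ => (lam j - lam M) * σ) atTop atBot :=
          tendsto_id.const_mul_atTop_of_neg hlt
        simpa [hj] using (Real.tendsto_exp_atBot.comp h1).const_mul (c j)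
    · filter_upwards [eventually_ge_atTop 0] with σ hσ j
      rw [norm_mul, Real.norm_eq_abs, Real.norm_of_nonneg (Real.exp_pos _).le]
      refine mul_le_of_le_one_right (abs_nonneg _) (Real.exp_le_one_iff.2 ?_)
      exact mul_nonpos_of_nonpos_of_nonneg (sub_nonpos.2 (hM j)) hσ
  have hz : ∀ σ : ℝ, ∑' j, c j * Real.exp ((lam j - lam M) * σ) = 0 := by
    intro σ
    have h1 := hall (-(I * σ))
    rw [expSum] at h1
    have h2 : ((∑' j, c j * Real.exp ((lam j - lam M) * σ) : ℝ) : ℂ) =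
        (∑' j, (c j : ℂ) * exp (I * lam j * (-(I * σ)))) * exp (-(lam M * σ)) := by
      rw [ofReal_tsum, ← tsum_mul_right]
      refine tsum_congr fun j => ?_
      push_cast
      rw [mul_assoc (c j : ℂ), ← Complex.exp_add]
      congr 2
      linear_combination (lam j * σ : ℂ) * I_sq
    rw [h1, zero_mul] at h2
    exact_mod_cast h2
  simp only [hz, tsum_ite_eq] at ht
  exact hc (tendsto_nhds_unique ht tendsto_const_nhds)

end expSum

/-! ### The theta series at the cusp `-1` and sums over half-integers -/

/-- The point `exp (i (π/4 - ε))` of the unit circle. -/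
noncomputable def sectorPoint (ε : ℝ) : ℂ := exp (((π / 4 - ε : ℝ) : ℂ) * I)

lemma sectorPoint_eq (ε : ℝ) : sectorPoint ε = exp ((π / 4 : ℂ) * I) * exp (-(ε : ℂ) * I) := by
  rw [sectorPoint, ← Complex.exp_add]
  congr 1
  push_cast
  ring

/-- As `ε → 0` the modulus of the theta function approaches `-1`; the displacement from it is
isolated here so that Poisson summation can be applied in it. -/
lemma I_mul_sectorPoint_sq (ε : ℝ) :
    I * sectorPoint ε ^ 2 = -1 + I * (2 * Real.sin ε * exp (-(ε : ℂ) * I)) := by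
  have h1 : exp ((π / 4 : ℂ) * I) ^ 2 = I := by
    rw [← exp_nat_mul]
    refine Eq.trans ?_ exp_pi_div_two_mul_I
    congr 1
    push_cast
    ring
  have h2 : exp (-(ε : ℂ) * I) * exp ((ε : ℂ) * I) = 1 := by
    rw [← Complex.exp_add]; simp
  rw [sectorPoint_eq, mul_pow, h1, ofReal_sin, Complex.sin]
  linear_combination I_sq + I ^ 2 * h2

lemma exp_neg_pi_I_int_sq (n : ℤ) : exp (-(π * I * n ^ 2)) = exp (π * I * n) := by
  obtain ⟨k, hk⟩ := Int.even_mul_succ_self n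
  have hk' : (n : ℂ) * (n + 1) = k + k := by exact_mod_cast hk
  rw [exp_eq_exp_iff_exists_int]
  refine ⟨-k, ?_⟩
  push_cast
  linear_combination (-(π * I : ℂ)) * hk'

/-- A shift of the modulus by `-1` inserts `(-1)^(n²) = (-1)^n`, which is a shift of `w` by `1/2`.
Poisson summation then gives Gaussians centred at half-integers. -/
lemma jacobiTheta₂_neg_one_add {τ : ℂ} (hτ : 0 < τ.re) (w : ℂ) :
    jacobiTheta₂ w (-1 + I * τ) =
      1 / τ ^ (1 / 2 : ℂ) * ∑' n : ℤ, exp (-π / τ * (n - 1 / 2 - w) ^ 2) := by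
  have h := tsum_exp_neg_quadratic hτ (I * (w + 1 / 2))
  have e1 : ∀ n : ℤ, exp (-π * τ * n ^ 2 + 2 * π * (I * (w + 1 / 2)) * n) =
      jacobiTheta₂_term n w (-1 + I * τ) := by
    intro n
    rw [jacobiTheta₂_term, show (-π * τ * n ^ 2 + 2 * π * (I * (w + 1 / 2)) * n : ℂ) =
      π * I * n + (2 * π * I * n * w - π * τ * n ^ 2) by ring, Complex.exp_add,
      ← exp_neg_pi_I_int_sq, ← Complex.exp_add]
    congr 1
    linear_combination (-(π * n ^ 2 * τ : ℂ)) * I_sq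
  have e2 : ∀ n : ℤ, (n + I * (I * (w + 1 / 2)) : ℂ) = n - 1 / 2 - w := by
    intro n
    linear_combination (w + 1 / 2) * I_sq
  simp only [e1, e2] at h
  exact h

/-- The sum over half-integers bounding the theta series near the boundary of its sector. -/
noncomputable def halfIntSum (X ε : ℝ) : ℝ :=
  ∑' n : ℤ, Real.exp (-(π / 2) * (Real.cos ε / Real.sin ε) * (n - 1 / 2 - X) ^ 2 +
    π * (n - 1 / 2) * X * ((1 - Real.cos ε) / Real.sin ε))

lemma summable_half_int (X : ℝ) : Summable fun n : ℤ =>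
    Real.exp (-(π / 4) * ((n : ℝ) - 1 / 2 - X) ^ 2 + π * |(n : ℝ) - 1 / 2| * |X|) := by
  have h := (summable_pow_mul_jacobiTheta₂_term_bound (|X| / 2) (T := 1 / 8) (by norm_num) 0).mul_left
    (Real.exp (π / 4 * (1 / 2 + X) ^ 2 + π / 2 * |X|))
  refine Summable.of_nonneg_of_le (fun n => (Real.exp_pos _).le) (fun n => ?_) h
  rw [pow_zero, one_mul, ← Real.exp_add]
  apply Real.exp_le_exp.2
  have h1 : |(n : ℝ) - 1 / 2| ≤ |(n : ℝ)| + 1 / 2 := by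
    refine (abs_sub _ _).trans (le_of_eq ?_)
    norm_num
  have h2 : (n : ℝ) ^ 2 / 2 - (1 / 2 + X) ^ 2 ≤ ((n : ℝ) - 1 / 2 - X) ^ 2 := by
    nlinarith [sq_nonneg ((n : ℝ) - 2 * (1 / 2 + X))]
  have h3 := mul_le_mul_of_nonneg_right h1 (abs_nonneg X)
  have hpi := Real.pi_pos
  push_cast
  nlinarith [mul_le_mul_of_nonneg_left h2 hpi.le, mul_le_mul_of_nonneg_left h3 hpi.le]

section small

variable {ε : ℝ}

lemma cot_ge_one (h0 : 0 < ε) (h1 : ε ≤ π / 4) : 1 ≤ Real.cos ε / Real.sin ε := by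
  have hs : 0 < Real.sin ε := Real.sin_pos_of_pos_of_lt_pi h0 (by linarith [Real.pi_pos])
  rw [le_div_iff₀ hs, one_mul, ← Real.cos_pi_div_two_sub]
  exact Real.cos_le_cos_of_nonneg_of_le_pi h0.le (by linarith) (by linarith)

lemma tan_half_mem (h0 : 0 < ε) (h1 : ε ≤ π / 4) :
    0 ≤ (1 - Real.cos ε) / Real.sin ε ∧ (1 - Real.cos ε) / Real.sin ε ≤ 1 := by
  have hs : 0 < Real.sin ε := Real.sin_pos_of_pos_of_lt_pi h0 (by linarith [Real.pi_pos])
  have hc : 0 < Real.cos ε := Real.cos_pos_of_mem_Ioo ⟨by linarith [Real.pi_pos], by linarith⟩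
  refine ⟨div_nonneg (by linarith [Real.cos_le_one ε]) hs.le, ?_⟩
  rw [div_le_one hs]
  nlinarith [Real.sin_sq_add_cos_sq ε]

lemma halfIntSum_term_le (X : ℝ) (h0 : 0 < ε) (h1 : ε ≤ π / 4) {d : ℝ} {n : ℤ}
    (hd : d ≤ ((n : ℝ) - 1 / 2 - X) ^ 2) :
    Real.exp (-(π / 2) * (Real.cos ε / Real.sin ε) * (n - 1 / 2 - X) ^ 2 +
      π * (n - 1 / 2) * X * ((1 - Real.cos ε) / Real.sin ε)) ≤
    Real.exp (-(π / 4) * d * (Real.cos ε / Real.sin ε)) *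
      Real.exp (-(π / 4) * ((n : ℝ) - 1 / 2 - X) ^ 2 + π * |(n : ℝ) - 1 / 2| * |X|) := by
  rw [← Real.exp_add]
  apply Real.exp_le_exp.2
  have hq := cot_ge_one h0 h1
  obtain ⟨t0, t1⟩ := tan_half_mem h0 h1
  set q := Real.cos ε / Real.sin ε
  set t := (1 - Real.cos ε) / Real.sin ε
  set A := ((n : ℝ) - 1 / 2 - X) ^ 2
  have hA : 0 ≤ A := sq_nonneg _
  have hpi := Real.pi_pos
  have k1 : ((n : ℝ) - 1 / 2) * X * t ≤ |(n : ℝ) - 1 / 2| * |X| := by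
    rw [← abs_mul]
    have := le_abs_self (((n : ℝ) - 1 / 2) * X)
    nlinarith [abs_nonneg (((n : ℝ) - 1 / 2) * X)]
  -- From `d ≤ A` and `1 ≤ q`: one half of the Gaussian exponent gives the decay `d * q` as `ε → 0`,
  -- the other half keeps `A` for summability uniformly in `ε`.
  have k2 : d * q + A ≤ 2 * (q * A) := by nlinarith
  nlinarith [mul_le_mul_of_nonneg_left k1 hpi.le, mul_le_mul_of_nonneg_left k2 hpi.le]

lemma summable_halfIntSum (X : ℝ) (h0 : 0 < ε) (h1 : ε ≤ π / 4) : Summable fun n : ℤ =>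
    Real.exp (-(π / 2) * (Real.cos ε / Real.sin ε) * (n - 1 / 2 - X) ^ 2 +
      π * (n - 1 / 2) * X * ((1 - Real.cos ε) / Real.sin ε)) :=
  Summable.of_nonneg_of_le (fun _ => (Real.exp_pos _).le)
    (fun _ => halfIntSum_term_le X h0 h1 (sq_nonneg _ : (0 : ℝ) ≤ _))
    ((summable_half_int X).mul_left _)

lemma halfIntSum_le_of_dist (X : ℝ) {d : ℝ} (hd : ∀ n : ℤ, d ≤ ((n : ℝ) - 1 / 2 - X) ^ 2)
    (h0 : 0 < ε) (h1 : ε ≤ π / 4) :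
    halfIntSum X ε ≤ Real.exp (-(π / 4) * d * (Real.cos ε / Real.sin ε)) *
      ∑' n : ℤ, Real.exp (-(π / 4) * ((n : ℝ) - 1 / 2 - X) ^ 2 + π * |(n : ℝ) - 1 / 2| * |X|) := by
  rw [← tsum_mul_left]
  exact (summable_halfIntSum X h0 h1).tsum_le_tsum (fun n => halfIntSum_term_le X h0 h1 (hd n))
    ((summable_half_int X).mul_left _)

/-- The half-integer nearest to `X` is `round (X + 1 / 2) - 1 / 2`. All others are at distance at
least `1/2`, whence the constant `1/4`; the nearest term is bounded with its Gaussian factor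
dropped. -/
lemma halfIntSum_le (X : ℝ) (h0 : 0 < ε) (h1 : ε ≤ π / 4) :
    halfIntSum X ε ≤ Real.exp (-(π / 4) * (1 / 4) * (Real.cos ε / Real.sin ε)) *
      ∑' n : ℤ, Real.exp (-(π / 4) * ((n : ℝ) - 1 / 2 - X) ^ 2 + π * |(n : ℝ) - 1 / 2| * |X|) +
      Real.exp (π * (round (X + 1 / 2) - 1 / 2) * X * ((1 - Real.cos ε) / Real.sin ε)) := by
  set m := round (X + 1 / 2) with hm
  have hmabs := abs_sub_round (X + 1 / 2)
  rw [← hm] at hmabs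
  have hq := cot_ge_one h0 h1
  have hS := (summable_half_int X).mul_left (Real.exp (-(π / 4) * (1 / 4) * (Real.cos ε / Real.sin ε)))
  have hm1 : HasSum (fun n : ℤ => if n = m then
      Real.exp (π * (m - 1 / 2) * X * ((1 - Real.cos ε) / Real.sin ε)) else 0)
      (Real.exp (π * (m - 1 / 2) * X * ((1 - Real.cos ε) / Real.sin ε))) := hasSum_ite_eq m _
  rw [← tsum_mul_left, ← hm1.tsum_eq, ← hS.tsum_add hm1.summable]
  refine (summable_halfIntSum X h0 h1).tsum_le_tsum (fun n => ?_) (hS.add hm1.summable)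
  by_cases hn : n = m
  · rw [if_pos hn, hn]
    refine le_trans ?_ (le_add_of_nonneg_left (by positivity))
    apply Real.exp_le_exp.2
    have : 0 ≤ π / 2 * (Real.cos ε / Real.sin ε) * ((m : ℝ) - 1 / 2 - X) ^ 2 := by positivity
    linarith
  · rw [if_neg hn, add_zero]
    refine halfIntSum_term_le X h0 h1 ?_
    have h2 : (1 : ℝ) ≤ |(n : ℝ) - m| := by
      exact_mod_cast Int.one_le_abs (sub_ne_zero.2 hn)
    have h3 : 1 / 2 ≤ |(n : ℝ) - 1 / 2 - X| := by
      have := abs_sub_abs_le_abs_sub ((n : ℝ) - m) (X + 1 / 2 - m)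
      rw [show (n : ℝ) - m - (X + 1 / 2 - m) = n - 1 / 2 - X by ring] at this
      linarith
    rw [← sq_abs]
    nlinarith

end small

/-! ### Theta near the boundary: imaginary axis versus dominant term -/

section asymptotics

variable {z : ℂ} {X Y ε : ℝ}

lemma exp_neg_ofReal_mul_I (ε : ℝ) : exp (-(ε : ℂ) * I) = Real.cos ε - Real.sin ε * I := by
  rw [← ofReal_neg, exp_mul_I, ← ofReal_cos, ← ofReal_sin, Real.cos_neg, Real.sin_neg]
  push_cast
  ring

lemma exp_ofReal_mul_I' (ε : ℝ) : exp ((ε : ℂ) * I) = Real.cos ε + Real.sin ε * I := by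
  rw [exp_mul_I, ← ofReal_cos, ← ofReal_sin]

lemma exp_neg_mul_exp (ε : ℝ) : exp (-(ε : ℂ) * I) * exp ((ε : ℂ) * I) = 1 := by
  rw [← Complex.exp_add]; simp

lemma mul_sectorPoint (hz : z * exp ((π / 4 : ℂ) * I) = 2 * (√π : ℝ) * (X + Y * I)) (ε : ℝ) :
    z * sectorPoint ε = 2 * (√π : ℝ) * ((X + Y * I) * exp (-(ε : ℂ) * I)) := by
  rw [sectorPoint_eq, ← mul_assoc, hz]
  ring

lemma I_mul_conj_mul_exp (hz : z * exp ((π / 4 : ℂ) * I) = 2 * (√π : ℝ) * (X + Y * I)) :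
    (I * (starRingEnd ℂ) z) * exp ((π / 4 : ℂ) * I) =
      2 * (√π : ℝ) * (((-X : ℝ) : ℂ) + Y * I) := by
  have h1 := congrArg (starRingEnd ℂ) hz
  rw [map_mul, ← exp_conj] at h1
  simp only [map_mul, map_add, map_div₀, conj_ofReal, conj_I, map_ofNat] at h1
  have h2 : exp ((π / 4 : ℂ) * I) = exp ((π / 4 : ℂ) * -I) * I := by
    have h3 : exp ((π / 4 : ℂ) * I) = exp ((π / 4 : ℂ) * -I) * exp ((π / 2 : ℂ) * I) := by
      rw [← Complex.exp_add]
      congr 1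
      ring
    rw [h3, exp_pi_div_two_mul_I]
  rw [h2]
  push_cast
  linear_combination (I * I) * h1 + (2 * ((√π : ℝ) : ℂ) * (X - Y * I)) * I_sq

lemma sq_div_four_eq (hz : z * exp ((π / 4 : ℂ) * I) = 2 * (√π : ℝ) * (X + Y * I)) :
    z ^ 2 / 4 = -I * (π * (X + Y * I) ^ 2) := by
  have h1 : exp ((π / 4 : ℂ) * I) ^ 2 = I := by
    rw [← exp_nat_mul]
    refine Eq.trans ?_ exp_pi_div_two_mul_I
    congr 1
    push_cast
    ring
  have h2 := congrArg (· ^ 2) hz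
  simp only [mul_pow, h1, ofReal_sqrt_pi_sq] at h2
  linear_combination (-I / 4) * h2 + (z ^ 2 / 4) * I_sq

lemma norm_cosTheta_sectorPoint_le
    (hz : z * exp ((π / 4 : ℂ) * I) = 2 * (√π : ℝ) * (X + Y * I)) (h0 : 0 < ε) (h1 : ε ≤ π / 4) :
    ‖cosTheta z (sectorPoint ε)‖ ≤ (√(2 * Real.sin ε))⁻¹ *
      (Real.exp (π / 2 * (Real.cos ε / Real.sin ε) * Y ^ 2 - π * X * Y) * halfIntSum X ε) := by
  have hs : 0 < Real.sin ε := Real.sin_pos_of_pos_of_lt_pi h0 (by linarith [Real.pi_pos])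
  have hc : 0 < Real.cos ε := Real.cos_pos_of_mem_Ioo ⟨by linarith [Real.pi_pos], by linarith⟩
  have hsc : (Real.sin ε : ℂ) ≠ 0 := by exact_mod_cast hs.ne'
  have hpi : ((√π : ℝ) : ℂ) ≠ 0 := ofReal_sqrt_pi_ne_zero
  set τ : ℂ := 2 * Real.sin ε * exp (-(ε : ℂ) * I) with hτ
  have hτre : 0 < τ.re := by
    rw [hτ, exp_neg_ofReal_mul_I]
    simp only [mul_re, mul_im, sub_re, sub_im, ofReal_re, ofReal_im, I_re, I_im, re_ofNat, im_ofNat]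
    ring_nf
    positivity
  have hτn : ‖τ‖ = 2 * Real.sin ε := by
    rw [hτ, norm_mul, norm_mul, norm_ofNat, norm_real, Real.norm_of_nonneg hs.le, ← ofReal_neg,
      norm_exp_ofReal_mul_I, mul_one]
  have hw : z * sectorPoint ε / (2 * (√π : ℝ)) = (X + Y * I) * exp (-(ε : ℂ) * I) := by
    rw [mul_sectorPoint hz]
    field_simp
  have hroot : ‖1 / τ ^ (1 / 2 : ℂ)‖ = (√(2 * Real.sin ε))⁻¹ := by
    rw [norm_div, norm_one, one_div, show (1 / 2 : ℂ) = ((1 / 2 : ℝ) : ℂ) by push_cast; rfl,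
      norm_cpow_real, hτn, ← Real.sqrt_eq_rpow]
  rw [cosTheta, hw, I_mul_sectorPoint_sq, ← hτ, jacobiTheta₂_neg_one_add hτre, norm_mul, hroot]
  refine mul_le_mul_of_nonneg_left ?_ (by positivity)
  rw [halfIntSum, ← tsum_mul_left]
  refine tsum_of_norm_bounded ((summable_halfIntSum X h0 h1).mul_left _).hasSum fun n => ?_
  rw [← Real.exp_add, norm_exp]
  apply Real.exp_le_exp.2
  apply le_of_eq
  set μ : ℝ := n - 1 / 2 with hμ
  have hE := exp_ne_zero (-(ε : ℂ) * I)
  -- Only the real part of the exponent matters. Completing the square around `X` in `μ` splits it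
  -- into the terms of `halfIntSum` and a factor independent of `n`.
  have e1 : -π / τ * (n - 1 / 2 - (X + Y * I) * exp (-(ε : ℂ) * I)) ^ 2 =
      ((-(π / (2 * Real.sin ε)) * (μ ^ 2 * Real.cos ε - 2 * μ * X + (X ^ 2 - Y ^ 2) * Real.cos ε +
        2 * X * Y * Real.sin ε) : ℝ) : ℂ) + ((-(π / (2 * Real.sin ε)) * (μ ^ 2 * Real.sin ε -
        2 * μ * Y + 2 * X * Y * Real.cos ε - (X ^ 2 - Y ^ 2) * Real.sin ε) : ℝ) : ℂ) * I := by
    have e2 : -π / τ * (n - 1 / 2 - (X + Y * I) * exp (-(ε : ℂ) * I)) ^ 2 =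
        -(π / (2 * Real.sin ε)) * ((n - 1 / 2) ^ 2 * exp ((ε : ℂ) * I) -
          2 * (n - 1 / 2) * (X + Y * I) + (X + Y * I) ^ 2 * exp (-(ε : ℂ) * I)) := by
      have e3 : exp ((ε : ℂ) * I) = (exp (-(ε : ℂ) * I))⁻¹ :=
        eq_inv_of_mul_eq_one_right (exp_neg_mul_exp ε)
      rw [e3, hτ]
      field_simp
      ring
    rw [e2, exp_neg_ofReal_mul_I, exp_ofReal_mul_I', hμ]
    push_cast
    linear_combination (-(π / (2 * Complex.sin ε))) *
      ((Y : ℂ) ^ 2 * (Complex.cos ε - Complex.sin ε * I) - 2 * X * Y * Complex.sin ε) * I_sq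
  rw [e1, add_re, ofReal_re, re_ofReal_mul, I_re, mul_zero, add_zero]
  field_simp
  ring

/-- The radius `Y / (2 sin ε)` makes the growing half of the first cosine term maximal to leading
order. There `Re x² = Q` and `Im a = 2πQ - πXY`, so this half has size `exp (π(Q - XY))`, while
everything else stays bounded. -/
lemma exists_norm_cosTheta_sub_main_le (X : ℝ) (hY : 0 < Y) :
    ∃ C : ℝ, 0 ≤ C ∧ ∀ z : ℂ, z * exp ((π / 4 : ℂ) * I) = 2 * (√π : ℝ) * (X + Y * I) →
      ∀ ε : ℝ, 0 < ε → ε ≤ π / 4 → 1 ≤ Y ^ 2 * Real.cos ε / (2 * Real.sin ε) →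
      ‖cosTheta z ((Y / (2 * Real.sin ε) : ℝ) * sectorPoint ε) - 1 -
        exp (-π * ((Y / (2 * Real.sin ε) : ℝ) * sectorPoint ε) ^ 2 -
          I * (2 * π * (Y / (2 * Real.sin ε) : ℝ) * ((X + Y * I) * exp (-(ε : ℂ) * I))))‖ ≤ C := by
  set D := |X * Y| with hD
  have hD0 : 0 ≤ D := abs_nonneg _
  have hb : Summable fun n : ℕ => 2 * Real.exp (-π * (n * (n + 2)) + π * (n + 2) * D) := by
    have h1 : Summable fun n : ℕ => (|((n : ℤ))| ^ 0 : ℝ) *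
        Real.exp (-π * (1 * ((n : ℤ) : ℝ) ^ 2 - 2 * (D / 2) * |((n : ℤ))|)) :=
      (summable_pow_mul_jacobiTheta₂_term_bound (D / 2) one_pos 0).comp_injective
        (Nat.cast_injective (R := ℤ))
    refine Summable.mul_left _ ?_
    refine Summable.of_nonneg_of_le (fun n => (Real.exp_pos _).le) (fun n => ?_)
      (h1.mul_left (Real.exp (2 * π * D)))
    rw [pow_zero, one_mul, ← Real.exp_add]
    apply Real.exp_le_exp.2
    simp only [Int.cast_natCast, Nat.abs_cast]
    nlinarith [Real.pi_pos, mul_nonneg Real.pi_pos.le (Nat.cast_nonneg (α := ℝ) n)]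
  refine ⟨∑' n : ℕ, 2 * Real.exp (-π * (n * (n + 2)) + π * (n + 2) * D) + Real.exp (π * D),
    add_nonneg (tsum_nonneg fun n => by positivity) (Real.exp_pos _).le,
    fun z hz ε h0 h1 hQ => ?_⟩
  have hs : 0 < Real.sin ε := Real.sin_pos_of_pos_of_lt_pi h0 (by linarith [Real.pi_pos])
  set Q := Y ^ 2 * Real.cos ε / (2 * Real.sin ε) with hQdef
  set R := Y / (2 * Real.sin ε) with hR
  set x : ℂ := (R : ℂ) * sectorPoint ε with hx
  set a : ℂ := 2 * π * R * ((X + Y * I) * exp (-(ε : ℂ) * I)) with ha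
  have hx2 : (x ^ 2).re = Q := by
    have e1 : sectorPoint ε ^ 2 = I + 2 * Real.sin ε * exp (-(ε : ℂ) * I) := by
      have := I_mul_sectorPoint_sq ε
      linear_combination (-I) * this + (sectorPoint ε ^ 2 -
        2 * Real.sin ε * exp (-(ε : ℂ) * I)) * I_sq
    rw [hx, mul_pow, e1, ← ofReal_pow, re_ofReal_mul, exp_neg_ofReal_mul_I]
    simp only [mul_re, mul_im, sub_re, sub_im, add_re, ofReal_re, ofReal_im, I_re, I_im, re_ofNat,
      im_ofNat]
    rw [hR, hQdef]
    field_simp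
    ring
  have haz : ∀ n : ℕ, ((√π : ℝ) * (n + 1) * x * z : ℂ) = ((n + 1 : ℕ) : ℝ) * a := by
    intro n
    rw [ha, hx]
    have := mul_sectorPoint hz ε
    push_cast
    linear_combination ((√π : ℝ) * (n + 1) * R : ℂ) * this +
      (2 * (n + 1) * R * ((X + Y * I) * exp (-(ε : ℂ) * I)) : ℂ) * ofReal_sqrt_pi_sq
  have haim : a.im = 2 * π * Q - π * (X * Y) := by
    rw [ha, exp_neg_ofReal_mul_I]
    rw [show (2 * π * R : ℂ) = ((2 * π * R : ℝ) : ℂ) by push_cast; ring, im_ofReal_mul]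
    simp only [mul_re, mul_im, sub_re, sub_im, add_re, add_im, ofReal_re, ofReal_im, I_re, I_im]
    rw [hR, hQdef]
    field_simp
    ring
  have hpi := Real.pi_pos
  have hre : 0 < (x ^ 2).re := by rw [hx2]; linarith
  have hsum := hasSum_cosTheta_sub_one z hre
  rw [← hasSum_nat_add_iff' 1] at hsum
  simp only [haz, Finset.range_one, Finset.sum_singleton] at hsum
  have e0 : 2 * exp (-π * (((0 : ℕ) : ℂ) + 1) ^ 2 * x ^ 2) * cos (((0 + 1 : ℕ) : ℝ) * a) =
      exp (-π * x ^ 2 - I * a) + exp (-π * x ^ 2 + I * a) := by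
    rw [sub_eq_add_neg, Complex.exp_add, Complex.exp_add, Complex.cos]
    push_cast
    rw [zero_add, show (1 : ℂ) * a * I = I * a by ring, show -((1 : ℂ) * a) * I = -(I * a) by ring,
      show (-π * 1 ^ 2 * x ^ 2 : ℂ) = -π * x ^ 2 by ring]
    ring
  rw [e0] at hsum
  have hsmall : ‖exp (-π * x ^ 2 + I * a)‖ ≤ Real.exp (π * D) := by
    rw [norm_exp]
    apply Real.exp_le_exp.2
    have : (-π * x ^ 2 + I * a).re = -π * Q - a.im := by
      rw [add_re, ← ofReal_neg, re_ofReal_mul, hx2]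
      simp
      ring
    rw [this, haim]
    nlinarith [le_abs_self (X * Y)]
  have htail : ‖cosTheta z x - 1 - (exp (-π * x ^ 2 - I * a) + exp (-π * x ^ 2 + I * a))‖ ≤
      ∑' n : ℕ, 2 * Real.exp (-π * (n * (n + 2)) + π * (n + 2) * D) := by
    rw [← hsum.tsum_eq]
    refine tsum_of_norm_bounded hb.hasSum fun n => ?_
    rw [norm_mul, norm_mul, norm_ofNat, norm_exp, mul_assoc]
    refine mul_le_mul_of_nonneg_left ?_ zero_le_two
    have k1 := norm_cos_le (((n + 1 + 1 : ℕ) : ℝ) * a)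
    refine (mul_le_mul_of_nonneg_left k1 (Real.exp_pos _).le).trans ?_
    rw [← Real.exp_add]
    apply Real.exp_le_exp.2
    have k2 : (-π * (((n + 1 : ℕ) : ℂ) + 1) ^ 2 * x ^ 2).re = -π * ((n : ℝ) + 2) ^ 2 * Q := by
      rw [show (-π * (((n + 1 : ℕ) : ℂ) + 1) ^ 2 * x ^ 2) =
        ((-π * ((n : ℝ) + 2) ^ 2 : ℝ) : ℂ) * x ^ 2 by push_cast; ring, re_ofReal_mul, hx2]
    have k3 : |((((n + 1 + 1 : ℕ) : ℝ) : ℂ) * a).im| ≤ ((n : ℝ) + 2) * (2 * π * Q + π * D) := by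
      rw [im_ofReal_mul, abs_mul, Nat.abs_cast, haim]
      push_cast
      rw [show (n : ℝ) + 1 + 1 = n + 2 by ring]
      refine mul_le_mul_of_nonneg_left ((abs_sub _ _).trans (le_of_eq ?_)) (by positivity)
      rw [abs_mul π, abs_of_pos hpi, abs_of_nonneg (by positivity)]
    rw [k2]
    -- The coefficient of `-π * Q` in the exponent of the term of index `n + 2` is `(n+2)² - 2(n+2)
    -- = n(n+2)`; hence `Q ≥ 1` gives a bound free of `ε`.
    have k4 : (n : ℝ) * (n + 2) ≤ n * (n + 2) * Q := le_mul_of_one_le_right (by positivity) hQ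
    nlinarith [mul_le_mul_of_nonneg_left k4 hpi.le]
  calc ‖cosTheta z x - 1 - exp (-π * x ^ 2 - I * a)‖
      = ‖(cosTheta z x - 1 - (exp (-π * x ^ 2 - I * a) + exp (-π * x ^ 2 + I * a))) +
          exp (-π * x ^ 2 + I * a)‖ := by congr 1; ring
    _ ≤ _ := norm_add_le_of_le htail hsmall

end asymptotics

/-! ### Upper and lower bounds for the kernel -/

section kernelBounds

variable {z : ℂ} {X Y ε : ℝ}

lemma shiftKernel_eq (z y : ℂ) : shiftKernel z y =
    exp (y / 2) * ((cosTheta (I * (starRingEnd ℂ) z) (exp y) - 1) +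
      exp (z ^ 2 / 4) * (cosTheta z (exp y) - 1)) -
    exp (-y / 2) * (exp ((starRingEnd ℂ) z ^ 2 / 4) + 1) := by
  have e1 : -(I * (starRingEnd ℂ) z) ^ 2 / 4 = (starRingEnd ℂ) z ^ 2 / 4 := by simp [mul_pow]
  have e2 : exp (z ^ 2 / 4) * exp (-z ^ 2 / 4) = 1 := by
    rw [← Complex.exp_add, exp_eq_one_iff]
    exact ⟨0, by push_cast; ring⟩
  rw [shiftKernel, thetaKernel, thetaKernel, e1]
  linear_combination (-exp (-y / 2)) * e2

lemma norm_exp_sq_div_four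
    (hz : z * exp ((π / 4 : ℂ) * I) = 2 * (√π : ℝ) * (X + Y * I)) :
    ‖exp (z ^ 2 / 4)‖ = Real.exp (2 * π * X * Y) := by
  rw [norm_exp, sq_div_four_eq hz]
  congr 1
  rw [show -I * (π * ((X : ℂ) + Y * I) ^ 2) = ((2 * π * X * Y : ℝ) : ℂ) +
    ((-(π * (X ^ 2 - Y ^ 2)) : ℝ) : ℂ) * I by
      push_cast
      linear_combination (-(π * Y ^ 2 * I + 2 * π * X * Y : ℂ)) * I_sq]
  rw [add_re, ofReal_re, re_ofReal_mul, I_re, mul_zero, add_zero]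

/-- The parameters of the two theta series have coordinates `(-X, Y)` and `(X, Y)`. Since `|exp
(z²/4)| = exp (2πXY)`, the two contributions carry the same exponential. -/
lemma exists_norm_shiftKernel_le
    (hz : z * exp ((π / 4 : ℂ) * I) = 2 * (√π : ℝ) * (X + Y * I)) :
    ∃ C : ℝ, ∀ ε : ℝ, 0 < ε → ε ≤ π / 4 →
      ‖shiftKernel z (((π / 4 - ε : ℝ) : ℂ) * I)‖ ≤ (√(2 * Real.sin ε))⁻¹ *
        (Real.exp (π * (Y ^ 2 * (Real.cos ε / Real.sin ε) / 2 + X * Y)) *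
          (halfIntSum (-X) ε + halfIntSum X ε)) + C := by
  refine ⟨(1 + ‖exp (z ^ 2 / 4)‖) + (‖exp ((starRingEnd ℂ) z ^ 2 / 4)‖ + 1), fun ε h0 h1 => ?_⟩
  have k1 := norm_cosTheta_sectorPoint_le (I_mul_conj_mul_exp hz) h0 h1
  have k2 := norm_cosTheta_sectorPoint_le hz h0 h1
  rw [shiftKernel_eq, show exp (((π / 4 - ε : ℝ) : ℂ) * I) = sectorPoint ε from rfl]
  have n1 : ‖exp (((π / 4 - ε : ℝ) : ℂ) * I / 2)‖ = 1 := by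
    rw [show ((π / 4 - ε : ℝ) : ℂ) * I / 2 = (((π / 4 - ε) / 2 : ℝ) : ℂ) * I by push_cast; ring]
    exact norm_exp_ofReal_mul_I _
  have n2 : ‖exp (-(((π / 4 - ε : ℝ) : ℂ) * I) / 2)‖ = 1 := by
    rw [show -(((π / 4 - ε : ℝ) : ℂ) * I) / 2 = ((-(π / 4 - ε) / 2 : ℝ) : ℂ) * I by push_cast; ring]
    exact norm_exp_ofReal_mul_I _
  refine (norm_sub_le _ _).trans ?_
  rw [norm_mul, norm_mul, n1, n2, one_mul, one_mul, ← add_assoc]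
  refine add_le_add ?_ ((norm_add_le _ _).trans (by rw [norm_one]))
  refine (norm_add_le _ _).trans ?_
  rw [norm_mul, norm_exp_sq_div_four hz]
  have k3 : ‖cosTheta (I * (starRingEnd ℂ) z) (sectorPoint ε) - 1‖ ≤
      ‖cosTheta (I * (starRingEnd ℂ) z) (sectorPoint ε)‖ + 1 := by
    simpa using norm_sub_le (cosTheta (I * (starRingEnd ℂ) z) (sectorPoint ε)) 1
  have k4 : ‖cosTheta z (sectorPoint ε) - 1‖ ≤ ‖cosTheta z (sectorPoint ε)‖ + 1 := by
    simpa using norm_sub_le (cosTheta z (sectorPoint ε)) 1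
  have k5 := mul_le_mul_of_nonneg_left (k4.trans (add_le_add_left k2 1))
    (Real.exp_pos (2 * π * X * Y)).le
  have k6 := k3.trans (add_le_add_left k1 1)
  refine (add_le_add k6 k5).trans (le_of_eq ?_)
  have e1 : Real.exp (π / 2 * (Real.cos ε / Real.sin ε) * Y ^ 2 - π * -X * Y) =
      Real.exp (π * (Y ^ 2 * (Real.cos ε / Real.sin ε) / 2 + X * Y)) := by
    congr 1; ring
  have e2 : Real.exp (2 * π * X * Y) *
      Real.exp (π / 2 * (Real.cos ε / Real.sin ε) * Y ^ 2 - π * X * Y) =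
      Real.exp (π * (Y ^ 2 * (Real.cos ε / Real.sin ε) / 2 + X * Y)) := by
    rw [← Real.exp_add]; congr 1; ring
  rw [e1]
  linear_combination ((√(2 * Real.sin ε))⁻¹ * halfIntSum X ε) * e2

/-- The two dominant terms have equal modulus, so only their relative phase can cancel them; the
remaining errors are absorbed in `C`. -/
lemma exists_le_norm_shiftKernel
    (hz : z * exp ((π / 4 : ℂ) * I) = 2 * (√π : ℝ) * (X + Y * I)) (hY : 0 < Y) :
    ∃ C : ℝ, ∀ ε : ℝ, 0 < ε → ε ≤ π / 4 → 1 ≤ Y ^ 2 * (Real.cos ε / Real.sin ε) / 2 →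
      √(Y / (2 * Real.sin ε)) *
        (Real.exp (π * (Y ^ 2 * (Real.cos ε / Real.sin ε) / 2 + X * Y)) *
        ‖1 + exp (-((π * (X ^ 2 - Y ^ 2) + 2 * π * X * Y * (Real.cos ε / Real.sin ε) : ℝ) : ℂ) * I)‖
          - C) ≤
      ‖shiftKernel z (Real.log (Y / (2 * Real.sin ε)) + ((π / 4 - ε : ℝ) : ℂ) * I)‖ := by
  obtain ⟨C1, hC1, hb1⟩ := exists_norm_cosTheta_sub_main_le (-X) hY
  obtain ⟨C2, hC2, hb2⟩ := exists_norm_cosTheta_sub_main_le X hY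
  refine ⟨C1 + Real.exp (2 * π * X * Y) * C2 + Y * (‖exp ((starRingEnd ℂ) z ^ 2 / 4)‖ + 1),
    fun ε h0 h1 hQ => ?_⟩
  have hs : 0 < Real.sin ε := Real.sin_pos_of_pos_of_lt_pi h0 (by linarith [Real.pi_pos])
  have hQ' : Y ^ 2 * Real.cos ε / (2 * Real.sin ε) = Y ^ 2 * (Real.cos ε / Real.sin ε) / 2 := by
    field_simp
  have b1 := hb1 _ (I_mul_conj_mul_exp hz) ε h0 h1 (by rwa [hQ'])
  have b2 := hb2 z hz ε h0 h1 (by rwa [hQ'])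
  set Q := Y ^ 2 * (Real.cos ε / Real.sin ε) / 2 with hQdef
  set R := Y / (2 * Real.sin ε) with hR
  have hR0 : 0 < R := by positivity
  have hRY : 1 ≤ R * Y := by
    refine hQ.trans ?_
    rw [hQdef, hR, div_mul_eq_mul_div, ← sq, ← mul_div_assoc, div_div, mul_comm (Real.sin ε)]
    apply div_le_div_of_nonneg_right _ (by positivity)
    exact mul_le_of_le_one_right (sq_nonneg Y) (Real.cos_le_one ε)
  set x : ℂ := (R : ℂ) * sectorPoint ε with hx
  set y : ℂ := Real.log R + ((π / 4 - ε : ℝ) : ℂ) * I with hy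
  have hexp : exp y = x := by
    rw [hy, Complex.exp_add, ← ofReal_exp, Real.exp_log hR0]
    rfl
  have hyre : y.re = Real.log R := by simp [hy]
  have n1 : ‖exp (y / 2)‖ = √R := by
    rw [norm_exp, show (y / 2).re = Real.log R * (1 / 2) by rw [← hyre]; simp; ring,
      ← Real.rpow_def_of_pos hR0, Real.sqrt_eq_rpow]
  have n2 : ‖exp (-y / 2)‖ ≤ √R * Y := by
    have : ‖exp (-y / 2)‖ * ‖exp (y / 2)‖ = 1 := by
      rw [← norm_mul, ← Complex.exp_add, neg_div, neg_add_cancel, Complex.exp_zero, norm_one]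
    rw [n1] at this
    have hsq : √R * √R = R := Real.mul_self_sqrt hR0.le
    have hpos : 0 < √R := Real.sqrt_pos.2 hR0
    have h3 : ‖exp (-y / 2)‖ * √R ≤ √R * Y * √R := by
      rw [this]
      calc (1 : ℝ) ≤ R * Y := hRY
        _ = √R * Y * √R := by linear_combination (-Y) * hsq
    exact le_of_mul_le_mul_right h3 hpos
  set a1 : ℂ := 2 * π * R * ((((-X : ℝ) : ℂ) + Y * I) * exp (-(ε : ℂ) * I)) with ha1
  set a2 : ℂ := 2 * π * R * ((X + Y * I) * exp (-(ε : ℂ) * I)) with ha2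
  have hsc : (Real.sin ε : ℂ) ≠ 0 := by exact_mod_cast hs.ne'
  -- The ratio of the dominant terms is unimodular, with an angle affine in `cot ε`.
  have hphase : z ^ 2 / 4 - I * a2 + I * a1 =
      -((π * (X ^ 2 - Y ^ 2) + 2 * π * X * Y * (Real.cos ε / Real.sin ε) : ℝ) : ℂ) * I := by
    rw [sq_div_four_eq hz, ha1, ha2, exp_neg_ofReal_mul_I, hR]
    push_cast [-ofReal_cos, -ofReal_sin]
    field_simp
    linear_combination (-(Y ^ 2 * Real.sin ε : ℂ)) * I_sq
  have hx2 : (x ^ 2).re = Q := by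
    have e1 : sectorPoint ε ^ 2 = I + 2 * Real.sin ε * exp (-(ε : ℂ) * I) := by
      have := I_mul_sectorPoint_sq ε
      linear_combination (-I) * this + (sectorPoint ε ^ 2 -
        2 * Real.sin ε * exp (-(ε : ℂ) * I)) * I_sq
    rw [hx, mul_pow, e1, ← ofReal_pow, re_ofReal_mul, exp_neg_ofReal_mul_I]
    simp only [mul_re, mul_im, sub_re, sub_im, add_re, ofReal_re, ofReal_im, I_re, I_im, re_ofNat,
      im_ofNat]
    rw [hR, hQdef]
    field_simp
    ring
  have ha1im : a1.im = 2 * π * Q + π * (X * Y) := by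
    rw [ha1, exp_neg_ofReal_mul_I]
    rw [show (2 * π * R : ℂ) = ((2 * π * R : ℝ) : ℂ) by push_cast; ring, im_ofReal_mul]
    simp only [mul_re, mul_im, sub_re, sub_im, add_re, add_im, ofReal_re, ofReal_im, I_re, I_im]
    rw [hR, hQdef]
    field_simp
    ring
  have hmain : ‖exp (-π * x ^ 2 - I * a1) + exp (z ^ 2 / 4) * exp (-π * x ^ 2 - I * a2)‖ =
      Real.exp (π * (Q + X * Y)) *
      ‖1 + exp (-((π * (X ^ 2 - Y ^ 2) + 2 * π * X * Y * (Real.cos ε / Real.sin ε) : ℝ) : ℂ) * I)‖ := by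
    rw [← hphase]
    have e1 : exp (-π * x ^ 2 - I * a1) + exp (z ^ 2 / 4) * exp (-π * x ^ 2 - I * a2) =
        exp (-π * x ^ 2 - I * a1) * (1 + exp (z ^ 2 / 4 - I * a2 + I * a1)) := by
      rw [mul_add, mul_one, ← Complex.exp_add, ← Complex.exp_add]
      congr 2
      ring
    rw [e1, norm_mul, norm_exp]
    congr 2
    rw [sub_re, ← ofReal_neg, re_ofReal_mul, hx2]
    simp only [mul_re, I_re, I_im, zero_mul, one_mul, zero_sub, ha1im]
    ring
  rw [shiftKernel_eq, hexp]
  have hdiff : ‖((cosTheta (I * (starRingEnd ℂ) z) x - 1) + exp (z ^ 2 / 4) * (cosTheta z x - 1)) -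
      (exp (-π * x ^ 2 - I * a1) + exp (z ^ 2 / 4) * exp (-π * x ^ 2 - I * a2))‖ ≤
      C1 + Real.exp (2 * π * X * Y) * C2 := by
    rw [← norm_exp_sq_div_four hz]
    calc _ = ‖(cosTheta (I * (starRingEnd ℂ) z) x - 1 - exp (-π * x ^ 2 - I * a1)) +
          exp (z ^ 2 / 4) * (cosTheta z x - 1 - exp (-π * x ^ 2 - I * a2))‖ := by congr 1; ring
      _ ≤ C1 + ‖exp (z ^ 2 / 4)‖ * C2 := by
        refine norm_add_le_of_le b1 ?_
        rw [norm_mul]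
        exact mul_le_mul_of_nonneg_left b2 (norm_nonneg _)
  have hlow := norm_sub_norm_le
    (exp (-π * x ^ 2 - I * a1) + exp (z ^ 2 / 4) * exp (-π * x ^ 2 - I * a2))
    ((cosTheta (I * (starRingEnd ℂ) z) x - 1) + exp (z ^ 2 / 4) * (cosTheta z x - 1))
  rw [norm_sub_rev, hmain] at hlow
  have hlow2 := norm_sub_norm_le (exp (y / 2) * ((cosTheta (I * (starRingEnd ℂ) z) x - 1) +
    exp (z ^ 2 / 4) * (cosTheta z x - 1))) (exp (-y / 2) * (exp ((starRingEnd ℂ) z ^ 2 / 4) + 1))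
  rw [norm_mul, norm_mul, n1] at hlow2
  have hlast : ‖exp (-y / 2)‖ * ‖exp ((starRingEnd ℂ) z ^ 2 / 4) + 1‖ ≤
      √R * Y * (‖exp ((starRingEnd ℂ) z ^ 2 / 4)‖ + 1) := by
    refine mul_le_mul n2 ((norm_add_le _ _).trans (by rw [norm_one])) (norm_nonneg _) (by positivity)
  have h4 := mul_le_mul_of_nonneg_left (sub_le_iff_le_add'.1 (hlow.trans hdiff)) (Real.sqrt_nonneg R)
  linarith

lemma tendsto_cot_nhdsGT_zero :
    Tendsto (fun ε : ℝ => Real.cos ε / Real.sin ε) (𝓝[>] 0) atTop := by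
  have h1 : Tendsto Real.cos (𝓝[>] 0) (𝓝 1) := by
    simpa using (Real.continuous_cos.tendsto 0).mono_left nhdsWithin_le_nhds
  have h2 : Tendsto Real.sin (𝓝[>] 0) (𝓝[>] 0) := by
    rw [tendsto_nhdsWithin_iff]
    refine ⟨by simpa using (Real.continuous_sin.tendsto 0).mono_left nhdsWithin_le_nhds, ?_⟩
    filter_upwards [Ioo_mem_nhdsGT Real.pi_pos] with x hx
    exact Real.sin_pos_of_pos_of_lt_pi hx.1 hx.2
  simp only [div_eq_mul_inv]
  exact h1.pos_mul_atTop one_pos h2.inv_tendsto_nhdsGT_zero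

lemma tendsto_tan_half_nhdsGT_zero :
    Tendsto (fun ε : ℝ => (1 - Real.cos ε) / Real.sin ε) (𝓝[>] 0) (𝓝 0) := by
  have h1 : Tendsto (fun ε : ℝ => Real.sin ε / (1 + Real.cos ε)) (𝓝[>] 0) (𝓝 0) := by
    have : ContinuousAt (fun ε : ℝ => Real.sin ε / (1 + Real.cos ε)) 0 :=
      (Real.continuous_sin.continuousAt).div (by fun_prop) (by norm_num)
    simpa using this.tendsto.mono_left nhdsWithin_le_nhds
  refine h1.congr' ?_
  filter_upwards [Ioo_mem_nhdsGT (show (0 : ℝ) < π / 2 by positivity)] with x hx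
  have hs : 0 < Real.sin x := Real.sin_pos_of_pos_of_lt_pi hx.1 (by linarith [hx.2, Real.pi_pos])
  have hc : 0 < Real.cos x := Real.cos_pos_of_mem_Ioo ⟨by linarith [hx.1, Real.pi_pos], hx.2⟩
  rw [div_eq_div_iff (by positivity) hs.ne']
  nlinarith [Real.sin_sq_add_cos_sq x]

lemma tendsto_exp_neg_cot {d : ℝ} (hd : 0 < d) (S : ℝ) :
    Tendsto (fun ε : ℝ => Real.exp (-(π / 4) * d * (Real.cos ε / Real.sin ε)) * S) (𝓝[>] 0)
      (𝓝 0) := by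
  have h1 : Tendsto (fun ε : ℝ => -(π / 4) * d * (Real.cos ε / Real.sin ε)) (𝓝[>] 0) atBot :=
    tendsto_cot_nhdsGT_zero.const_mul_atTop_of_neg (by have := Real.pi_pos; nlinarith)
  simpa using (Real.tendsto_exp_atBot.comp h1).mul_const S

lemma exists_halfIntSum_le_tendsto_zero {X : ℝ} (hX : ∀ n : ℤ, (n : ℝ) - 1 / 2 ≠ X) :
    ∃ U : ℝ → ℝ, (∀ ε, 0 < ε → ε ≤ π / 4 → halfIntSum X ε ≤ U ε) ∧
      Tendsto U (𝓝[>] 0) (𝓝 0) := by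
  have hd : 0 < (X + 1 / 2 - round (X + 1 / 2)) ^ 2 := by
    have h1 := hX (round (X + 1 / 2))
    have : X + 1 / 2 - round (X + 1 / 2) ≠ 0 := fun h => h1 (by linarith)
    positivity
  refine ⟨_, fun ε h0 h1 => halfIntSum_le_of_dist X (fun n => ?_) h0 h1, tendsto_exp_neg_cot hd _⟩
  rw [← sq_abs, ← sq_abs ((n : ℝ) - 1 / 2 - X)]
  have h2 := round_le (X + 1 / 2) n
  have h3 : |X + 1 / 2 - n| = |(n : ℝ) - 1 / 2 - X| := by rw [abs_sub_comm]; congr 1; ring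
  rw [h3] at h2
  gcongr

lemma exists_halfIntSum_le_tendsto_one (X : ℝ) :
    ∃ U : ℝ → ℝ, (∀ ε, 0 < ε → ε ≤ π / 4 → halfIntSum X ε ≤ U ε) ∧
      Tendsto U (𝓝[>] 0) (𝓝 1) := by
  refine ⟨_, fun ε h0 h1 => halfIntSum_le X h0 h1, ?_⟩
  have h1 := tendsto_tan_half_nhdsGT_zero.const_mul (π * (round (X + 1 / 2) - 1 / 2) * X)
  have h2 := (Real.continuous_exp.tendsto _).comp h1
  simpa using (tendsto_exp_neg_cot (show (0 : ℝ) < 1 / 4 by norm_num) _).add h2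

end kernelBounds

/-! ### The growth comparison -/

section growth

variable {c lam : ℕ → ℝ} {h : ℂ → ℂ} {B : ℝ}

/-- The base point is `iπ/4` itself when the sum does not vanish there, and otherwise any non-zero
point of the same line. Recurrence provides the `ω n`, and `δ` allows the height and real part to be
perturbed. -/
lemma exists_tendsto_norm_expSum (hsum : Summable fun j => |c j|) (hB : ∀ j, |lam j| ≤ B)
    (hinj : Function.Injective lam) {M : ℕ} (hM : ∀ j, lam j ≤ lam M) (hc : c M ≠ 0) :
    ∃ p : ℝ, 0 < p ∧ ‖expSum c lam (((π / 4 : ℝ) : ℂ) * I)‖ ≤ p ∧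
      ∃ ω : ℕ → ℝ, Tendsto ω atTop atTop ∧ ∀ δ : ℕ → ℂ, Tendsto δ atTop (𝓝 0) →
        Tendsto (fun n => ‖expSum c lam (ω n + ((π / 4 : ℝ) : ℂ) * I + δ n)‖) atTop (𝓝 p) := by
  obtain ⟨ω₀, hp, hle⟩ : ∃ ω₀ : ℝ, 0 < ‖expSum c lam (ω₀ + ((π / 4 : ℝ) : ℂ) * I)‖ ∧
      ‖expSum c lam (((π / 4 : ℝ) : ℂ) * I)‖ ≤
        ‖expSum c lam (ω₀ + ((π / 4 : ℝ) : ℂ) * I)‖ := by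
    by_cases h0 : expSum c lam (((π / 4 : ℝ) : ℂ) * I) = 0
    · obtain ⟨ω₀, h1⟩ := exists_expSum_ne_zero hsum hB hinj hM hc (π / 4)
      exact ⟨ω₀, norm_pos_iff.2 h1, by rw [h0, norm_zero]; exact norm_nonneg _⟩
    · exact ⟨0, by simpa using h0, by simp⟩
  obtain ⟨ω, h1, h2⟩ := exists_tendsto_expSum hsum hB (ω₀ + ((π / 4 : ℝ) : ℂ) * I)
  refine ⟨_, hp, hle, fun n => ω n + ω₀, tendsto_atTop_add_const_right _ _ h1, fun δ hδ => ?_⟩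
  have h3 := (tendsto_expSum_add hsum hB (fun n => ?_) hδ h2).norm
  · refine h3.congr fun n => ?_
    push_cast
    rw [← add_assoc]
  · have : ((ω n : ℂ) + (ω₀ + ((π / 4 : ℝ) : ℂ) * I)).im = π / 4 := by simp
    rw [this, abs_of_pos (by positivity)]
    linarith [Real.pi_le_four]

/-- A one-signed superposition of translates forces the growth of its kernel along suitable
horizontal shifts not to exceed the growth on the imaginary axis. -/
lemma StripDecay.exists_growth_le (hh : StripDecay h) (hsum : Summable fun j => |c j|)
    (hB : ∀ j, |lam j| ≤ B) (hinj : Function.Injective lam) {M : ℕ} (hM : ∀ j, lam j ≤ lam M)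
    (hc : c M ≠ 0) (him : ∀ t, (shiftSum c lam h t).im = 0) {T : ℝ}
    (hT : ∀ t, T ≤ t → 0 ≤ (shiftSum c lam h t).re) :
    ∃ ω : ℕ → ℝ, Tendsto ω atTop atTop ∧ ∀ (ε R G l u : ℕ → ℝ) (l' u' : ℝ),
      Tendsto ε atTop (𝓝[>] 0) → Tendsto (fun n => R n - ω n) atTop (𝓝 0) →
      Tendsto G atTop atTop → Tendsto l atTop (𝓝 l') → Tendsto u atTop (𝓝 u') → 0 ≤ u' →
      (∀ᶠ n in atTop, G n * l n ≤ ‖h (R n + ((π / 4 - ε n : ℝ) : ℂ) * I)‖) →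
      (∀ᶠ n in atTop, ‖h (((π / 4 - ε n : ℝ) : ℂ) * I)‖ ≤ G n * u n) → l' ≤ u' := by
  obtain ⟨p, hp, hle, ω, hω, hrec⟩ := exists_tendsto_norm_expSum hsum hB hinj hM hc
  obtain ⟨C, hC⟩ := hh.norm_expSum_mul_le hsum hB him hT
  refine ⟨ω, hω, fun ε R G l u l' u' hε hR hG hl hu hu0 hlow hupp => ?_⟩
  rw [tendsto_nhdsWithin_iff] at hε
  obtain ⟨hε0, hεpos⟩ := hε
  have hεc : Tendsto (fun n => (ε n : ℂ)) atTop (𝓝 0) := by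
    simpa [Function.comp_def] using (continuous_ofReal.tendsto 0).comp hε0
  have hRc : Tendsto (fun n => ((R n - ω n : ℝ) : ℂ)) atTop (𝓝 0) := by
    simpa [Function.comp_def] using (continuous_ofReal.tendsto 0).comp hR
  have t1 : Tendsto (fun n => ‖expSum c lam (R n + ((π / 4 - ε n : ℝ) : ℂ) * I)‖) atTop (𝓝 p) := by
    refine (hrec (fun n => ((R n - ω n : ℝ) : ℂ) - ε n * I) ?_).congr fun n => ?_
    · simpa using hRc.sub (hεc.mul_const I)
    · congr 2
      push_cast
      ring
  have t2 : Tendsto (fun n => ‖expSum c lam (((π / 4 - ε n : ℝ) : ℂ) * I)‖) atTop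
      (𝓝 ‖expSum c lam (((π / 4 : ℝ) : ℂ) * I)‖) := by
    have hcont : Continuous fun x : ℝ => ‖expSum c lam (((π / 4 - x : ℝ) : ℂ) * I)‖ :=
      ((differentiable_expSum hsum hB).continuous.comp (by fun_prop)).norm
    simpa [Function.comp_def] using (hcont.tendsto 0).comp hε0
  have hev : ∀ᶠ n in atTop, ‖expSum c lam (R n + ((π / 4 - ε n : ℝ) : ℂ) * I)‖ * l n ≤
      ‖expSum c lam (((π / 4 - ε n : ℝ) : ℂ) * I)‖ * u n + C * (G n)⁻¹ := by
    filter_upwards [hlow, hupp, hεpos, hε0.eventually_le_const (show (0 : ℝ) < π / 4 by positivity),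
      hG.eventually_gt_atTop 0] with n h1 h2 h3 h4 h5
    have h6 := hC (π / 4 - ε n) (by linarith) (by linarith [mem_Ioi.1 h3]) (R n)
    have h7 := mul_le_mul_of_nonneg_left h1
      (norm_nonneg (expSum c lam (R n + ((π / 4 - ε n : ℝ) : ℂ) * I)))
    have h8 := mul_le_mul_of_nonneg_left h2
      (norm_nonneg (expSum c lam (((π / 4 - ε n : ℝ) : ℂ) * I)))
    refine le_of_mul_le_mul_left ?_ h5
    have h9 : G n * (C * (G n)⁻¹) = C := by field_simp
    rw [mul_add, h9]
    linarith
  have hlim := le_of_tendsto_of_tendsto (t1.mul hl)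
    ((t2.mul hu).add (hG.inv_tendsto_atTop.const_mul C)) hev
  rw [mul_zero, add_zero] at hlim
  exact le_of_mul_le_mul_left (hlim.trans (mul_le_mul_of_nonneg_right hle hu0)) hp

variable {z : ℂ} {X Y : ℝ}

/-- The common exponentials cancel and the prefactors `√(Y / (2 sin ε))` and `1 / √(2 sin ε)` leave
the ratio `√Y`. Since `cot ε` may be moved by a bounded amount, the phase can be made favourable
without leaving the almost periods. -/
lemma shiftKernel_growth_le
    (hsum : Summable fun j => |c j|) (hB : ∀ j, |lam j| ≤ B) (hinj : Function.Injective lam) {M : ℕ}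
    (hM : ∀ j, lam j ≤ lam M) (hc : c M ≠ 0) {T : ℝ}
    (hT : ∀ t, T ≤ t → 0 ≤ (shiftSum c lam (shiftKernel z) t).re)
    (him : ∀ t, (shiftSum c lam (shiftKernel z) t).im = 0)
    (hz : z * exp ((π / 4 : ℂ) * I) = 2 * (√π : ℝ) * (X + Y * I)) (hY : 0 < Y) {κ K : ℝ}
    (hphase : ∀ x : ℝ, ∃ q : ℝ, |q - x| ≤ K ∧
      κ ≤ ‖1 + exp (-((π * (X ^ 2 - Y ^ 2) + 2 * π * X * Y * q : ℝ) : ℂ) * I)‖)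
    {U V : ℝ → ℝ} {u v : ℝ} (hU : ∀ ε, 0 < ε → ε ≤ π / 4 → halfIntSum (-X) ε ≤ U ε)
    (hV : ∀ ε, 0 < ε → ε ≤ π / 4 → halfIntSum X ε ≤ V ε) (hu : Tendsto U (𝓝[>] 0) (𝓝 u))
    (hv : Tendsto V (𝓝[>] 0) (𝓝 v)) (hu0 : 0 ≤ u) (hv0 : 0 ≤ v) : √Y * κ ≤ u + v := by
  obtain ⟨ω, hω, hgrow⟩ := (stripDecay_shiftKernel z).exists_growth_le hsum hB hinj hM hc him hT
  obtain ⟨C1, hC1⟩ := exists_norm_shiftKernel_le hz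
  obtain ⟨C2, hC2⟩ := exists_le_norm_shiftKernel hz hY
  -- With `q = cot ε`, this target makes `log (Y / (2 sin ε))` asymptotic to `ω n` with error
  -- tending to 0; the bounded correction `K` is negligible against `exp (ω n)`.
  choose q hq hκ using fun n => hphase (2 * Real.exp (ω n) / Y)
  have hexp : Tendsto (fun n => Real.exp (ω n)) atTop atTop := Real.tendsto_exp_atTop.comp hω
  have hqtop : Tendsto q atTop atTop := by
    have h1 : Tendsto (fun n => 2 * Real.exp (ω n) / Y + -K) atTop atTop :=
      tendsto_atTop_add_const_right _ _
        ((hexp.const_mul_atTop (show (0 : ℝ) < 2 by norm_num)).atTop_div_const hY)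
    refine tendsto_atTop_mono (fun n => ?_) h1
    linarith [neg_le_of_abs_le (hq n)]
  set ε : ℕ → ℝ := fun n => Real.arctan (q n)⁻¹ with hεdef
  have hε : Tendsto ε atTop (𝓝[>] 0) := by
    rw [tendsto_nhdsWithin_iff]
    constructor
    · simpa [hεdef, Function.comp_def] using
        (Real.continuous_arctan.tendsto 0).comp hqtop.inv_tendsto_atTop
    · filter_upwards [hqtop.eventually_gt_atTop 0] with n hn
      exact Real.arctan_pos.2 (inv_pos.2 hn)
  have hε0 : Tendsto ε atTop (𝓝 0) := hε.mono_right nhdsWithin_le_nhds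
  have hcot : ∀ n, Real.cos (ε n) / Real.sin (ε n) = q n := by
    intro n
    rw [← inv_div, ← Real.tan_eq_sin_div_cos, Real.tan_arctan, inv_inv]
  have hgood : ∀ᶠ n in atTop, 0 < ε n ∧ ε n ≤ π / 4 ∧ 0 < Real.sin (ε n) := by
    filter_upwards [hε (self_mem_nhdsWithin),
      hε0.eventually_le_const (show (0 : ℝ) < π / 4 by positivity)] with n h1 h2
    exact ⟨h1, h2, Real.sin_pos_of_pos_of_lt_pi h1 (by linarith [Real.pi_pos])⟩
  set E : ℕ → ℝ := fun n => Real.exp (π * (Y ^ 2 * q n / 2 + X * Y)) with hEdef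
  have hE : Tendsto E atTop atTop := by
    refine Real.tendsto_exp_atTop.comp (Tendsto.const_mul_atTop Real.pi_pos
      (tendsto_atTop_add_const_right _ _ ?_))
    exact (hqtop.const_mul_atTop (by positivity)).atTop_div_const (by norm_num)
  have hr : Tendsto (fun n => (√(2 * Real.sin (ε n)))⁻¹) atTop atTop := by
    have h1 : Tendsto (fun n => √(2 * Real.sin (ε n))) atTop (𝓝[>] 0) := by
      rw [tendsto_nhdsWithin_iff]
      constructor
      · have hcont : Continuous fun x : ℝ => √(2 * Real.sin x) := by fun_prop
        simpa [Function.comp_def] using (hcont.tendsto 0).comp hε0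
      · filter_upwards [hgood] with n hn
        have := hn.2.2
        exact Real.sqrt_pos.2 (by positivity)
    exact h1.inv_tendsto_nhdsGT_zero
  have hG : Tendsto (fun n => (√(2 * Real.sin (ε n)))⁻¹ * E n) atTop atTop := hr.atTop_mul_atTop₀ hE
  have hqexp : Tendsto (fun n => q n * (Real.exp (ω n))⁻¹) atTop (𝓝 (2 / Y)) := by
    rw [tendsto_iff_norm_sub_tendsto_zero]
    refine squeeze_zero (fun _ => norm_nonneg _) (fun n => ?_)
      (by simpa using hexp.inv_tendsto_atTop.const_mul K)
    have h1 : q n * (Real.exp (ω n))⁻¹ - 2 / Y =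
        (q n - 2 * Real.exp (ω n) / Y) * (Real.exp (ω n))⁻¹ := by
      field_simp
    rw [h1, norm_mul, norm_inv, Real.norm_of_nonneg (Real.exp_pos _).le, Real.norm_eq_abs]
    exact mul_le_mul_of_nonneg_right (hq n) (by positivity)
  have hRtend : Tendsto (fun n => Real.log (Y / (2 * Real.sin (ε n))) - ω n) atTop (𝓝 0) := by
    have h1 : Tendsto (fun n => Y / (2 * Real.cos (ε n)) * (q n * (Real.exp (ω n))⁻¹)) atTop
        (𝓝 1) := by
      have h2 : Tendsto (fun n => Y / (2 * Real.cos (ε n))) atTop (𝓝 (Y / 2)) := by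
        have h3 : Tendsto (fun n => 2 * Real.cos (ε n)) atTop (𝓝 2) := by
          simpa using ((Real.continuous_cos.tendsto 0).comp hε0).const_mul 2
        exact tendsto_const_nhds.div h3 (by norm_num)
      have h4 := h2.mul hqexp
      rwa [show Y / 2 * (2 / Y) = 1 by field_simp] at h4
    have h5 := (Real.continuousAt_log one_ne_zero).tendsto.comp h1
    rw [Real.log_one] at h5
    refine h5.congr' ?_
    filter_upwards [hgood] with n hn
    have hs := hn.2.2
    have hco : Real.cos (ε n) ≠ 0 := (Real.cos_arctan_pos _).ne'
    have h6 : Y / (2 * Real.cos (ε n)) * (q n * (Real.exp (ω n))⁻¹) =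
        Y / (2 * Real.sin (ε n)) * (Real.exp (ω n))⁻¹ := by
      rw [← hcot n]
      field_simp
    rw [Function.comp_apply, h6, Real.log_mul (by positivity) (by positivity), Real.log_inv,
      Real.log_exp, sub_eq_add_neg]
  refine hgrow ε (fun n => Real.log (Y / (2 * Real.sin (ε n))))
    (fun n => (√(2 * Real.sin (ε n)))⁻¹ * E n)
    (fun n => √Y * (κ - C2 * (E n)⁻¹))
    (fun n => (U (ε n) + V (ε n)) + C1 * ((√(2 * Real.sin (ε n)))⁻¹ * E n)⁻¹) _ _
    hε hRtend hG ?_ ?_ (add_nonneg hu0 hv0) ?_ ?_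
  · simpa using ((hE.inv_tendsto_atTop.const_mul C2).const_sub κ).const_mul (√Y)
  · simpa using ((hu.comp hε).add (hv.comp hε)).add (hG.inv_tendsto_atTop.const_mul C1)
  · have hQ : ∀ᶠ n in atTop, 1 ≤ Y ^ 2 * q n / 2 :=
      ((hqtop.const_mul_atTop (show 0 < Y ^ 2 by positivity)).atTop_div_const
        (by norm_num)).eventually_ge_atTop 1
    filter_upwards [hgood, hQ] with n ⟨h1, h2, h3⟩ hn
    have h4 := hC2 (ε n) h1 h2 (by rw [hcot]; exact hn)
    rw [hcot] at h4
    refine le_trans (le_of_eq ?_) ((mul_le_mul_of_nonneg_left (sub_le_sub_right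
      (mul_le_mul_of_nonneg_left (hκ n) (Real.exp_pos _).le) C2) (Real.sqrt_nonneg _)).trans h4)
    rw [Real.sqrt_div hY.le, div_eq_mul_inv]
    have h5 : E n * (E n)⁻¹ = 1 := mul_inv_cancel₀ (Real.exp_pos _).ne'
    change _ = √Y * (√(2 * Real.sin (ε n)))⁻¹ * (E n * κ - C2)
    linear_combination (-C2 * √Y * (√(2 * Real.sin (ε n)))⁻¹) * h5
  · filter_upwards [hgood] with n ⟨h1, h2, h3⟩
    have h4 := hC1 (ε n) h1 h2
    rw [hcot] at h4
    refine h4.trans ?_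
    have h5 : 0 < (√(2 * Real.sin (ε n)))⁻¹ * E n := by
      have : 0 < √(2 * Real.sin (ε n)) := Real.sqrt_pos.2 (by positivity)
      positivity
    rw [mul_add (_ * _) (_ + _), mul_left_comm _ C1, mul_inv_cancel₀ h5.ne', mul_one, ← mul_assoc]
    gcongr
    exacts [hU _ h1 h2, hV _ h1 h2]

end growth

/-! ### The point `z = 0` -/

lemma exp_neg_pi_le_norm_cosTheta_zero {x : ℂ} (h0 : 1 / 2 ≤ (x ^ 2).re) (h1 : (x ^ 2).re ≤ 1) :
    Real.exp (-π) ≤ ‖cosTheta 0 x - 1‖ := by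
  have h := hasSum_cosTheta_sub_one 0 (x := x) (by linarith)
  simp only [mul_zero, cos_zero, mul_one] at h
  rw [← hasSum_nat_add_iff' 1] at h
  simp only [Finset.range_one, Finset.sum_singleton, Nat.cast_zero, zero_add, one_pow,
    mul_one] at h
  set r := (x ^ 2).re with hr
  have hpi := Real.pi_gt_three
  have hnorm : ∀ a : ℝ, ‖exp (-π * (a : ℂ) ^ 2 * x ^ 2)‖ = Real.exp (-π * a ^ 2 * r) := by
    intro a
    rw [norm_exp, show (-π * (a : ℂ) ^ 2 * x ^ 2) = ((-π * a ^ 2 : ℝ) : ℂ) * x ^ 2 by push_cast; ring,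
      re_ofReal_mul]
  have hq : Real.exp (-(3 * π * r)) ≤ 1 / 4 := by
    rw [Real.exp_neg, one_div]
    apply inv_anti₀ (by norm_num)
    have := Real.add_one_le_exp (3 * π * r)
    nlinarith
  have hgeo : HasSum (fun n : ℕ => 2 * Real.exp (-π * r) * ((1 / 4) * (1 / 4 : ℝ) ^ n))
      (2 * Real.exp (-π * r) * ((1 / 4) * (1 - 1 / 4)⁻¹)) :=
    ((hasSum_geometric_of_lt_one (by norm_num) (by norm_num)).mul_left _).mul_left _
  have hle : ‖cosTheta 0 x - 1 - 2 * exp (-π * x ^ 2)‖ ≤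
      2 * Real.exp (-π * r) * ((1 / 4) * (1 - 1 / 4)⁻¹) := by
    rw [← h.tsum_eq]
    refine tsum_of_norm_bounded hgeo fun n => ?_
    have e1 : (((n + 1 : ℕ) : ℂ) + 1) = ((n + 2 : ℝ) : ℂ) := by push_cast; ring
    rw [e1, norm_mul, norm_ofNat, hnorm, mul_assoc (2 : ℝ)]
    refine mul_le_mul_of_nonneg_left ?_ (by norm_num)
    have e2 : (1 / 4 : ℝ) * (1 / 4) ^ n = (1 / 4) ^ (n + 1) := by ring
    rw [e2]
    have h3 : Real.exp (-(3 * π * r)) ^ (n + 1) ≤ (1 / 4) ^ (n + 1) := by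
      gcongr
    refine le_trans ?_ (mul_le_mul_of_nonneg_left h3 (Real.exp_pos _).le)
    rw [← Real.exp_nat_mul, ← Real.exp_add]
    apply Real.exp_le_exp.2
    push_cast
    have : 0 ≤ π * r * (n ^ 2 + n) := by positivity
    nlinarith
  have h2 := norm_sub_norm_le (2 * exp (-π * x ^ 2)) (cosTheta 0 x - 1)
  rw [norm_sub_rev _ (cosTheta 0 x - 1), norm_mul, norm_ofNat] at h2
  have h3 : ‖exp (-π * x ^ 2)‖ = Real.exp (-π * r) := by simpa using hnorm 1
  rw [h3] at h2
  have h4 : Real.exp (-π) ≤ Real.exp (-π * r) := Real.exp_le_exp.2 (by nlinarith)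
  have h5 := Real.exp_pos (-π * r)
  rw [show (1 / 4 : ℝ) * (1 - 1 / 4)⁻¹ = 1 / 3 by norm_num] at hle
  linarith

section oscillation

variable {c lam : ℕ → ℝ} {B : ℝ} {z : ℂ} {X Y : ℝ}

lemma shiftSum_shiftKernel_im (hsum : Summable fun j => |c j|) (z : ℂ) (t : ℝ) :
    (shiftSum c lam (shiftKernel z) t).im = 0 := by
  rw [shiftSum, im_tsum ((stripDecay_shiftKernel z).summable_shift hsum t)]
  refine (tsum_congr fun j => ?_).trans tsum_zero
  rw [im_ofReal_mul, lineTransform_shiftKernel_im, mul_zero]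

/-- With `X = Y = 0` there is no exponential growth. On the imaginary axis the half-integer
Gaussians keep the kernel bounded, but along the almost periods it is at least of order `√r` with `r
= exp (ω n)`. -/
lemma exists_shiftSum_zero_neg
    (hsum : Summable fun j => |c j|) (hB : ∀ j, |lam j| ≤ B) (hinj : Function.Injective lam) {M : ℕ}
    (hM : ∀ j, lam j ≤ lam M) (hc : c M ≠ 0) (T : ℝ) :
    ∃ t, T ≤ t ∧ (shiftSum c lam (shiftKernel 0) t).re < 0 := by
  by_contra! hT
  obtain ⟨ω, hω, hgrow⟩ := (stripDecay_shiftKernel 0).exists_growth_le hsum hB hinj hM hc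
    (shiftSum_shiftKernel_im hsum 0) hT
  obtain ⟨C, hC⟩ := exists_norm_shiftKernel_le (z := 0) (X := 0) (Y := 0) (by simp)
  set S := ∑' n : ℤ, Real.exp (-(π / 4) * ((n : ℝ) - 1 / 2 - 0) ^ 2 + π * |(n : ℝ) - 1 / 2| * |0|)
    with hS
  have hS0 : 0 ≤ S := tsum_nonneg fun _ => (Real.exp_pos _).le
  set r : ℕ → ℝ := fun n => Real.exp (ω n) with hr
  have hrtop : Tendsto r atTop atTop := Real.tendsto_exp_atTop.comp hω
  have hrpos : ∀ n, 0 < r n := fun n => Real.exp_pos _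
  -- The choice `sin ε = 1 / (2 r²)` gives `Re x² = r² sin 2ε = cos ε`, which stays in the range
  -- where the theta series minus 1 is bounded below.
  set a : ℕ → ℝ := fun n => (r n ^ 2)⁻¹ / 2 with ha
  have ha0 : Tendsto a atTop (𝓝 0) := by
    have h1 : Tendsto (fun n => r n ^ 2) atTop atTop := (tendsto_pow_atTop two_ne_zero).comp hrtop
    simpa using h1.inv_tendsto_atTop.div_const 2
  have hapos : ∀ n, 0 < a n := fun n => by have := hrpos n; positivity
  have hε0 : Tendsto (fun n => Real.arcsin (a n)) atTop (𝓝 0) := by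
    simpa [Function.comp_def] using (Real.continuous_arcsin.tendsto 0).comp ha0
  have hε : Tendsto (fun n => Real.arcsin (a n)) atTop (𝓝[>] 0) :=
    tendsto_nhdsWithin_iff.2 ⟨hε0, Eventually.of_forall fun n => Real.arcsin_pos.2 (hapos n)⟩
  have hgood : ∀ᶠ n in atTop, Real.arcsin (a n) ≤ π / 4 ∧ Real.sin (Real.arcsin (a n)) = a n ∧
      1 / 2 ≤ Real.cos (Real.arcsin (a n)) ∧ 1 ≤ r n := by
    have hcos : Tendsto (fun n => Real.cos (Real.arcsin (a n))) atTop (𝓝 1) := by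
      simpa [Function.comp_def] using (Real.continuous_cos.tendsto 0).comp hε0
    filter_upwards [hε0.eventually_le_const (show (0 : ℝ) < π / 4 by positivity),
      ha0.eventually_le_const one_pos, hcos.eventually_const_le (show (1 / 2 : ℝ) < 1 by norm_num),
      hrtop.eventually_ge_atTop 1] with n h1 h2 h3 h4
    exact ⟨h1, Real.sin_arcsin (by linarith [hapos n]) h2, h3, h4⟩
  have hsqrt : Tendsto (fun n => √(r n)) atTop atTop := Real.tendsto_sqrt_atTop.comp hrtop
  have key := hgrow (fun n => Real.arcsin (a n)) ω (fun n => √(r n))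
    (fun n => 2 * (Real.exp (-π) - (r n)⁻¹))
    (fun n => (2 * (16 / π) * S + C) * (√(r n))⁻¹) (2 * Real.exp (-π)) 0 hε (by simp) hsqrt
    (by simpa using (hrtop.inv_tendsto_atTop.const_sub (Real.exp (-π))).const_mul 2)
    (by simpa using hsqrt.inv_tendsto_atTop.const_mul (2 * (16 / π) * S + C)) le_rfl ?_ ?_
  · linarith [Real.exp_pos (-π)]
  · filter_upwards [hgood] with n ⟨h1, h2, h3, h4⟩
    set ε := Real.arcsin (a n) with hεn
    have hexp : exp (ω n + ((π / 4 - ε : ℝ) : ℂ) * I) = r n * sectorPoint ε := by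
      rw [Complex.exp_add, ← ofReal_exp]
      rfl
    have hx2 : (((r n : ℂ) * sectorPoint ε) ^ 2).re = Real.cos ε := by
      have e1 : sectorPoint ε ^ 2 = I + 2 * Real.sin ε * exp (-(ε : ℂ) * I) := by
        have := I_mul_sectorPoint_sq ε
        linear_combination (-I) * this + (sectorPoint ε ^ 2 -
          2 * Real.sin ε * exp (-(ε : ℂ) * I)) * I_sq
      rw [mul_pow, e1, ← ofReal_pow, re_ofReal_mul, exp_neg_ofReal_mul_I]
      simp only [mul_re, mul_im, sub_re, sub_im, add_re, ofReal_re, ofReal_im, I_re, I_im,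
        re_ofNat, im_ofNat]
      rw [h2, ha]
      have := (hrpos n).ne'
      field_simp
      ring
    have hlow := exp_neg_pi_le_norm_cosTheta_zero (x := r n * sectorPoint ε) (by rw [hx2]; exact h3)
      (by rw [hx2]; exact Real.cos_le_one _)
    rw [shiftKernel_eq, hexp]
    set y : ℂ := ω n + ((π / 4 - ε : ℝ) : ℂ) * I with hy
    have hyre : y.re = ω n := by simp [hy]
    have n1 : ‖exp (y / 2)‖ = √(r n) := by
      rw [norm_exp, hr, ← Real.exp_half]
      congr 1
      rw [← hyre]
      simp
    have n2 : ‖exp (-y / 2)‖ = √(r n) * (r n)⁻¹ := by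
      rw [norm_exp, hr, ← Real.exp_half, ← Real.exp_neg, ← Real.exp_add]
      congr 1
      rw [← hyre]
      simp
      ring
    set ψ := cosTheta 0 (r n * sectorPoint ε) - 1 with hψ
    have e2 : exp (y / 2) * ((cosTheta (I * (starRingEnd ℂ) 0) (r n * sectorPoint ε) - 1) +
        exp (0 ^ 2 / 4) * (cosTheta 0 (r n * sectorPoint ε) - 1)) -
        exp (-y / 2) * (exp ((starRingEnd ℂ) 0 ^ 2 / 4) + 1) =
        2 * (exp (y / 2) * ψ) - 2 * exp (-y / 2) := by
      simp [hψ]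
      ring
    rw [e2]
    refine le_trans ?_ (norm_sub_norm_le _ _)
    rw [norm_mul, norm_mul, norm_mul, n1, n2, norm_ofNat]
    have := mul_le_mul_of_nonneg_left hlow (Real.sqrt_nonneg (r n))
    linarith
  · filter_upwards [hgood] with n ⟨h1, h2, h3, h4⟩
    set ε := Real.arcsin (a n) with hεn
    have hεpos : 0 < ε := Real.arcsin_pos.2 (hapos n)
    refine (hC ε hεpos h1).trans ?_
    have hd : ∀ m : ℤ, (1 / 4 : ℝ) ≤ ((m : ℝ) - 1 / 2 - 0) ^ 2 := by
      intro m
      have : (0 : ℝ) ≤ m * (m - 1) := by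
        rcases le_or_gt m 0 with hm | hm
        · have : (m : ℝ) ≤ 0 := by exact_mod_cast hm
          nlinarith
        · have : (1 : ℝ) ≤ m := by exact_mod_cast hm
          nlinarith
      nlinarith
    have hsum0 := halfIntSum_le_of_dist 0 hd hεpos h1
    rw [← hS] at hsum0
    have hsin : (√(2 * Real.sin ε))⁻¹ = r n := by
      rw [h2, ha, show 2 * ((r n ^ 2)⁻¹ / 2) = (r n)⁻¹ ^ 2 by rw [inv_pow]; ring,
        Real.sqrt_sq (inv_nonneg.2 (hrpos n).le), inv_inv]
    have hcot : r n ^ 2 ≤ Real.cos ε / Real.sin ε := by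
      have := hrpos n
      rw [h2, ha, div_div_eq_mul_div, div_inv_eq_mul]
      nlinarith [sq_nonneg (r n)]
    have hbound : r n * Real.exp (-(π / 4) * (1 / 4) * (Real.cos ε / Real.sin ε)) ≤ 16 / π := by
      have hpi := Real.pi_pos
      have k1 : Real.exp (-(π / 4) * (1 / 4) * (Real.cos ε / Real.sin ε)) ≤
          Real.exp (-(π / 16 * r n)) := by
        apply Real.exp_le_exp.2
        have : r n ≤ r n ^ 2 := by nlinarith
        nlinarith
      have k2 := Real.add_one_le_exp (π / 16 * r n)
      have k3 := mul_le_mul_of_nonneg_left k1 (hrpos n).le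
      refine k3.trans ?_
      rw [Real.exp_neg, ← div_eq_mul_inv, div_le_div_iff₀ (Real.exp_pos _) hpi]
      linarith
    have hrS := mul_le_mul_of_nonneg_right hbound hS0
    have hrH := mul_le_mul_of_nonneg_left hsum0 (hrpos n).le
    have hR : √(r n) * ((2 * (16 / π) * S + C) * (√(r n))⁻¹) = 2 * (16 / π) * S + C := by
      have : √(r n) ≠ 0 := (Real.sqrt_pos.2 (hrpos n)).ne'
      field_simp
    rw [hR, hsin]
    have e3 : r n * (Real.exp (π * (0 ^ 2 * (Real.cos ε / Real.sin ε) / 2 + 0 * 0)) *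
        (halfIntSum (-0) ε + halfIntSum 0 ε)) = 2 * (r n * halfIntSum 0 ε) := by
      simp
      ring
    rw [e3]
    linarith

end oscillation

/-! ### Case distinction over the region -/

/-- Every superposition of translates of the transform of `shiftKernel z` whose frequencies attain
their maximum is negative at arbitrarily large arguments. -/
def ShiftOscillates (z : ℂ) : Prop :=
  ∀ (c lam : ℕ → ℝ) (B : ℝ) (M : ℕ), (Summable fun j => |c j|) → (∀ j, |lam j| ≤ B) →
    Function.Injective lam → (∀ j, lam j ≤ lam M) → c M ≠ 0 →
    ∀ T, ∃ t, T ≤ t ∧ (shiftSum c lam (shiftKernel z) t).re < 0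

section oscillation

variable {z : ℂ} {X Y : ℝ}

lemma shiftKernel_neg (z : ℂ) : shiftKernel (-z) = shiftKernel z := by
  ext y
  rw [shiftKernel, map_neg, mul_neg, thetaKernel_neg_left, thetaKernel_neg_left, neg_sq, shiftKernel]

lemma ShiftOscillates.of_neg (h : ShiftOscillates (-z)) : ShiftOscillates z := by
  simpa only [ShiftOscillates, shiftKernel_neg] using h

lemma shiftOscillates_zero : ShiftOscillates 0 :=
  fun _ _ _ _ hsum hB hinj hM hc T => exists_shiftSum_zero_neg hsum hB hinj hM hc T

lemma shiftOscillates_of_not_half_int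
    (hz : z * exp ((π / 4 : ℂ) * I) = 2 * (√π : ℝ) * (X + Y * I)) (hY : 0 < Y)
    (hX : ∀ n : ℤ, (n : ℝ) - 1 / 2 ≠ X) {κ K : ℝ} (hκ : 0 < κ)
    (hphase : ∀ x : ℝ, ∃ q : ℝ, |q - x| ≤ K ∧
      κ ≤ ‖1 + exp (-((π * (X ^ 2 - Y ^ 2) + 2 * π * X * Y * q : ℝ) : ℂ) * I)‖) :
    ShiftOscillates z := by
  intro c lam B M hsum hB hinj hM hc T
  by_contra! hT
  have hX' : ∀ n : ℤ, (n : ℝ) - 1 / 2 ≠ -X := fun n hn => hX (1 - n) (by push_cast; linarith)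
  obtain ⟨U, hU, hu⟩ := exists_halfIntSum_le_tendsto_zero hX'
  obtain ⟨V, hV, hv⟩ := exists_halfIntSum_le_tendsto_zero hX
  have := shiftKernel_growth_le hsum hB hinj hM hc hT (shiftSum_shiftKernel_im hsum z) hz hY hphase
    hU hV hu hv le_rfl le_rfl
  have h2 : 0 < √Y * κ := mul_pos (Real.sqrt_pos.2 hY) hκ
  linarith

lemma shiftOscillates_of_one_lt
    (hz : z * exp ((π / 4 : ℂ) * I) = 2 * (√π : ℝ) * (X + Y * I)) (hY : 1 < Y) {K : ℝ}
    (hphase : ∀ x : ℝ, ∃ q : ℝ, |q - x| ≤ K ∧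
      2 ≤ ‖1 + exp (-((π * (X ^ 2 - Y ^ 2) + 2 * π * X * Y * q : ℝ) : ℂ) * I)‖) :
    ShiftOscillates z := by
  intro c lam B M hsum hB hinj hM hc T
  by_contra! hT
  obtain ⟨U, hU, hu⟩ := exists_halfIntSum_le_tendsto_one (-X)
  obtain ⟨V, hV, hv⟩ := exists_halfIntSum_le_tendsto_one X
  have := shiftKernel_growth_le hsum hB hinj hM hc hT (shiftSum_shiftKernel_im hsum z) hz
    (by linarith) hphase hU hV hu hv zero_le_one zero_le_one
  have h2 : 1 < √Y := by rw [Real.lt_sqrt (by norm_num)]; linarith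
  linarith

/-- As `q` varies the angle runs through a full turn in length `1 / |b|`; rounding finds an angle
that is a multiple of `2π` within half of that length. -/
lemma exists_phase_eq_two (a : ℝ) {b : ℝ} (hb : b ≠ 0) (x : ℝ) :
    ∃ q : ℝ, |q - x| ≤ 1 / (2 * |b|) ∧
      2 ≤ ‖1 + exp (-((π * a + 2 * π * b * q : ℝ) : ℂ) * I)‖ := by
  refine ⟨(round (a / 2 + b * x) - a / 2) / b, ?_, ?_⟩
  · have h1 := abs_sub_round (a / 2 + b * x)
    rw [abs_sub_comm] at h1
    rw [show (round (a / 2 + b * x) - a / 2) / b - x = (round (a / 2 + b * x) - (a / 2 + b * x)) / b by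
      field_simp; ring, abs_div, ← div_div]
    gcongr
  · have h1 : exp (-((π * a + 2 * π * b * ((round (a / 2 + b * x) - a / 2) / b) : ℝ) : ℂ) * I) = 1 := by
      rw [exp_eq_one_iff]
      refine ⟨-round (a / 2 + b * x), ?_⟩
      rw [show π * a + 2 * π * b * ((round (a / 2 + b * x) - a / 2) / b) =
        2 * π * round (a / 2 + b * x) by field_simp; ring]
      push_cast
      ring
    rw [h1]
    norm_num

lemma exists_phase_eq_two_mul (hX : X ≠ 0) (hY : Y ≠ 0) : ∃ K : ℝ, ∀ x : ℝ, ∃ q : ℝ, |q - x| ≤ K ∧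
    2 ≤ ‖1 + exp (-((π * (X ^ 2 - Y ^ 2) + 2 * π * X * Y * q : ℝ) : ℂ) * I)‖ := by
  refine ⟨1 / (2 * |X * Y|), fun x => ?_⟩
  obtain ⟨q, h1, h2⟩ := exists_phase_eq_two (X ^ 2 - Y ^ 2) (mul_ne_zero hX hY) x
  exact ⟨q, h1, by rwa [mul_assoc (2 * π)]⟩

lemma shiftOscillates_of_eq_zero (hz : z * exp ((π / 4 : ℂ) * I) = 2 * (√π : ℝ) * ((0 : ℝ) + Y * I))
    (hY : 0 < Y) (hne : exp ((π * Y ^ 2 : ℝ) * I) ≠ -1) : ShiftOscillates z := by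
  refine shiftOscillates_of_not_half_int hz hY (fun n hn => ?_)
    (κ := ‖1 + exp ((π * Y ^ 2 : ℝ) * I)‖) (K := 0) ?_ fun x => ⟨x, by simp, le_of_eq ?_⟩
  · have h1 : (2 * n : ℝ) = 1 := by linarith
    have h2 : 2 * n = 1 := by exact_mod_cast h1
    omega
  · rw [norm_pos_iff]
    intro h
    exact hne (by linear_combination h)
  · congr 3
    push_cast
    ring

/-- The inequality matters only when `X` is a half-integer: then `4X² ≥ 1` forces `Y > 1`, and the
factor 2 from aligned phases times `√Y` exceeds the limiting bound `1 + 1`. For `X = 0` the phase is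
constant and cannot be adjusted. -/
lemma shiftOscillates_or_exceptional
    (hz : z * exp ((π / 4 : ℂ) * I) = 2 * (√π : ℝ) * (X + Y * I)) (hY : 0 < Y)
    (hXY : 4 * X ^ 2 < (1 - 2 * Y) ^ 2) :
    ShiftOscillates z ∨ X = 0 ∧ exp ((π * Y ^ 2 : ℝ) * I) = -1 := by
  by_cases hX0 : X = 0
  · by_cases hne : exp ((π * Y ^ 2 : ℝ) * I) = -1
    · exact Or.inr ⟨hX0, hne⟩
    · exact Or.inl (shiftOscillates_of_eq_zero (by rw [hz, hX0]) hY hne)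
  · left
    obtain ⟨K, hK⟩ := exists_phase_eq_two_mul hX0 hY.ne'
    by_cases hhalf : ∀ n : ℤ, (n : ℝ) - 1 / 2 ≠ X
    · exact shiftOscillates_of_not_half_int hz hY hhalf two_pos hK
    · push Not at hhalf
      obtain ⟨n, hn⟩ := hhalf
      refine shiftOscillates_of_one_lt hz ?_ hK
      have h1 : (0 : ℝ) ≤ n * (n - 1) := by
        rcases le_or_gt n 0 with hm | hm
        · have : (n : ℝ) ≤ 0 := by exact_mod_cast hm
          nlinarith
        · have : (1 : ℝ) ≤ n := by exact_mod_cast hm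
          nlinarith
      have h2 : 4 * X ^ 2 = 4 * (n * (n - 1)) + 1 := by rw [← hn]; ring
      by_contra! hY1
      nlinarith [mul_nonneg hY.le (sub_nonneg.2 hY1)]

lemma mul_exp_pi_div_four (z : ℂ) : z * exp ((π / 4 : ℂ) * I) =
    2 * (√π : ℝ) * (((z.re - z.im) / (2 * √(2 * π)) : ℝ) + ((z.re + z.im) / (2 * √(2 * π)) : ℝ) * I) := by
  have h1 : exp ((π / 4 : ℂ) * I) = ((√2 / 2 : ℝ) : ℂ) + ((√2 / 2 : ℝ) : ℂ) * I := by
    rw [show (π / 4 : ℂ) = ((π / 4 : ℝ) : ℂ) by push_cast; rfl, exp_mul_I, ← ofReal_cos, ← ofReal_sin,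
      Real.cos_pi_div_four, Real.sin_pi_div_four]
  have h2 : √2 * √2 = 2 := Real.mul_self_sqrt (by norm_num)
  have hp : √π ≠ 0 := (Real.sqrt_pos.2 Real.pi_pos).ne'
  have hs : √2 ≠ 0 := by positivity
  have h3 : ∀ a : ℝ, 2 * √π * (a / (2 * √(2 * π))) = √2 / 2 * a := by
    intro a
    rw [Real.sqrt_mul (by norm_num)]
    field_simp
    linear_combination (-a) * h2
  rw [h1, show (2 * (√π : ℝ) : ℂ) = ((2 * √π : ℝ) : ℂ) by push_cast; ring,
    mul_add ((2 * √π : ℝ) : ℂ), ← mul_assoc ((2 * √π : ℝ) : ℂ),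
    ← ofReal_mul, ← ofReal_mul, h3, h3]
  apply Complex.ext
  · simp; ring
  · simp; ring

lemma four_mul_sq_lt_of_mem_regionD (hz : z ∈ regionD) :
    4 * ((z.re + z.im) / (2 * √(2 * π))) ^ 2 <
      (1 - 2 * |(z.re - z.im) / (2 * √(2 * π))|) ^ 2 := by
  have h : |z.re - z.im| < √(π / 2) - √(2 / π) * z.re * z.im := hz
  have hpi := Real.pi_pos
  set s := √(2 * π) with hs
  have hs0 : 0 < s := Real.sqrt_pos.2 (by positivity)
  have hss : s * s = 2 * π := Real.mul_self_sqrt (by positivity)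
  have e1 : √(π / 2) = s / 2 := by
    rw [Real.sqrt_eq_iff_mul_self_eq (by positivity) (by positivity)]
    linear_combination -hss / 4
  have e2 : √(2 / π) = 2 / s := by
    rw [Real.sqrt_eq_iff_mul_self_eq (by positivity) (by positivity), div_mul_div_comm, hss]
    field_simp
  rw [e1, e2] at h
  rw [abs_div, abs_of_pos (show 0 < 2 * s by positivity)]
  set a := |z.re - z.im| with ha
  have haa : a ^ 2 = (z.re - z.im) ^ 2 := sq_abs _
  have h2 : s * a < s ^ 2 / 2 - 2 * z.re * z.im := by
    have := mul_lt_mul_of_pos_left h hs0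
    have e3 : s * (s / 2 - 2 / s * z.re * z.im) = s ^ 2 / 2 - 2 * z.re * z.im := by
      field_simp
    linarith
  have e4 : 4 * ((z.re + z.im) / (2 * s)) ^ 2 = (z.re + z.im) ^ 2 / s ^ 2 := by
    field_simp
    ring
  have e5 : (1 - 2 * (a / (2 * s))) ^ 2 = (s - a) ^ 2 / s ^ 2 := by
    field_simp
  rw [e4, e5]
  gcongr ?_ / _
  nlinarith

/-- On this line `I * conj z = -z`, so both halves of the kernel are the same even function of `z`,
and their weights are `1` and `exp (z²/4) = -1`. -/
lemma shiftKernel_eq_zero (hz : z * exp ((π / 4 : ℂ) * I) = 2 * (√π : ℝ) * (X + (0 : ℝ) * I))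
    (hX : exp ((π * X ^ 2 : ℝ) * I) = -1) : shiftKernel z = 0 := by
  have h1 := I_mul_conj_mul_exp hz
  have h2 : I * (starRingEnd ℂ) z = -z := by
    apply mul_right_cancel₀ (exp_ne_zero ((π / 4 : ℂ) * I))
    rw [h1, neg_mul, hz]
    push_cast
    ring
  have h3 : exp (z ^ 2 / 4) = -1 := by
    rw [sq_div_four_eq hz, show -I * (π * ((X : ℂ) + (0 : ℝ) * I) ^ 2) = -((π * X ^ 2 : ℝ) * I) by
      push_cast; ring, Complex.exp_neg, hX]
    norm_num
  ext y
  rw [shiftKernel, h2, h3, thetaKernel_neg_left]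
  simp

/-- In the region, one of `z` and its conjugate oscillates unless the kernel vanishes identically. -/
lemma shiftOscillates_of_mem_regionD (hz : z ∈ regionD) :
    ShiftOscillates z ∨ ShiftOscillates ((starRingEnd ℂ) z) ∨ shiftKernel z = 0 := by
  have hlt := four_mul_sq_lt_of_mem_regionD hz
  have h1 := mul_exp_pi_div_four z
  have h2 := mul_exp_pi_div_four ((starRingEnd ℂ) z)
  rw [conj_re, conj_im, sub_neg_eq_add, ← sub_eq_add_neg] at h2
  set X := (z.re - z.im) / (2 * √(2 * π))
  set Y := (z.re + z.im) / (2 * √(2 * π))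
  have neg_coord : ∀ {w : ℂ} {a b : ℝ}, w * exp ((π / 4 : ℂ) * I) = 2 * (√π : ℝ) * (a + b * I) →
      (-w) * exp ((π / 4 : ℂ) * I) = 2 * (√π : ℝ) * ((-a : ℝ) + (-b : ℝ) * I) := by
    intro w a b h
    push_cast
    linear_combination -h
  -- The coordinates of the conjugate are `(Y, X)`. For `X ≠ 0` the conjugate, up to sign, has
  -- positive second coordinate `|X|`; for `X = 0` it would have none, and `z` itself is used.
  rcases lt_trichotomy X 0 with hX | hX | hX
  · rw [abs_of_neg hX] at hlt
    rcases shiftOscillates_or_exceptional (neg_coord h2) (neg_pos.2 hX) (by rwa [neg_sq]) with h | ⟨h, h'⟩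
    · exact Or.inr (Or.inl h.of_neg)
    · rw [neg_eq_zero] at h
      rw [neg_sq] at h'
      exact Or.inr (Or.inr (shiftKernel_eq_zero (by rw [h1, h]) h'))
  · rw [hX, abs_zero, mul_zero, sub_zero, one_pow] at hlt
    left
    have hne : exp ((π * Y ^ 2 : ℝ) * I) ≠ -1 := by
      intro h
      have hre := congrArg re h
      rw [exp_ofReal_mul_I_re, neg_re, one_re] at hre
      have : 0 < Real.cos (π * Y ^ 2) := Real.cos_pos_of_mem_Ioo
        ⟨by have := Real.pi_pos; have := sq_nonneg Y; nlinarith, by have := Real.pi_pos; nlinarith⟩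
      linarith
    rcases lt_trichotomy Y 0 with hY | hY | hY
    · refine (shiftOscillates_of_eq_zero (Y := -Y) ?_ (neg_pos.2 hY) (by rwa [neg_sq])).of_neg
      rw [neg_coord h1, hX, neg_zero]
    · rw [hX, hY] at h1
      have h0 : z = 0 := by
        have : z * exp ((π / 4 : ℂ) * I) = 0 := by rw [h1]; simp
        exact (mul_eq_zero.1 this).resolve_right (exp_ne_zero _)
      rw [h0]
      exact shiftOscillates_zero
    · exact shiftOscillates_of_eq_zero (by rw [h1, hX]) hY hne
  · rw [abs_of_pos hX] at hlt
    rcases shiftOscillates_or_exceptional h2 hX hlt with h | ⟨h, h'⟩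
    · exact Or.inr (Or.inl h)
    · exact Or.inr (Or.inr (shiftKernel_eq_zero (by rw [h1, h]) h'))

/-! ### Reflection symmetry and sign changes -/

/-- Passing to the conjugate of `z` reverses the critical line, so oscillation for the conjugate at
`+∞` gives zeros for `z` towards `-∞`, with negated frequencies. -/
lemma lineTransform_shiftKernel_conj (z : ℂ) (u : ℝ) :
    lineTransform (shiftKernel ((starRingEnd ℂ) z)) (-u) = lineTransform (shiftKernel z) u := by
  have h1 : (starRingEnd ℂ) (lineTransform (thetaKernel (I * (starRingEnd ℂ) z)) u) =
      lineTransform (thetaKernel (I * z)) (-u) := by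
    rw [lineTransform, ← integral_conj, lineTransform]
    congr 1
    ext x
    rw [map_mul, thetaKernel_conj, ← exp_conj, conj_ofReal, map_mul, conj_I, conj_conj, neg_mul,
      thetaKernel_neg_left]
    congr 2
    simp
  rw [lineTransform_shiftKernel, lineTransform_shiftKernel, conj_conj, ← h1, conj_conj, add_comm]

lemma shiftSum_shiftKernel_conj (c lam : ℕ → ℝ) (z : ℂ) (t : ℝ) :
    shiftSum c (fun j => -lam j) (shiftKernel ((starRingEnd ℂ) z)) t =
      shiftSum c lam (shiftKernel z) (-t) := by
  refine tsum_congr fun j => ?_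
  rw [← lineTransform_shiftKernel_conj z]
  congr 2
  ring

lemma shiftSum_neg (c lam : ℕ → ℝ) (h : ℂ → ℂ) (t : ℝ) :
    shiftSum (fun j => -c j) lam h t = -shiftSum c lam h t := by
  rw [shiftSum, shiftSum, ← tsum_neg]
  refine tsum_congr fun j => ?_
  push_cast
  ring

lemma infinite_zeros_of_sign_changes {f : ℝ → ℝ} (hf : Continuous f)
    (hneg : ∀ T, ∃ t, T ≤ t ∧ f t < 0) (hpos : ∀ T, ∃ t, T ≤ t ∧ 0 < f t) :
    {t | f t = 0}.Infinite := by
  intro hfin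
  obtain ⟨T, hT⟩ := hfin.bddAbove
  obtain ⟨a, ha, hfa⟩ := hneg (T + 1)
  obtain ⟨b, hb, hfb⟩ := hpos (T + 1)
  obtain ⟨x, hx, hx0⟩ := intermediate_value_uIcc (a := a) (b := b) hf.continuousOn
    (show (0 : ℝ) ∈ uIcc (f a) (f b) from mem_uIcc.2 (Or.inl ⟨hfa.le, hfb.le⟩))
  have h1 : T + 1 ≤ x := (le_inf ha hb).trans hx.1
  linarith [hT hx0]

/-- `ShiftOscillates` quantifies over all coefficient sequences; applied to `-c` it gives positive
values as well. -/
lemma ShiftOscillates.infinite_zeros (hz : ShiftOscillates z) {c lam : ℕ → ℝ} {B : ℝ} {M : ℕ}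
    (hsum : Summable fun j => |c j|) (hB : ∀ j, |lam j| ≤ B) (hinj : Function.Injective lam)
    (hM : ∀ j, lam j ≤ lam M) (hc : c M ≠ 0) :
    {t | shiftSum c lam (shiftKernel z) t = 0}.Infinite := by
  have hcont := (stripDecay_shiftKernel z).continuous_shiftSum (lam := lam) hsum
  have key := infinite_zeros_of_sign_changes (continuous_re.comp hcont)
    (hz c lam B M hsum hB hinj hM hc) fun T => by
      obtain ⟨t, h1, h2⟩ := hz (fun j => -c j) lam B M (by simpa using hsum) hB hinj hM
        (neg_ne_zero.2 hc) T
      rw [shiftSum_neg, neg_re, neg_lt_zero] at h2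
      exact ⟨t, h1, h2⟩
  refine key.mono fun t ht => ?_
  exact Complex.ext ht (shiftSum_shiftKernel_im hsum z t)

lemma shiftSum_zeros_infinite {c lam : ℕ → ℝ}
    (hc : ∀ j, c j ≠ 0) (hsum : Summable fun j => |c j|)
    (hbdd : Bornology.IsBounded (Set.range lam)) (hinj : Function.Injective lam)
    (hmax : ∃ M, ∀ j, lam j ≤ lam M) (hmin : ∃ m, ∀ j, lam m ≤ lam j) (hz : z ∈ regionD) :
    {t | shiftSum c lam (shiftKernel z) t = 0}.Infinite := by
  obtain ⟨B, hB⟩ := isBounded_iff_forall_norm_le.1 hbdd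
  have hB' : ∀ j, |lam j| ≤ B := fun j => hB _ (mem_range_self j)
  obtain ⟨M, hM⟩ := hmax
  obtain ⟨m, hm⟩ := hmin
  rcases shiftOscillates_of_mem_regionD hz with h | h | h
  · exact h.infinite_zeros hsum hB' hinj hM (hc M)
  · have key := h.infinite_zeros hsum (lam := fun j => -lam j) (M := m) (by simpa using hB')
      (fun i j hij => hinj (neg_injective hij)) (fun j => neg_le_neg (hm j)) (hc m)
    refine (key.image neg_injective.injOn).mono ?_
    rintro _ ⟨t, ht, rfl⟩
    rw [mem_ofPred_eq, shiftSum_shiftKernel_conj] at ht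
    exact ht
  -- In the exceptional case the kernel is zero, so the sum vanishes at every `t`.
  · rw [h]
    have : {t | shiftSum c lam 0 t = 0} = univ := by
      ext t
      simp [shiftSum, lineTransform]
    rw [this]
    exact infinite_univ

end oscillation

theorem theorem2 (c lam : ℕ → ℝ)
    (hc : ∀ j, c j ≠ 0) (hsum : Summable fun j => |c j|)
    (hbdd : Bornology.IsBounded (Set.range lam)) (hinj : Function.Injective lam)
    (hmax : ∃ M, ∀ j, lam j ≤ lam M) (hmin : ∃ m, ∀ j, lam m ≤ lam j)
    (z : ℂ) (hz : z ∈ regionD) :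
    (∀ s : ℂ, s.re = 1 / 2 → Summable (shiftTerm c lam z s)) ∧
      {s : ℂ | s.re = 1 / 2 ∧ shiftF c lam z s = 0}.Infinite := by
  have hterm : ∀ t : ℝ, shiftTerm c lam z (1 / 2 + I * t) =
      fun j => (c j : ℂ) * lineTransform (shiftKernel z) (t + lam j) :=
    fun t => funext (shiftTerm_critical c lam z t)
  constructor
  · intro s hs
    have hs' : s = 1 / 2 + I * s.im := Complex.ext (by simp [hs]) (by simp)
    rw [hs', hterm]
    exact (stripDecay_shiftKernel z).summable_shift hsum _
  · have hinj2 : Function.Injective fun t : ℝ => (1 / 2 + I * t : ℂ) := by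
      intro a b hab
      simpa using hab
    refine ((shiftSum_zeros_infinite hc hsum hbdd hinj hmax hmin hz).image hinj2.injOn).mono ?_
    rintro _ ⟨t, ht, rfl⟩
    refine ⟨by simp, ?_⟩
    rw [shiftF, hterm]
    exact ht
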